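/- Let $N\ge 2$, $0<q<1$, and let $k\in\mathbb{C}^\times$ satisfy $k^{2j}\notin q^{\mathbb{Z}}$ for $1\le j\le N$. Put $T=(\mathbb{C}^\times)^N$ and let $W=S_N\ltimes\mathbb{Z}^N$ act on $T$ by $(ut)_i=t_{u^{-1}(i)}$ for $u\in S_N$ and $\lambda t=q^\lambda t=(q^{\lambda_1}t_1,\dots,q^{\lambda_N}t_N)$ for $\lambda\in\mathbb{Z}^N$, and on $\mathbb{C}(T)$ by $(wf)(t)=f(w^{-1}t)$. Inside the algebra $\mathbb{C}(T)\#W$ of $q$-difference reflection operators on $\mathbb{C}(T)$ put, for $1\le i<N$, \[T_i=k+\frac{k^{-1}-kX_i/X_{i+1}}{1-X_i/X_{i+1}}(s_i-1),\qquad (\pi f)(t)=f(t_2,\dots,t_N,q^{-1}t_1),\] \[Y_i=T_{i-1}^{-1}\cdots T_1^{-1}\,\pi\,T_{N-1}\cdots T_i\quad(1\le i\le N),\] where $X_i$ is multiplication by the $i$-th coordinate function. Put $T_w=T_{i_1}\cdots T_{i_r}$ for a reduced expression $w=s_{i_1}\cdots s_{i_r}\in S_N$, and $Y^\nu=Y_1^{\nu_1}\cdots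 Y_N^{\nu_N}$ for $\nu\in\mathbb{Z}^N$. The $T_wY^\nu$ form a left $\mathbb{C}(T)$-basis of $\mathbb{C}(T)\#W$ (PBW), and the $T_w$ ($w\in S_N$) form a basis of the finite Hecke algebra $H_0$. For $w\in W$ let $C_{(w,e)}(t,\gamma)$ be the $\mathrm{End}(H_0)$-valued function on $T\times T$, rational in $t$ and Laurent polynomial in $\gamma$, given by \[C_{(w,e)}(t,\gamma)T_v=\sum_{u\in S_N,\,\nu\in\mathbb{Z}^N}a_{u,\nu}(t)\gamma^\nu T_u\quad\text{if}\quad wT_v=\sum_{u,\nu}a_{u,\nu}(X)T_uY^\nu .\] (Here $w\in\mathbb{C}(T)\#W$ is the normalized affine intertwiner.) Let $C_\iota$ be the linear map $T_w\mapsto T_{w^{-1}}$ of $H_0$, and put $C_{(e,w)}(t,\gamma)=C_\iota\,C_{(w,e)}(\gamma^{-1},t^{-1})\,C_\iota$. The quantum KZ equations with central character $\zeta\in T$, for an $H_0$-valued function $f$ on $T$, are \[C_{(\nu,e)}(t,\zeta)f(q^{-\nu}t)=f(t)\qquad\text{for all }\nu\in\mathbb{Z}^N,\] and $f$ is called $S_N$-invariant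 if $C_{(u,e)}(t,\zeta)f(u^{-1}t)=f(t)$ for all $u\in S_N$ (the function $C_{(u,e)}$ does not depend on $\zeta$). Let $\delta=(N-1,N-3,\dots,1-N)$, let $k^{\pm\delta}=(k^{\pm\delta_1},\dots,k^{\pm\delta_N})$, let $\Lambda=\{\lambda\in\mathbb{Z}^N:\lambda_1\ge\dots\ge\lambda_N\}$, and let $v_+=\sum_{w\in S_N}k^{\ell(w)}T_w$. Then: 1. For $\lambda\in\Lambda$, the function $\gamma\mapsto C_{(e,\lambda)}(\cdot,\gamma)$ is regular at $\gamma=k^{-\delta}$, the value $C_{(e,\lambda)}(\cdot,k^{-\delta})$ is invertible in $\mathbb{C}[T]\otimes\mathrm{End}(H_0)$, and the $H_0$-valued Laurent polynomial \[Q_\lambda:=C_{(e,\lambda)}(\cdot,k^{-\delta})^{-1}v_+\] is an $S_N$-invariant solution of the quantum KZ equations with central character $q^\lambda k^{-\delta}$. 2. (Self-duality) For all $\lambda,\mu\in\Lambda$, \[Q_\lambda(q^{-\mu}k^{\delta})=C_\iota\,Q_\mu(q^{-\lambda}k^{\delta})\quad\text{in }H_0 .\] -/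

import Mathlib

namespace BqKZ

noncomputable section

/-! Throughout `N = n + 1`, the indices `1, …, N` are the elements of `Fin (n + 1)`, and
`Fin n` indexes the simple reflections `s_1, …, s_{N-1}`. -/

/-- The complex torus `T = (ℂˣ)^N`; it is a group under pointwise multiplication. -/
abbrev Torus (n : ℕ) : Type := Fin (n + 1) → ℂˣ

/-- The lattice `ℤ^N`. -/
abbrev Lattice (n : ℕ) : Type := Fin (n + 1) → ℤ

/-- The field `ℂ(T) = ℂ(x_1, …, x_N)` of rational functions on `T`. -/
abbrev RatFun (n : ℕ) : Type := FractionRing (MvPolynomial (Fin (n + 1)) ℂ)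

/-- The algebra `ℂ[T] = ℂ[x_1^{±1}, …, x_N^{±1}]` of regular functions on `T`;
`AddMonoidAlgebra.single ν 1` is the monomial `x^ν`. -/
abbrev Laurent (n : ℕ) : Type := AddMonoidAlgebra ℂ (Lattice n)

/-! ### Points, monomials, evaluation -/

/-- The monomial map `ν ↦ t^ν = t_1^{ν_1} ⋯ t_N^{ν_N}` for units `t_1, …, t_N`. -/
def monom {n : ℕ} {A : Type*} [CommRing A] (t : Fin (n + 1) → Aˣ) :
    Multiplicative (Lattice n) →* A where
  toFun ν := ((∏ i, t i ^ (Multiplicative.toAdd ν i) : Aˣ) : A)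
  map_one' := by simp
  map_mul' a b := by
    rw [← Units.val_mul, ← Finset.prod_mul_distrib]
    simp [zpow_add]

/-- Evaluation of a Laurent polynomial at a point of `T`. -/
def evalL {n : ℕ} (t : Torus n) : Laurent n →ₐ[ℂ] ℂ :=
  AddMonoidAlgebra.lift ℂ ℂ (Lattice n) (monom t)

/-- The coordinate function `x_i` in `ℂ(T)`. -/
def xvar {n : ℕ} (i : Fin (n + 1)) : RatFun n :=
  algebraMap (MvPolynomial (Fin (n + 1)) ℂ) (RatFun n) (MvPolynomial.X i)

theorem xvar_ne_zero {n : ℕ} (i : Fin (n + 1)) : xvar i ≠ (0 : RatFun n) := by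
  unfold xvar
  rw [Ne, FaithfulSMul.algebraMap_eq_zero_iff]
  exact MvPolynomial.X_ne_zero i

/-- The inclusion `ℂ[T] ⊂ ℂ(T)`. -/
def toRat {n : ℕ} : Laurent n →ₐ[ℂ] RatFun n :=
  AddMonoidAlgebra.lift ℂ (RatFun n) (Lattice n)
    (monom fun i => Units.mk0 (xvar i) (xvar_ne_zero i))

/-- The rational function `f` is regular at `t ∈ T`, with value `z` there. -/
def HasValueAt {n : ℕ} (t : Torus n) (f : RatFun n) (z : ℂ) : Prop :=
  ∃ p r : MvPolynomial (Fin (n + 1)) ℂ,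
    MvPolynomial.eval (fun i => (t i : ℂ)) r ≠ 0 ∧
    f * algebraMap _ (RatFun n) r = algebraMap _ (RatFun n) p ∧
    z = MvPolynomial.eval (fun i => (t i : ℂ)) p / MvPolynomial.eval (fun i => (t i : ℂ)) r

theorem HasValueAt.unique {n : ℕ} {t : Torus n} {f : RatFun n} {z z' : ℂ}
    (h : HasValueAt t f z) (h' : HasValueAt t f z') : z = z' := by
  obtain ⟨p, r, hr, hf, rfl⟩ := h
  obtain ⟨p', r', hr', hf', rfl⟩ := h'
  have key : p * r' = p' * r := by
    apply FaithfulSMul.algebraMap_injective (MvPolynomial (Fin (n + 1)) ℂ) (RatFun n)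
    rw [map_mul, map_mul, ← hf, ← hf']
    ring
  rw [div_eq_div_iff hr hr', ← map_mul, ← map_mul, key]

/-- `f ∈ ℂ(T)` is regular at `t`. -/
def RegularAt {n : ℕ} (t : Torus n) (f : RatFun n) : Prop := ∃ z, HasValueAt t f z

/-- The value `f(t)` of a rational function that is regular at `t`. -/
def ratEval {n : ℕ} (t : Torus n) (f : RatFun n) : ℂ :=
  Classical.epsilon (HasValueAt t f)

/-- `q^ν = (q^{ν_1}, …, q^{ν_N}) ∈ T`. -/
def tpow {n : ℕ} (q : ℂˣ) (ν : Lattice n) : Torus n := fun i => q ^ ν i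

/-- `δ = (N - 1, N - 3, …, 1 - N)`. -/
def delta (n : ℕ) : Lattice n := fun i => (n : ℤ) - 2 * (i : ℕ)

/-- The cone `Λ` of dominant weights `ν_1 ≥ ν_2 ≥ ⋯ ≥ ν_N`. -/
def Dominant {n : ℕ} (ν : Lattice n) : Prop := Antitone ν

/-! ### The extended affine Weyl group `W = S_N ⋉ ℤ^N` acting on `ℂ(T)` -/

/-- `(w f)(t) = f(w⁻¹ t)` for `w ∈ S_N`, where `(w t)_i = t_{w⁻¹ i}`; thus `x_i ↦ x_{w i}`. -/
def permOp {n : ℕ} (w : Equiv.Perm (Fin (n + 1))) : RatFun n ≃ₗ[ℂ] RatFun n :=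
  (IsFractionRing.algEquivOfAlgEquiv (K := RatFun n) (L := RatFun n)
    (MvPolynomial.renameEquiv ℂ w)).toLinearEquiv

/-- Rescaling of the coordinates of a polynomial: `x_i ↦ a_i x_i`. -/
def scaleEquiv {n : ℕ} (a : Torus n) :
    MvPolynomial (Fin (n + 1)) ℂ ≃ₐ[ℂ] MvPolynomial (Fin (n + 1)) ℂ :=
  AlgEquiv.ofAlgHom
    (MvPolynomial.aeval fun i => MvPolynomial.C (a i : ℂ) * MvPolynomial.X i)
    (MvPolynomial.aeval fun i => MvPolynomial.C ((a i)⁻¹ : ℂˣ).val * MvPolynomial.X i)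
    (by
      ext1 i
      simp only [AlgHom.comp_apply, MvPolynomial.aeval_X, map_mul, AlgHom.id_apply,
        MvPolynomial.aeval_C, MvPolynomial.algebraMap_eq]
      rw [← mul_assoc, ← MvPolynomial.C_mul, Units.inv_mul, MvPolynomial.C_1, one_mul])
    (by
      ext1 i
      simp only [AlgHom.comp_apply, MvPolynomial.aeval_X, map_mul, AlgHom.id_apply,
        MvPolynomial.aeval_C, MvPolynomial.algebraMap_eq]
      rw [← mul_assoc, ← MvPolynomial.C_mul, Units.mul_inv, MvPolynomial.C_1, one_mul])

/-- `(ν f)(t) = f(q^{-ν} t)` for `ν ∈ ℤ^N`; thus `x_i ↦ q^{-ν_i} x_i`. -/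
def shiftOp {n : ℕ} (q : ℂˣ) (ν : Lattice n) : RatFun n ≃ₗ[ℂ] RatFun n :=
  (IsFractionRing.algEquivOfAlgEquiv (K := RatFun n) (L := RatFun n)
    (scaleEquiv (tpow q (-ν)))).toLinearEquiv

/-- The action on `ℂ(T)` of the element `ν u` of `W = S_N ⋉ ℤ^N` (`ν ∈ ℤ^N`, `u ∈ S_N`).
Every element of `W` is of this form in exactly one way. -/
def weylOp {n : ℕ} (q : ℂˣ) (ν : Lattice n) (u : Equiv.Perm (Fin (n + 1))) :
    RatFun n ≃ₗ[ℂ] RatFun n :=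
  shiftOp q ν * permOp u

/-- The simple transposition `s_i`. -/
def simple {n : ℕ} (i : Fin n) : Equiv.Perm (Fin (n + 1)) := Equiv.swap i.castSucc i.succ

/-- `l` is a reduced word for `w ∈ S_N`. -/
def IsReducedWord {n : ℕ} (l : List (Fin n)) (w : Equiv.Perm (Fin (n + 1))) : Prop :=
  (l.map simple).prod = w ∧ ∀ l' : List (Fin n), (l'.map simple).prod = w → l.length ≤ l'.length

theorem exists_isReducedWord {n : ℕ} (w : Equiv.Perm (Fin (n + 1))) :
    ∃ l : List (Fin n), IsReducedWord l w := by
  classical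
  have hex : ∃ l : List (Fin n), (l.map simple).prod = w := by
    have hw : w ∈ Submonoid.closure
        (Set.range fun i : Fin n => Equiv.swap i.castSucc i.succ) := by
      rw [Equiv.Perm.mclosure_swap_castSucc_succ]
      trivial
    induction hw using Submonoid.closure_induction with
    | mem x hx =>
      obtain ⟨i, rfl⟩ := hx
      exact ⟨[i], by simp [simple]⟩
    | one => exact ⟨[], by simp⟩
    | mul x y _ _ hx hy =>
      obtain ⟨l, rfl⟩ := hx
      obtain ⟨l', rfl⟩ := hy
      exact ⟨l ++ l', by simp⟩
  have hlen : ∃ m : ℕ, ∃ l : List (Fin n), (l.map simple).prod = w ∧ l.length = m := by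
    obtain ⟨l, hl⟩ := hex
    exact ⟨l.length, l, hl, rfl⟩
  obtain ⟨l, hl, hm⟩ := Nat.find_spec hlen
  exact ⟨l, hl, fun l' hl' => hm ▸ Nat.find_min' hlen ⟨l', hl', rfl⟩⟩

/-- A reduced word for `w`. -/
def redWord {n : ℕ} (w : Equiv.Perm (Fin (n + 1))) : List (Fin n) :=
  Classical.choose (exists_isReducedWord w)

/-- The length `ℓ(w)` of `w ∈ S_N`. -/
def len {n : ℕ} (w : Equiv.Perm (Fin (n + 1))) : ℕ := (redWord w).length

/-- `π = σ ε_N`, with `σ = s_1 ⋯ s_{N-1}` the rotation `i ↦ i + 1`, `N ↦ 1`; hence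
`π (t_1, …, t_N) = (q t_N, t_1, …, t_{N-1})`. -/
def piOp {n : ℕ} (q : ℂˣ) : RatFun n ≃ₗ[ℂ] RatFun n :=
  permOp (finRotate (n + 1)) * shiftOp q (Pi.single (Fin.last n) 1)

/-! ### The affine Hecke algebra inside the `q`-difference reflection operators

The smashed product `ℂ(T) # W` acts faithfully on `ℂ(T)` and is identified with its image, the
algebra of `q`-difference reflection operators, inside `Module.End ℂ (RatFun n)`. -/

/-- `c_k(z) = (k⁻¹ - k z) / (1 - z)`, as an element of `ℂ(T)`. -/
def cfun {n : ℕ} (k : ℂˣ) (z : RatFun n) : RatFun n :=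
  (algebraMap ℂ (RatFun n) (k⁻¹ : ℂˣ).val - algebraMap ℂ (RatFun n) (k : ℂ) * z) / (1 - z)

/-- `T_i = k + c_k(x_i / x_{i+1}) (s_i - 1)`. -/
def heckeOp {n : ℕ} (k : ℂˣ) (i : Fin n) : Module.End ℂ (RatFun n) :=
  (k : ℂ) • 1 + cfun k (xvar i.castSucc / xvar i.succ) •
    ((permOp (simple i)).toLinearMap - 1 : Module.End ℂ (RatFun n))

theorem permOp_mul {n : ℕ} (w : Equiv.Perm (Fin (n + 1))) (f g : RatFun n) :
    permOp w (f * g) = permOp w f * permOp w g := by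
  simp [permOp]

theorem permOp_div {n : ℕ} (w : Equiv.Perm (Fin (n + 1))) (f g : RatFun n) :
    permOp w (f / g) = permOp w f / permOp w g := by
  simp [permOp]

theorem permOp_xvar {n : ℕ} (w : Equiv.Perm (Fin (n + 1))) (i : Fin (n + 1)) :
    permOp w (xvar i) = (xvar (w i) : RatFun n) := by
  simp [permOp, xvar]

theorem permOp_algebraMap {n : ℕ} (w : Equiv.Perm (Fin (n + 1))) (a : ℂ) :
    permOp w (algebraMap ℂ (RatFun n) a) = algebraMap ℂ (RatFun n) a := by
  simp [permOp]

theorem permOp_one {n : ℕ} (w : Equiv.Perm (Fin (n + 1))) :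
    permOp w (1 : RatFun n) = 1 := by
  simp [permOp]

theorem permOp_simple_simple {n : ℕ} (i : Fin n) (f : RatFun n) :
    permOp (simple i) (permOp (simple i) f) = f := by
  have h : ∀ p : MvPolynomial (Fin (n + 1)) ℂ, permOp (simple i)
      (permOp (simple i) (algebraMap _ (RatFun n) p)) = algebraMap _ (RatFun n) p := by
    intro p
    have hs : (⇑(simple i) ∘ ⇑(simple i) : Fin (n + 1) → Fin (n + 1)) = id := by
      funext j
      simp [simple]
    simp [permOp, MvPolynomial.rename_rename, hs]
  obtain ⟨p, r, hr, rfl⟩ := IsFractionRing.div_surjective (A := MvPolynomial (Fin (n + 1)) ℂ) f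
  rw [permOp_div, permOp_div, h, h]

theorem xvar_sub_ne_zero {n : ℕ} {i j : Fin (n + 1)} (h : i ≠ j) :
    (xvar i - xvar j : RatFun n) ≠ 0 := by
  intro h0
  apply h
  apply MvPolynomial.X_injective (σ := Fin (n + 1)) (R := ℂ)
  apply FaithfulSMul.algebraMap_injective (MvPolynomial (Fin (n + 1)) ℂ) (RatFun n)
  exact sub_eq_zero.mp h0

theorem heckeOp_apply {n : ℕ} (k : ℂˣ) (i : Fin n) (f : RatFun n) :
    heckeOp k i f = algebraMap ℂ (RatFun n) k * f +
      cfun k (xvar i.castSucc / xvar i.succ) * (permOp (simple i) f - f) := by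
  simp [heckeOp, Algebra.smul_def]

/-- The quadratic relation `(T_i - k)(T_i + k⁻¹) = 0`, in the form `T_i (T_i - k + k⁻¹) = 1`. -/
theorem heckeOp_quadratic {n : ℕ} (k : ℂˣ) (i : Fin n) (f : RatFun n) :
    heckeOp k i (heckeOp k i f) =
      algebraMap ℂ (RatFun n) ((k : ℂ) - (k⁻¹ : ℂˣ).val) * heckeOp k i f + f := by
  have hne : (i.castSucc : Fin (n + 1)) ≠ i.succ := (Fin.castSucc_lt_succ).ne
  have hx := xvar_ne_zero (n := n) i.castSucc
  have hy := xvar_ne_zero (n := n) i.succ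
  have hxy := xvar_sub_ne_zero (n := n) hne
  have hyx := xvar_sub_ne_zero (n := n) hne.symm
  have hk : (algebraMap ℂ (RatFun n) (k⁻¹ : ℂˣ).val) * algebraMap ℂ (RatFun n) k = 1 := by
    rw [← map_mul, Units.inv_mul, map_one]
  have hc : permOp (simple i) (cfun k (xvar i.castSucc / xvar i.succ)) =
      (cfun k (xvar i.succ / xvar i.castSucc) : RatFun n) := by
    unfold cfun
    rw [permOp_div, map_sub, permOp_algebraMap, permOp_mul, permOp_algebraMap, map_sub,
      permOp_one, permOp_div, permOp_xvar, permOp_xvar]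
    simp [simple]
  have hsum : (cfun k (xvar i.castSucc / xvar i.succ) : RatFun n) +
      cfun k (xvar i.succ / xvar i.castSucc) =
      algebraMap ℂ (RatFun n) (k⁻¹ : ℂˣ).val + algebraMap ℂ (RatFun n) k := by
    have h1 : (1 - xvar i.castSucc / xvar i.succ : RatFun n) ≠ 0 := by
      rw [one_sub_div hy]
      exact div_ne_zero hyx hy
    have h2 : (1 - xvar i.succ / xvar i.castSucc : RatFun n) ≠ 0 := by
      rw [one_sub_div hx]
      exact div_ne_zero hxy hx
    unfold cfun
    rw [div_add_div _ _ h1 h2, div_eq_iff (mul_ne_zero h1 h2)]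
    field_simp
    ring
  simp only [heckeOp_apply, map_add, map_sub, permOp_mul, permOp_algebraMap,
    permOp_simple_simple, hc]
  rw [← sub_eq_iff_eq_add'.mpr hsum.symm]
  linear_combination f * hk

/-- `T_i` as an invertible operator, with inverse `T_i - k + k⁻¹`. -/
def heckeEquiv {n : ℕ} (k : ℂˣ) (i : Fin n) : RatFun n ≃ₗ[ℂ] RatFun n :=
  LinearEquiv.ofLinearMap (heckeOp k i)
    (heckeOp k i - ((k : ℂ) - (k⁻¹ : ℂˣ).val) • (1 : Module.End ℂ (RatFun n)))
    (by
      ext1 f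
      have h := heckeOp_quadratic k i f
      simp only [LinearMap.comp_apply, LinearMap.sub_apply, LinearMap.smul_apply,
        Module.End.one_apply, LinearMap.id_apply, map_sub (heckeOp k i),
        map_smul (heckeOp k i)]
      rw [h, Algebra.smul_def]
      ring)
    (by
      ext1 f
      have h := heckeOp_quadratic k i f
      simp only [LinearMap.comp_apply, LinearMap.sub_apply, LinearMap.smul_apply,
        Module.End.one_apply, LinearMap.id_apply]
      rw [h, Algebra.smul_def]
      ring)

/-- `T_w = T_{i_1} ⋯ T_{i_r}` for a reduced expression `w = s_{i_1} ⋯ s_{i_r}` of `w ∈ S_N`. -/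
def heckeT {n : ℕ} (k : ℂˣ) (w : Equiv.Perm (Fin (n + 1))) : RatFun n ≃ₗ[ℂ] RatFun n :=
  ((redWord w).map (heckeEquiv k)).prod

/-- `Y_i = T_{i-1}⁻¹ ⋯ T_1⁻¹ π T_{N-1} ⋯ T_i`. -/
def yOp {n : ℕ} (q k : ℂˣ) (i : Fin (n + 1)) : RatFun n ≃ₗ[ℂ] RatFun n :=
  ((((List.finRange n).filter fun j => j.castSucc < i).map (heckeEquiv k)).prod)⁻¹ *
    piOp q *
    (((List.finRange n).filter fun j => i ≤ j.castSucc).reverse.map (heckeEquiv k)).prod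

/-- `Y^ν = Y_1^{ν_1} ⋯ Y_N^{ν_N}`. -/
def yPow {n : ℕ} (q k : ℂˣ) (ν : Lattice n) : RatFun n ≃ₗ[ℂ] RatFun n :=
  (List.ofFn fun i => yOp q k i ^ ν i).prod

/-- The map `ℂ(T) ⊗ H_0 ⊗ ℂ[T] → ℂ(T) # W`, `f ⊗ T_w ⊗ x^ν ↦ f(X) T_w Y^ν`.
By the Poincaré–Birkhoff–Witt theorem it is injective, with image the whole algebra of
`q`-difference reflection operators. -/
def pbw {n : ℕ} (q k : ℂˣ) :
    ((Equiv.Perm (Fin (n + 1)) × Lattice n) →₀ RatFun n) →ₗ[RatFun n] Module.End ℂ (RatFun n) :=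
  Finsupp.linearCombination (RatFun n) fun p =>
    (heckeT k p.1 * yPow q k p.2 : RatFun n ≃ₗ[ℂ] RatFun n).toLinearMap

/-- The coefficients `a_{w,ν} ∈ ℂ(T)` in the expansion `A = ∑ a_{w,ν}(X) T_w Y^ν` of a
`q`-difference reflection operator `A`. -/
def pbwCoeff {n : ℕ} (q k : ℂˣ) (A : Module.End ℂ (RatFun n)) :
    (Equiv.Perm (Fin (n + 1)) × Lattice n) →₀ RatFun n :=
  Function.invFun (pbw q k) A

/-! ### The cocycle

Vectors and endomorphisms of the finite Hecke algebra `H_0` are written in coordinates with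
respect to the basis `T_w`, `w ∈ S_N`. -/

/-- The cocycle value `C_{(w,e)}(t, γ)` for `w = ν u ∈ W`, as a matrix over
`ℂ(T) ⊗ ℂ[T] = ℂ(t)[γ^{±1}]`.

The normalised intertwiner `d_w(X)⁻¹ S̃_w` is the element `w` of `ℂ(T) # W`, so that
`C_{(w,e)} T_v = τ(w,e) T_v = d_w(x)⁻¹ · (S̃_w T_v)` is obtained from the expansion
`w T_v = ∑ a_{u',κ}(X) T_{u'} Y^κ` as `∑ a_{u',κ}(t) γ^κ T_{u'}`. -/
def cocycle {n : ℕ} (q k : ℂˣ) (ν : Lattice n) (u : Equiv.Perm (Fin (n + 1))) :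
    Matrix (Equiv.Perm (Fin (n + 1))) (Equiv.Perm (Fin (n + 1)))
      (AddMonoidAlgebra (RatFun n) (Lattice n)) :=
  fun u' v => AddMonoidAlgebra.ofCoeff
    ((pbwCoeff q k (weylOp q ν u * heckeT k v : RatFun n ≃ₗ[ℂ] RatFun n).toLinearMap).curry u')

/-- The specialisation `C_w^ζ(t) = C_{(w,e)}(t, ζ)`, `w = ν u`, a matrix over `ℂ(T)`. -/
def cocycleAt {n : ℕ} (q k : ℂˣ) (ζ : Torus n) (ν : Lattice n)
    (u : Equiv.Perm (Fin (n + 1))) :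
    Matrix (Equiv.Perm (Fin (n + 1))) (Equiv.Perm (Fin (n + 1))) (RatFun n) :=
  (cocycle q k ν u).map
    (AddMonoidAlgebra.lift (RatFun n) (RatFun n) (Lattice n)
      (monom fun i => Units.map (algebraMap ℂ (RatFun n)).toMonoidHom (ζ i)))

/-- The dual cocycle value `C_{(e,w)}(t, γ) = C_ι C_{(w,e)}(γ⁻¹, t⁻¹) C_ι`, `w = ν ∈ ℤ^N`, as a
function of `t` for fixed `γ = ζ`: a matrix over `ℂ[T]`. It is meaningful when
`DualRegularAt q k ζ ν` holds. -/
def dualCocycleAt {n : ℕ} (q k : ℂˣ) (ζ : Torus n) (ν : Lattice n) :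
    Matrix (Equiv.Perm (Fin (n + 1))) (Equiv.Perm (Fin (n + 1))) (Laurent n) :=
  fun u v => (cocycle q k ν 1 u⁻¹ v⁻¹).coeff.sum fun κ a =>
    AddMonoidAlgebra.single (-κ) (ratEval ζ⁻¹ a)

/-- `γ ↦ C_{(e,ν)}(·, γ)` is regular at `γ = ζ`. -/
def DualRegularAt {n : ℕ} (q k : ℂˣ) (ζ : Torus n) (ν : Lattice n) : Prop :=
  ∀ u v κ, RegularAt ζ⁻¹ ((cocycle q k ν 1 u v).coeff κ)

/-- `C_ι` on `H_0`: the anti-involution `T_w ↦ T_{w⁻¹}`. -/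
def cIota {n : ℕ} {A : Type*} (f : Equiv.Perm (Fin (n + 1)) → A) :
    Equiv.Perm (Fin (n + 1)) → A :=
  fun w => f w⁻¹

/-- An `H_0`-valued Laurent polynomial `f` solves the quantum KZ equations with central
character `ζ`: `C_ν^ζ(t) f(q^{-ν} t) = f(t)` for all `ν ∈ ℤ^N`. -/
def SolvesQKZ {n : ℕ} (q k : ℂˣ) (ζ : Torus n)
    (f : Equiv.Perm (Fin (n + 1)) → Laurent n) : Prop :=
  ∀ ν : Lattice n,
    (cocycleAt q k ζ ν 1).mulVec (fun v => shiftOp q ν (toRat (f v))) = fun v => toRat (f v)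

/-- `f` is `S_N`-invariant: `C_u^ζ(t) f(u⁻¹ t) = f(t)` for all `u ∈ S_N`. -/
def IsSymmInvariant {n : ℕ} (q k : ℂˣ) (ζ : Torus n)
    (f : Equiv.Perm (Fin (n + 1)) → Laurent n) : Prop :=
  ∀ u : Equiv.Perm (Fin (n + 1)),
    (cocycleAt q k ζ 0 u).mulVec (fun v => permOp u (toRat (f v))) = fun v => toRat (f v)

/-- `v_+ = ∑_w k^{ℓ(w)} T_w`, as a constant `H_0`-valued Laurent polynomial. -/
def vPlus (n : ℕ) (k : ℂˣ) : Equiv.Perm (Fin (n + 1)) → Laurent n :=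
  fun w => algebraMap ℂ (Laurent n) ((k : ℂ) ^ len w)

/-- `Q_ν = C_{(e,ν)}(·, k^{-δ})⁻¹ v_+`, an `H_0`-valued Laurent polynomial. -/
def Q {n : ℕ} (q k : ℂˣ) (ν : Lattice n) : Equiv.Perm (Fin (n + 1)) → Laurent n :=
  ((dualCocycleAt q k (tpow k (-delta n)) ν)⁻¹).mulVec (vPlus n k)

/-- The value in `H_0` of an `H_0`-valued Laurent polynomial at `t ∈ T`. -/
def evalH {n : ℕ} (t : Torus n) (f : Equiv.Perm (Fin (n + 1)) → Laurent n) :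
    Equiv.Perm (Fin (n + 1)) → ℂ :=
  fun w => evalL t (f w)

end

end BqKZ

/-! The space of operators `∑ a(X) T_u Y^κ` is read as vectors indexed by `S_N` with entries in
`ℂ(T)[y^{±1}]`. Left multiplication by `A ∈ W` then becomes a matrix `C_A` followed by the action of
`A` on coefficients, which gives the cocycle relation `C_{AB} = C_A · A(C_B)` (`cocMat_mul`). This
presupposes the PBW theorem. The `Y_i` commute by braid relations, and independence of the `T_u Y^κ`
follows from Dedekind's independence of automorphisms by a dimension count in bounded degree.

The cocycle is compatible with a second family of operators, obtained by exchanging the two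
variables and applying `C_ι`. For the dual intertwiner of `s_i` and for the dual rotation this is
checked on the generators `s_j` and `π` of `W` (`intertwines_interMat`, `intertwines_rotMat`). Let
`D = C_{(e,ν)}(·, ζ)`, whose first argument remains a variable. Once the coefficients may be
specialised at `ζ⁻¹`, these relations say that `D` carries the twisted action of `W` with central
character `q^ν ζ` to the one with central character `ζ`. Since `D` is invertible, it pulls solutions
at `ζ` back to solutions at `q^ν ζ` (`fixes_of_dualRat_mulVec`). The constant vector `v_+` is a
solution at `ζ = k^{-δ}`: `T_i v_+ = k v_+` handles `s_i`, and the change of length under rotation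
handles `π` (`fixes_vPlus`). Hence `Q_ν = D⁻¹ v_+` is a solution at `q^ν k^{-δ}`.

Regularity and invertibility at `k^{-δ}` come from factoring translations into simple reflections
and `π`. The only poles lie on `x_{i+1} = k² x_i`. A dominant weight is reached from `0` through
dominant weights by unit steps, and along such a path only coordinates with different powers of `q`
are exchanged, so the genericity of `k` excludes all poles (`goodAt_dominant`).

For self-duality put `A_ν(y) = C_{(ν,e)}(k^δ, y)`, an invertible matrix. The definition of `Q_ν`
reads `A_ν(t⁻¹) C_ι Q_ν(t) = v_+`. The quantum KZ equation at `t = k^δ`, for a solution `f` with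
character `ζ`, reads `A_ν(ζ) f(q^{-ν} k^δ) = f(k^δ)`. With `f = v_+` this gives `Q_ν(k^δ) = v_+`.
With `f = Q_μ`, both `Q_μ(q^{-ν} k^δ)` and `C_ι Q_ν(q^{-μ} k^δ)` are then solutions of one system
with matrix `A_ν(q^μ k^{-δ})` and right side `v_+`, so they agree. -/

namespace BqKZ

/-! ### Inversions and reduced words in the symmetric group -/

section Inversions

variable {n : ℕ}

/-- The number of inversions of a permutation. -/
def invNum (w : Equiv.Perm (Fin (n + 1))) : ℕ :=
  (Finset.univ.filter fun p : Fin (n + 1) × Fin (n + 1) => p.1 < p.2 ∧ w p.2 < w p.1).card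

@[simp] theorem simple_castSucc (i : Fin n) : simple i i.castSucc = i.succ := by simp [simple]

@[simp] theorem simple_succ (i : Fin n) : simple i i.succ = i.castSucc := by simp [simple]

theorem simple_of_ne {i : Fin n} {a : Fin (n + 1)} (h : a ≠ i.castSucc) (h' : a ≠ i.succ) :
    simple i a = a := Equiv.swap_apply_of_ne_of_ne h h'

@[simp] theorem simple_mul_self (i : Fin n) : simple i * simple i = 1 := by simp [simple]

@[simp] theorem simple_inv (i : Fin n) : (simple i)⁻¹ = simple i := by simp [simple]

@[simp] theorem simple_simple (i : Fin n) (a : Fin (n + 1)) : simple i (simple i a) = a := by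
  simp [simple]

theorem simple_mul_cancel_left (i : Fin n) (w : Equiv.Perm (Fin (n + 1))) :
    simple i * (simple i * w) = w := by rw [← mul_assoc, simple_mul_self, one_mul]

theorem mul_simple_cancel_right (i : Fin n) (w : Equiv.Perm (Fin (n + 1))) :
    w * simple i * simple i = w := by rw [mul_assoc, simple_mul_self, mul_one]

/-- A simple reflection keeps the order of every pair other than the one it swaps. -/
theorem simple_lt_simple {i : Fin n} {a b : Fin (n + 1)} (hab : a < b)
    (h : ¬ (a = i.castSucc ∧ b = i.succ)) : simple i a < simple i b := by
  simp only [simple, Equiv.swap_apply_def]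
  simp only [Fin.ext_iff, Fin.lt_def, Fin.val_castSucc, Fin.val_succ] at *
  split_ifs <;> (try simp only [Fin.val_castSucc, Fin.val_succ]) <;> omega

/-- Applying `s_i` to both entries carries the inversions of `w` bijectively to the inversions of `w
s_i` other than `(i, i+1)`, which is the single new one. -/
theorem invNum_mul_simple {w : Equiv.Perm (Fin (n + 1))} {i : Fin n}
    (h : w i.castSucc < w i.succ) : invNum (w * simple i) = invNum w + 1 := by
  classical
  have hlt : i.castSucc < i.succ := Fin.castSucc_lt_succ
  set S := Finset.univ.filter fun p : Fin (n + 1) × Fin (n + 1) => p.1 < p.2 ∧ w p.2 < w p.1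
    with hS
  have hnot : (i.castSucc, i.succ) ∉ S.map
      ((simple i).toEmbedding.prodMap (simple i).toEmbedding) := by
    simp only [Finset.mem_map, hS, Finset.mem_filter, Finset.mem_univ, true_and, not_exists,
      not_and, Prod.forall]
    rintro a b ⟨hab, -⟩ he
    simp only [Function.Embedding.coe_prodMap, Prod.map, Prod.mk.injEq,
      Equiv.coe_toEmbedding] at he
    have ha : a = i.succ := by rw [← simple_simple i a, he.1, simple_castSucc]
    have hb : b = i.castSucc := by rw [← simple_simple i b, he.2, simple_succ]
    subst ha hb
    exact absurd hab hlt.asymm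
  have key : (Finset.univ.filter fun p : Fin (n + 1) × Fin (n + 1) =>
      p.1 < p.2 ∧ (w * simple i) p.2 < (w * simple i) p.1) =
      Finset.cons (i.castSucc, i.succ)
        (S.map ((simple i).toEmbedding.prodMap (simple i).toEmbedding)) hnot := by
    ext ⟨a, b⟩
    rw [Finset.mem_filter_univ, Finset.mem_cons, Finset.mem_map]
    simp only [Finset.mem_filter_univ, hS, Prod.exists, Function.Embedding.coe_prodMap,
      Prod.map, Prod.mk.injEq, Equiv.coe_toEmbedding, Equiv.Perm.mul_apply]
    constructor
    · rintro ⟨hab, hw⟩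
      by_cases hp : a = i.castSucc ∧ b = i.succ
      · exact Or.inl hp
      · exact Or.inr ⟨simple i a, simple i b, ⟨simple_lt_simple hab hp, hw⟩, by simp⟩
    · rintro (⟨rfl, rfl⟩ | ⟨c, d, ⟨hcd, hw⟩, rfl, rfl⟩)
      · simpa using h
      · refine ⟨simple_lt_simple hcd ?_, by simpa using hw⟩
        rintro ⟨rfl, rfl⟩
        exact absurd h hw.asymm
  unfold invNum
  rw [key, Finset.card_cons, Finset.card_map]

theorem invNum_inv (w : Equiv.Perm (Fin (n + 1))) : invNum w⁻¹ = invNum w := by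
  classical
  unfold invNum
  refine Finset.card_nbij' (fun p => (w⁻¹ p.2, w⁻¹ p.1)) (fun p => (w p.2, w p.1)) ?_ ?_ ?_ ?_
  · rintro ⟨a, b⟩; simp; tauto
  · rintro ⟨a, b⟩; simp; tauto
  · rintro ⟨a, b⟩; simp
  · rintro ⟨a, b⟩; simp

theorem invNum_simple_mul {w : Equiv.Perm (Fin (n + 1))} {i : Fin n}
    (h : w⁻¹ i.castSucc < w⁻¹ i.succ) : invNum (simple i * w) = invNum w + 1 := by
  rw [← invNum_inv, mul_inv_rev, simple_inv, invNum_mul_simple h, invNum_inv]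

theorem lt_or_gt_castSucc_succ (w : Equiv.Perm (Fin (n + 1))) (i : Fin n) :
    w i.castSucc < w i.succ ∨ w i.succ < w i.castSucc := by
  apply lt_or_gt_of_ne
  simp [Fin.castSucc_lt_succ.ne]

theorem invNum_of_descent {w : Equiv.Perm (Fin (n + 1))} {i : Fin n}
    (h : w i.succ < w i.castSucc) : invNum w = invNum (w * simple i) + 1 := by
  have h' : (w * simple i) i.castSucc < (w * simple i) i.succ := by simpa using h
  simpa [mul_simple_cancel_right] using invNum_mul_simple h'

theorem invNum_of_left_descent {w : Equiv.Perm (Fin (n + 1))} {i : Fin n}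
    (h : w⁻¹ i.succ < w⁻¹ i.castSucc) : invNum w = invNum (simple i * w) + 1 := by
  rw [← invNum_inv, invNum_of_descent h, ← invNum_inv (simple i * w), mul_inv_rev, simple_inv]

theorem invNum_one : invNum (1 : Equiv.Perm (Fin (n + 1))) = 0 := by
  simp only [invNum, Finset.card_eq_zero, Finset.filter_eq_empty_iff]
  rintro ⟨a, b⟩ -
  simpa using fun h : a < b => h.le

/-- Without a descent `w⁻¹` is strictly increasing, and the only strictly increasing bijection of a
finite chain is the identity. -/
theorem exists_left_descent {w : Equiv.Perm (Fin (n + 1))} (hw : w ≠ 1) :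
    ∃ i : Fin n, w⁻¹ i.succ < w⁻¹ i.castSucc := by
  by_contra! hcon
  apply hw
  have hmono : StrictMono (w⁻¹ : Equiv.Perm (Fin (n + 1))) := by
    rw [Fin.strictMono_iff_lt_succ]
    intro i
    exact (lt_or_gt_castSucc_succ w⁻¹ i).resolve_right (hcon i).not_gt
  have h1 : (w⁻¹ : Equiv.Perm (Fin (n + 1))) = 1 := by
    ext1 a
    have : Set.range (w⁻¹ : Equiv.Perm (Fin (n + 1))) = Set.range (id : Fin (n + 1) → _) := by
      simp
    exact congrFun ((StrictMono.range_inj hmono strictMono_id).1 this) a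
  simpa using h1

theorem invNum_prod_le (l : List (Fin n)) : invNum (l.map simple).prod ≤ l.length := by
  induction l with
  | nil => simp [invNum_one]
  | cons i l ih =>
    rw [List.map_cons, List.prod_cons, List.length_cons]
    rcases lt_or_gt_castSucc_succ (l.map simple).prod⁻¹ i with h | h
    · rw [invNum_simple_mul h]; omega
    · have := invNum_of_left_descent h; omega

theorem exists_word_invNum (w : Equiv.Perm (Fin (n + 1))) :
    ∃ l : List (Fin n), (l.map simple).prod = w ∧ l.length = invNum w := by
  induction hm : invNum w using Nat.strong_induction_on generalizing w with
  | _ m ih =>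
    by_cases hw : w = 1
    · subst hw; exact ⟨[], by simp, by rw [← hm, invNum_one]; rfl⟩
    · obtain ⟨i, hi⟩ := exists_left_descent hw
      have h1 := invNum_of_left_descent hi
      obtain ⟨l, hl, hl'⟩ := ih _ (by omega) (simple i * w) rfl
      exact ⟨i :: l, by simp [hl, simple_mul_cancel_left], by simp; omega⟩

/-- Sorting by descents produces a word of length `invNum w`, and no word is shorter because each
letter raises the inversion number by at most one. -/
theorem isReducedWord_iff {l : List (Fin n)} {w : Equiv.Perm (Fin (n + 1))} :
    IsReducedWord l w ↔ (l.map simple).prod = w ∧ l.length = invNum w := by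
  constructor
  · rintro ⟨h, h'⟩
    obtain ⟨m, hm, hm'⟩ := exists_word_invNum w
    refine ⟨h, le_antisymm (hm' ▸ h' m hm) ?_⟩
    rw [← h]; exact invNum_prod_le l
  · rintro ⟨h, h'⟩
    refine ⟨h, fun l' hl' => ?_⟩
    rw [h', ← hl']; exact invNum_prod_le l'

theorem redWord_spec (w : Equiv.Perm (Fin (n + 1))) : IsReducedWord (redWord w) w :=
  Classical.choose_spec (exists_isReducedWord w)

theorem len_eq_invNum (w : Equiv.Perm (Fin (n + 1))) : len w = invNum w :=
  (isReducedWord_iff.1 (redWord_spec w)).2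

theorem len_inv (w : Equiv.Perm (Fin (n + 1))) : len w⁻¹ = len w := by
  rw [len_eq_invNum, len_eq_invNum, invNum_inv]

theorem isReducedWord_cons {l : List (Fin n)} {w : Equiv.Perm (Fin (n + 1))} {i : Fin n}
    (h : IsReducedWord (i :: l) w) :
    IsReducedWord l (simple i * w) ∧ w⁻¹ i.succ < w⁻¹ i.castSucc := by
  rw [isReducedWord_iff] at h
  obtain ⟨h1, h2⟩ := h
  rw [List.map_cons, List.prod_cons] at h1
  rw [List.length_cons] at h2
  have hl : (l.map simple).prod = simple i * w := by rw [← h1, simple_mul_cancel_left]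
  have hle := invNum_prod_le l
  rw [hl] at hle
  rcases lt_or_gt_castSucc_succ w⁻¹ i with h | h
  · rw [invNum_simple_mul h] at hle; omega
  · have := invNum_of_left_descent h
    exact ⟨isReducedWord_iff.2 ⟨hl, by omega⟩, h⟩

theorem isReducedWord_cons_of {l : List (Fin n)} {w : Equiv.Perm (Fin (n + 1))} {i : Fin n}
    (h : IsReducedWord l (simple i * w)) (hd : w⁻¹ i.succ < w⁻¹ i.castSucc) :
    IsReducedWord (i :: l) w := by
  rw [isReducedWord_iff] at h ⊢
  have := invNum_of_left_descent hd
  exact ⟨by simp [h.1, simple_mul_cancel_left], by simp; omega⟩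

/-- Far apart simple reflections commute. -/
theorem simple_comm {i j : Fin n} (h : (i : ℕ) + 1 < j) :
    simple i * simple j = simple j * simple i := by
  apply Equiv.Perm.Disjoint.commute
  intro a
  by_cases h1 : a = i.castSucc
  · right; apply simple_of_ne <;> simp [h1, Fin.ext_iff] <;> omega
  by_cases h2 : a = i.succ
  · right; apply simple_of_ne <;> simp [h2, Fin.ext_iff] <;> omega
  · exact Or.inl (simple_of_ne h1 h2)

theorem simple_braid {i j : Fin n} (h : (i : ℕ) + 1 = j) :
    simple i * simple j * simple i = simple j * simple i * simple j := by
  have hij : i.succ = j.castSucc := by simp [Fin.ext_iff, h]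
  ext1 a
  simp only [simple, Equiv.Perm.mul_apply, Equiv.swap_apply_def, hij]
  have h1 : i.castSucc ≠ j.castSucc := by simp [Fin.ext_iff]; omega
  have h2 : i.castSucc ≠ j.succ := by simp [Fin.ext_iff]; omega
  have h3 : j.castSucc ≠ j.succ := Fin.castSucc_lt_succ.ne
  split_ifs <;> simp_all

/-- Matsumoto's theorem for the symmetric group. -/
theorem matsumoto {G : Type*} [Group G] (φ : Fin n → G)
    (hcomm : ∀ i j : Fin n, (i : ℕ) + 1 < j → φ i * φ j = φ j * φ i)
    (hbraid : ∀ i j : Fin n, (i : ℕ) + 1 = j → φ i * φ j * φ i = φ j * φ i * φ j)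
    {w : Equiv.Perm (Fin (n + 1))} {l l' : List (Fin n)}
    (hl : IsReducedWord l w) (hl' : IsReducedWord l' w) :
    (l.map φ).prod = (l'.map φ).prod := by
  induction hm : l.length using Nat.strong_induction_on generalizing l l' w with
  | _ m ih =>
  have hlen : l.length = l'.length := by
    rw [(isReducedWord_iff.1 hl).2, (isReducedWord_iff.1 hl').2]
  rcases l with _ | ⟨i, l⟩
  · rw [List.eq_nil_of_length_eq_zero hlen.symm]
  rcases l' with _ | ⟨j, l'⟩
  · simp at hlen
  have hil := isReducedWord_cons hl
  have hjl := isReducedWord_cons hl'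
  simp only [List.length_cons] at hm hlen
  -- Both first letters are left descents of `w`. Hence `w` has reduced words beginning with `i j`
  -- and `j i` when the letters commute, and with `i j i` and `j i j` when they are adjacent. By
  -- induction each given word may be replaced by the one of these with the same first letter, and
  -- the two replacements differ by one relation.
  have key : ∀ (i j : Fin n) (l l' : List (Fin n)), l.length < m → l'.length < m →
      IsReducedWord l (simple i * w) → w⁻¹ i.succ < w⁻¹ i.castSucc →
      IsReducedWord l' (simple j * w) → w⁻¹ j.succ < w⁻¹ j.castSucc → i < j →
      φ i * (l.map φ).prod = φ j * (l'.map φ).prod := by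
    intro i j l l' hlm hlm' hil hi hjl hj hij
    rcases (Nat.succ_le_iff.2 (Fin.lt_def.1 hij)).lt_or_eq with h | h
    · have hne1 : simple i j.castSucc = j.castSucc := by
        apply simple_of_ne <;> simp [Fin.ext_iff] <;> omega
      have hne2 : simple i j.succ = j.succ := by
        apply simple_of_ne <;> simp [Fin.ext_iff] <;> omega
      have hne3 : simple j i.castSucc = i.castSucc := by
        apply simple_of_ne <;> simp [Fin.ext_iff] <;> omega
      have hne4 : simple j i.succ = i.succ := by
        apply simple_of_ne <;> simp [Fin.ext_iff] <;> omega
      have r0 := redWord_spec (simple j * (simple i * w))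
      have e1 : IsReducedWord (j :: redWord (simple j * (simple i * w))) (simple i * w) :=
        isReducedWord_cons_of r0 (by simpa [hne1, hne2] using hj)
      have e2 : IsReducedWord (i :: redWord (simple j * (simple i * w))) (simple j * w) := by
        apply isReducedWord_cons_of
        · have e : simple i * (simple j * w) = simple j * (simple i * w) := by
            rw [← mul_assoc, simple_comm h, mul_assoc]
          rw [e]
          exact r0
        · simpa [hne3, hne4] using hi
      rw [ih _ hlm hil e1 rfl, ih _ hlm' hjl e2 rfl]
      simp only [List.map_cons, List.prod_cons, ← mul_assoc, hcomm i j h]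
    · have hc : i.succ = j.castSucc := by simp [Fin.ext_iff]; omega
      have g1 : simple i j.succ = j.succ := by
        apply simple_of_ne <;> simp [Fin.ext_iff] <;> omega
      have g2 : simple i j.castSucc = i.castSucc := by rw [← hc, simple_succ]
      have g3 : simple j i.castSucc = i.castSucc := by
        apply simple_of_ne <;> simp [Fin.ext_iff] <;> omega
      have g4 : simple j i.succ = j.succ := by rw [hc, simple_castSucc]
      rw [hc] at hi
      have r0 := redWord_spec (simple i * (simple j * (simple i * w)))
      have e1 : IsReducedWord (i :: redWord (simple i * (simple j * (simple i * w))))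
          (simple j * (simple i * w)) :=
        isReducedWord_cons_of r0 (by simpa [g1, g3, g4, hc] using hj)
      have e1' : IsReducedWord (j :: i :: redWord (simple i * (simple j * (simple i * w))))
          (simple i * w) :=
        isReducedWord_cons_of e1 (by simpa [g1, g2] using hj.trans hi)
      have hb : simple i * (simple j * (simple i * w)) = simple j * (simple i * (simple j * w)) := by
        simpa only [mul_assoc] using congrArg (· * w) (simple_braid h)
      have e2 : IsReducedWord (j :: redWord (simple i * (simple j * (simple i * w))))
          (simple i * (simple j * w)) := by
        apply isReducedWord_cons_of
        · rwa [← hb]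
        · simpa [g1, g2, g3] using hi
      have e2' : IsReducedWord (i :: j :: redWord (simple i * (simple j * (simple i * w))))
          (simple j * w) :=
        isReducedWord_cons_of e2 (by simpa [g3, g4] using hj.trans hi)
      rw [ih _ hlm hil e1' rfl, ih _ hlm' hjl e2' rfl]
      simp only [List.map_cons, List.prod_cons, ← mul_assoc, hbraid i j h]
  simp only [List.map_cons, List.prod_cons]
  rcases lt_trichotomy i j with h | h | h
  · exact key i j l l' (by omega) (by omega) hil.1 hil.2 hjl.1 hjl.2 h
  · subst h
    rw [ih l.length (by omega) hil.1 hjl.1 rfl]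
  · exact (key j i l' l (by omega) (by omega) hjl.1 hjl.2 hil.1 hil.2 h).symm

end Inversions

end BqKZ

namespace BqKZ
noncomputable section

/-! ### Permutations and shifts as field automorphisms -/

section Automorphisms

variable {n : ℕ}

/-- The automorphism `x_i ↦ x_{w i}` of `ℂ(T)`. -/
def permAlg (w : Equiv.Perm (Fin (n + 1))) : RatFun n ≃ₐ[ℂ] RatFun n :=
  IsFractionRing.algEquivOfAlgEquiv (K := RatFun n) (L := RatFun n) (MvPolynomial.renameEquiv ℂ w)

/-- The automorphism `x_i ↦ q^{-ν_i} x_i` of `ℂ(T)`. -/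
def shiftAlg (q : ℂˣ) (ν : Lattice n) : RatFun n ≃ₐ[ℂ] RatFun n :=
  IsFractionRing.algEquivOfAlgEquiv (K := RatFun n) (L := RatFun n) (scaleEquiv (tpow q (-ν)))

/-- The automorphism underlying `piOp`. -/
def piAlg (q : ℂˣ) : RatFun n ≃ₐ[ℂ] RatFun n :=
  permAlg (finRotate (n + 1)) * shiftAlg q (Pi.single (Fin.last n) 1)

@[simp] theorem permAlg_xvar (w : Equiv.Perm (Fin (n + 1))) (i : Fin (n + 1)) :
    permAlg w (xvar i) = (xvar (w i) : RatFun n) := by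
  simp [permAlg, xvar]

@[simp] theorem shiftAlg_xvar (q : ℂˣ) (ν : Lattice n) (i : Fin (n + 1)) :
    shiftAlg q ν (xvar i) = (algebraMap ℂ (RatFun n) (q ^ (-ν i) : ℂˣ) * xvar i : RatFun n) := by
  simp only [shiftAlg, xvar, scaleEquiv, IsFractionRing.algEquivOfAlgEquiv_algebraMap,
    AlgEquiv.ofAlgHom_apply, MvPolynomial.aeval_X, map_mul, tpow, Pi.neg_apply]
  rfl

theorem algEquiv_ext {A B : RatFun n ≃ₐ[ℂ] RatFun n} (h : ∀ i, A (xvar i) = B (xvar i)) :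
    A = B := by
  have hp : (A : RatFun n →ₐ[ℂ] RatFun n).comp
      (IsScalarTower.toAlgHom ℂ (MvPolynomial (Fin (n + 1)) ℂ) (RatFun n)) =
      (B : RatFun n →ₐ[ℂ] RatFun n).comp
      (IsScalarTower.toAlgHom ℂ (MvPolynomial (Fin (n + 1)) ℂ) (RatFun n)) := by
    apply MvPolynomial.algHom_ext
    exact h
  ext f
  obtain ⟨p, r, hr, rfl⟩ := IsFractionRing.div_surjective (A := MvPolynomial (Fin (n + 1)) ℂ) f
  rw [map_div₀, map_div₀]
  congr 1
  · exact DFunLike.congr_fun hp p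
  · exact DFunLike.congr_fun hp r

theorem permAlg_mul (u w : Equiv.Perm (Fin (n + 1))) :
    permAlg (u * w) = permAlg u * permAlg w :=
  algEquiv_ext fun i => by simp [AlgEquiv.mul_apply]

theorem permAlg_one : permAlg (1 : Equiv.Perm (Fin (n + 1))) = 1 :=
  algEquiv_ext fun i => by simp

theorem shiftAlg_add (q : ℂˣ) (ν μ : Lattice n) :
    shiftAlg q (ν + μ) = shiftAlg q ν * shiftAlg q μ :=
  algEquiv_ext fun i => by
    have h : (q ^ (-(ν i + μ i)) : ℂˣ) = q ^ (-μ i) * q ^ (-ν i) := by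
      rw [← zpow_add, neg_add_rev]
    simp only [shiftAlg_xvar, AlgEquiv.mul_apply, map_mul, AlgEquiv.commutes, Pi.add_apply, h,
      Units.val_mul, mul_assoc]

theorem shiftAlg_zero (q : ℂˣ) : shiftAlg q (0 : Lattice n) = 1 :=
  algEquiv_ext fun i => by simp

theorem shiftAlg_neg (q : ℂˣ) (ν : Lattice n) : shiftAlg q (-ν) = (shiftAlg q ν)⁻¹ := by
  rw [eq_inv_iff_mul_eq_one, ← shiftAlg_add, neg_add_cancel, shiftAlg_zero]

theorem permAlg_inv (w : Equiv.Perm (Fin (n + 1))) : permAlg w⁻¹ = (permAlg w)⁻¹ := by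
  rw [eq_inv_iff_mul_eq_one, ← permAlg_mul, inv_mul_cancel, permAlg_one]

theorem permAlg_mul_shiftAlg (q : ℂˣ) (w : Equiv.Perm (Fin (n + 1))) (ν : Lattice n) :
    permAlg w * shiftAlg q ν = shiftAlg q (ν ∘ ⇑w⁻¹) * permAlg w :=
  algEquiv_ext fun i => by
    simp only [AlgEquiv.mul_apply, shiftAlg_xvar, permAlg_xvar, map_mul, AlgEquiv.commutes]
    simp

theorem piAlg_xvar_castSucc (q : ℂˣ) (i : Fin n) :
    piAlg q (xvar i.castSucc) = (xvar i.succ : RatFun n) := by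
  simp [piAlg, AlgEquiv.mul_apply, Fin.castSucc_ne_last]

theorem piAlg_xvar_last (q : ℂˣ) :
    piAlg q (xvar (Fin.last n)) = (algebraMap ℂ (RatFun n) (q⁻¹ : ℂˣ) * xvar 0 : RatFun n) := by
  simp [piAlg, AlgEquiv.mul_apply]

/-- The linear equivalence underlying an algebra automorphism, as a group homomorphism. -/
def toLin : (RatFun n ≃ₐ[ℂ] RatFun n) →* (RatFun n ≃ₗ[ℂ] RatFun n) where
  toFun A := A.toLinearEquiv
  map_one' := rfl
  map_mul' _ _ := rfl

@[simp] theorem toLin_apply (A : RatFun n ≃ₐ[ℂ] RatFun n) (f : RatFun n) : toLin A f = A f := rfl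

theorem toLin_permAlg (w : Equiv.Perm (Fin (n + 1))) : toLin (permAlg w) = permOp w := rfl

end Automorphisms

/-! ### Relations between the Hecke operators -/

section HeckeRelations

/-- Once `s` and `t` are pushed through all coefficients, both sides are combinations of the six
images of `f` under `S_3`. Treating these images as independent variables leaves an identity of
rational functions in `a, b, x, y, z`. -/
theorem demazureLusztig_braid {K : Type*} [Field K] (s t : K →+* K) (a b x y z : K)
    (hsa : s a = a) (hsb : s b = b) (hta : t a = a) (htb : t b = b)
    (hsx : s x = y) (hsy : s y = x) (hsz : s z = z) (htx : t x = x) (hty : t y = z) (htz : t z = y)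
    (hss : ∀ f, s (s f) = f) (htt : ∀ f, t (t f) = f) (hst : ∀ f, s (t (s f)) = t (s (t f)))
    (hxy : x - y ≠ 0) (hyz : y - z ≠ 0) (hxz : x - z ≠ 0) (S T : K → K)
    (hS : ∀ f, S f = a * f + (b * y - a * x) / (y - x) * (s f - f))
    (hT : ∀ f, T f = a * f + (b * z - a * y) / (z - y) * (t f - f)) (f : K) :
    S (T (S f)) = T (S (T f)) := by
  have hyx : y - x ≠ 0 := by rwa [← neg_ne_zero, neg_sub]
  have hzy : z - y ≠ 0 := by rwa [← neg_ne_zero, neg_sub]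
  have hzx : z - x ≠ 0 := by rwa [← neg_ne_zero, neg_sub]
  simp only [hS, hT, map_add, map_sub, map_mul, map_div₀, hsa, hsb, hta, htb, hsx, hsy, hsz,
    htx, hty, htz, hss, htt, hst]
  generalize s f = f1
  generalize t f = f2
  generalize s (t f) = f3
  generalize t (s f) = f4
  generalize t (s (t f)) = f5
  have e1 : x - y = -(y - x) := by ring
  have e2 : y - z = -(z - y) := by ring
  simp only [e1, e2]
  field_simp
  ring

variable {n : ℕ}

theorem cfun_eq (k : ℂˣ) {x y : RatFun n} (hy : y ≠ 0) :
    cfun k (x / y) = (algebraMap ℂ (RatFun n) (k⁻¹ : ℂˣ).val * y - algebraMap ℂ (RatFun n) k * x) /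
      (y - x) := by
  unfold cfun
  rw [one_sub_div hy, ← mul_div_assoc, sub_div' hy, div_div_div_cancel_right₀ hy]

theorem heckeEquiv_apply (k : ℂˣ) (i : Fin n) (f : RatFun n) :
    heckeEquiv k i f = heckeOp k i f := rfl

theorem heckeEquiv_apply' (k : ℂˣ) (i : Fin n) (f : RatFun n) :
    heckeEquiv k i f = algebraMap ℂ (RatFun n) k * f +
      (algebraMap ℂ (RatFun n) (k⁻¹ : ℂˣ).val * xvar i.succ -
        algebraMap ℂ (RatFun n) k * xvar i.castSucc) / (xvar i.succ - xvar i.castSucc) *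
      (permAlg (simple i) f - f) := by
  rw [heckeEquiv_apply, heckeOp_apply, cfun_eq k (xvar_ne_zero _)]
  rfl

theorem permAlg_permAlg (u w : Equiv.Perm (Fin (n + 1))) (f : RatFun n) :
    permAlg u (permAlg w f) = permAlg (u * w) f := by
  rw [permAlg_mul]; rfl

theorem heckeEquiv_braid (k : ℂˣ) {i j : Fin n} (h : (i : ℕ) + 1 = j) :
    heckeEquiv k i * heckeEquiv k j * heckeEquiv k i =
      heckeEquiv k j * heckeEquiv k i * heckeEquiv k j := by
  ext1 f
  have hij : i.succ = j.castSucc := by simp [Fin.ext_iff, h]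
  have h1 : i.castSucc ≠ i.succ := Fin.castSucc_lt_succ.ne
  have h2 : i.castSucc ≠ j.succ := by simp [Fin.ext_iff]; omega
  have h3 : i.succ ≠ j.succ := by simp [Fin.ext_iff]; omega
  have e1 : simple j i.castSucc = i.castSucc := by
    apply simple_of_ne <;> simp [Fin.ext_iff] <;> omega
  have e2 : simple j i.succ = j.succ := by rw [hij, simple_castSucc]
  have e3 : simple j j.succ = i.succ := by rw [hij, simple_succ]
  have e4 : simple i j.succ = j.succ := by
    apply simple_of_ne <;> simp [Fin.ext_iff] <;> omega
  refine demazureLusztig_braid (permAlg (simple i) : RatFun n →+* RatFun n)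
    (permAlg (simple j) : RatFun n →+* RatFun n) (algebraMap ℂ (RatFun n) k)
    (algebraMap ℂ (RatFun n) (k⁻¹ : ℂˣ).val) (xvar i.castSucc) (xvar i.succ) (xvar j.succ)
    ?_ ?_ ?_ ?_ ?_ ?_ ?_ ?_ ?_ ?_ ?_ ?_ ?_ (xvar_sub_ne_zero h1) (xvar_sub_ne_zero h3)
    (xvar_sub_ne_zero h2) (heckeEquiv k i) (heckeEquiv k j) (heckeEquiv_apply' k i)
    (fun f => ?_) f
  iterate 4 exact AlgEquiv.commutes _ _
  iterate 6 simp [e1, e2, e3, e4]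
  · intro f; simp [permAlg_permAlg, permAlg_one]
  · intro f; simp [permAlg_permAlg, permAlg_one]
  · intro f; simp [permAlg_permAlg, ← mul_assoc, simple_braid h]
  · rw [heckeEquiv_apply', hij]; rfl

theorem heckeEquiv_comm (k : ℂˣ) {i j : Fin n} (h : (i : ℕ) + 1 < j) :
    heckeEquiv k i * heckeEquiv k j = heckeEquiv k j * heckeEquiv k i := by
  ext1 f
  have e1 : simple j i.castSucc = i.castSucc := by
    apply simple_of_ne <;> simp [Fin.ext_iff] <;> omega
  have e2 : simple j i.succ = i.succ := by
    apply simple_of_ne <;> simp [Fin.ext_iff] <;> omega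
  have e3 : simple i j.castSucc = j.castSucc := by
    apply simple_of_ne <;> simp [Fin.ext_iff] <;> omega
  have e4 : simple i j.succ = j.succ := by
    apply simple_of_ne <;> simp [Fin.ext_iff] <;> omega
  simp only [LinearEquiv.mul_apply, heckeEquiv_apply', map_add, map_sub, map_mul, map_div₀,
    AlgEquiv.commutes, permAlg_xvar, e1, e2, e3, e4, permAlg_permAlg, simple_comm h]
  ring

theorem heckeEquiv_quadratic (k : ℂˣ) (i : Fin n) (f : RatFun n) :
    heckeEquiv k i (heckeEquiv k i f) =
      algebraMap ℂ (RatFun n) ((k : ℂ) - (k⁻¹ : ℂˣ).val) * heckeEquiv k i f + f :=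
  heckeOp_quadratic k i f

/-- Conjugation of a Hecke operator by an automorphism that carries `s_i` to `s_j`. -/
theorem toLin_mul_heckeEquiv (k : ℂˣ) (A : RatFun n ≃ₐ[ℂ] RatFun n) (i j : Fin n)
    (hA : A * permAlg (simple i) = permAlg (simple j) * A)
    (hx : A (xvar i.castSucc / xvar i.succ) = xvar j.castSucc / xvar j.succ) :
    toLin A * heckeEquiv k i = heckeEquiv k j * toLin A := by
  ext1 f
  have h1 := DFunLike.congr_fun hA f
  simp only [AlgEquiv.mul_apply] at h1
  simp only [LinearEquiv.mul_apply, heckeEquiv_apply, heckeOp_apply, toLin_apply, map_add, map_mul,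
    map_sub, AlgEquiv.commutes, ← toLin_permAlg, h1]
  congr 2
  simp only [cfun, map_div₀, map_sub, map_mul, AlgEquiv.commutes, map_one] at hx ⊢
  rw [hx]

theorem piAlg_mul_simple (q : ℂˣ) {i j : Fin n} (h : (i : ℕ) + 1 = j) :
    piAlg q * permAlg (simple i) = permAlg (simple j) * piAlg q := by
  have hij : i.succ = j.castSucc := by simp [Fin.ext_iff, h]
  have h0 : Fin.last n ≠ i.castSucc := (Fin.castSucc_ne_last i).symm
  have h0' : Fin.last n ≠ i.succ := by rw [hij]; exact (Fin.castSucc_ne_last j).symm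
  apply algEquiv_ext
  intro a
  simp only [AlgEquiv.mul_apply, permAlg_xvar]
  induction a using Fin.lastCases with
  | last =>
    have h1 : simple j (0 : Fin (n + 1)) = 0 := by
      apply simple_of_ne <;> simp [Fin.ext_iff] <;> omega
    simp [simple_of_ne h0 h0', piAlg_xvar_last, h1]
  | cast a =>
    by_cases ha : a = i
    · subst ha
      simp [piAlg_xvar_castSucc, hij]
    by_cases ha' : a = j
    · subst ha'
      rw [← hij, simple_succ, piAlg_xvar_castSucc, hij, piAlg_xvar_castSucc, permAlg_xvar,
        simple_succ]
    · rw [simple_of_ne (by simpa using ha) (by rw [hij]; simpa using ha'), piAlg_xvar_castSucc,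
        permAlg_xvar, simple_of_ne (by rw [← hij]; simpa using ha) (by simpa using ha')]

theorem piOp_mul_heckeEquiv (q k : ℂˣ) {i j : Fin n} (h : (i : ℕ) + 1 = j) :
    piOp q * heckeEquiv k i = heckeEquiv k j * piOp q := by
  have hij : i.succ = j.castSucc := by simp [Fin.ext_iff, h]
  apply toLin_mul_heckeEquiv k (piAlg q) i j (piAlg_mul_simple q h)
  rw [map_div₀, hij, piAlg_xvar_castSucc, piAlg_xvar_castSucc, hij]

/-- The square of `π` sends the last two coordinates to `q⁻¹ x_1` and `q⁻¹ x_2`. The factor `q⁻¹`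
cancels in their ratio, so `π²` conjugates the last Hecke operator to the first. This wrap-around
relation is what makes `Y_1` and `Y_2` commute. -/
theorem piOp_sq_mul_heckeEquiv {m : ℕ} (q k : ℂˣ) :
    piOp q * piOp q * heckeEquiv k (Fin.last m) = heckeEquiv k 0 * (piOp q * piOp q) := by
  have hl : (Fin.last m).succ = Fin.last (m + 1) := by simp
  have e1 : ∀ a : Fin (m + 1), a ≠ Fin.last m → (piAlg q * piAlg q : RatFun (m + 1) ≃ₐ[ℂ] RatFun (m + 1)) (xvar a.castSucc) =
      (xvar (a + 1).succ : RatFun (m + 1)) := by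
    intro a ha
    obtain ⟨b, rfl⟩ := Fin.exists_castSucc_eq.2 ha
    rw [AlgEquiv.mul_apply, piAlg_xvar_castSucc, Fin.succ_castSucc, piAlg_xvar_castSucc,
      Fin.coeSucc_eq_succ]
  have e2 : (piAlg q * piAlg q : RatFun (m + 1) ≃ₐ[ℂ] RatFun (m + 1)) (xvar (Fin.last m).castSucc) =
      (algebraMap ℂ (RatFun (m + 1)) (q⁻¹ : ℂˣ) * xvar (0 : Fin (m + 1)).castSucc :
        RatFun (m + 1)) := by
    rw [AlgEquiv.mul_apply, piAlg_xvar_castSucc, hl, piAlg_xvar_last]; rfl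
  have e3 : (piAlg q * piAlg q : RatFun (m + 1) ≃ₐ[ℂ] RatFun (m + 1)) (xvar (Fin.last m).succ) =
      (algebraMap ℂ (RatFun (m + 1)) (q⁻¹ : ℂˣ) * xvar (0 : Fin (m + 1)).succ :
        RatFun (m + 1)) := by
    rw [AlgEquiv.mul_apply, hl, piAlg_xvar_last, map_mul, AlgEquiv.commutes, ← Fin.castSucc_zero,
      piAlg_xvar_castSucc]
  change toLin (piAlg q * piAlg q) * _ = _ * toLin (piAlg q * piAlg q)
  apply toLin_mul_heckeEquiv k (piAlg q * piAlg q)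
  · apply algEquiv_ext
    intro a
    rw [AlgEquiv.mul_apply, AlgEquiv.mul_apply (permAlg (simple 0)), permAlg_xvar]
    rcases eq_or_ne a (Fin.last m).castSucc with rfl | h1
    · rw [simple_castSucc, e2, e3, map_mul, AlgEquiv.commutes, permAlg_xvar, simple_castSucc]
    rcases eq_or_ne a (Fin.last m).succ with rfl | h2
    · rw [simple_succ, e2, e3, map_mul, AlgEquiv.commutes, permAlg_xvar, simple_succ]
    · rw [simple_of_ne h1 h2]
      obtain ⟨b, rfl⟩ := Fin.exists_castSucc_eq.2 (hl ▸ h2)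
      have hb : b ≠ Fin.last m := fun h => h1 (h ▸ rfl)
      rw [e1 b hb, permAlg_xvar]
      obtain ⟨c, rfl⟩ := Fin.exists_castSucc_eq.2 hb
      rw [Fin.coeSucc_eq_succ, simple_of_ne] <;> simp [Fin.ext_iff]
  · rw [map_div₀, e2, e3, mul_div_mul_left]
    rw [Ne, FaithfulSMul.algebraMap_eq_zero_iff]
    exact Units.ne_zero _

end HeckeRelations
end
end BqKZ

namespace BqKZ
noncomputable section

/-! ### The basis `T_w` and the commuting elements `Y_i` -/

section HeckeBasis

variable {n : ℕ}

theorem heckeT_eq_word (k : ℂˣ) {w : Equiv.Perm (Fin (n + 1))} {l : List (Fin n)}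
    (hl : IsReducedWord l w) : heckeT k w = (l.map (heckeEquiv k)).prod :=
  matsumoto _ (fun _ _ h => heckeEquiv_comm k h) (fun _ _ h => heckeEquiv_braid k h)
    (redWord_spec w) hl

theorem heckeT_one (k : ℂˣ) : heckeT k (1 : Equiv.Perm (Fin (n + 1))) = 1 := by
  rw [heckeT_eq_word k (l := []) (isReducedWord_iff.2 ⟨by simp, by simp [invNum_one]⟩)]
  simp

theorem heckeT_simple_mul (k : ℂˣ) {w : Equiv.Perm (Fin (n + 1))} {i : Fin n}
    (h : w⁻¹ i.castSucc < w⁻¹ i.succ) : heckeT k (simple i * w) = heckeEquiv k i * heckeT k w := by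
  have h1 := isReducedWord_iff.1 (redWord_spec w)
  rw [heckeT_eq_word k (l := i :: redWord w)]
  · simp [heckeT]
  · rw [isReducedWord_iff]
    exact ⟨by simp [h1.1], by simp [h1.2, invNum_simple_mul h]⟩

theorem heckeT_mul_simple (k : ℂˣ) {w : Equiv.Perm (Fin (n + 1))} {i : Fin n}
    (h : w i.castSucc < w i.succ) : heckeT k (w * simple i) = heckeT k w * heckeEquiv k i := by
  have h1 := isReducedWord_iff.1 (redWord_spec w)
  rw [heckeT_eq_word k (l := redWord w ++ [i])]
  · simp [heckeT]
  · rw [isReducedWord_iff]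
    exact ⟨by simp [h1.1], by simp [h1.2, invNum_mul_simple h]⟩

theorem heckeT_of_descent (k : ℂˣ) {w : Equiv.Perm (Fin (n + 1))} {i : Fin n}
    (h : w i.succ < w i.castSucc) : heckeT k w = heckeT k (w * simple i) * heckeEquiv k i := by
  rw [← heckeT_mul_simple, mul_simple_cancel_right]
  simpa using h

theorem heckeT_of_left_descent (k : ℂˣ) {w : Equiv.Perm (Fin (n + 1))} {i : Fin n}
    (h : w⁻¹ i.succ < w⁻¹ i.castSucc) : heckeT k w = heckeEquiv k i * heckeT k (simple i * w) := by
  rw [← heckeT_simple_mul, simple_mul_cancel_left]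
  simpa using h

/-- Induction over the symmetric group along length-increasing right multiplications. -/
theorem perm_induction_right {P : Equiv.Perm (Fin (n + 1)) → Prop} (one : P 1)
    (step : ∀ w (i : Fin n), w i.castSucc < w i.succ → P w → P (w * simple i))
    (w : Equiv.Perm (Fin (n + 1))) : P w := by
  induction hm : invNum w using Nat.strong_induction_on generalizing w with
  | _ m ih =>
    by_cases hw : w = 1
    · rwa [hw]
    · obtain ⟨i, hi⟩ := exists_left_descent (w := w⁻¹) (by simpa using hw)
      rw [inv_inv] at hi
      have h1 := invNum_of_descent hi
      have h2 := step (w * simple i) i (by simpa using hi) (ih _ (by omega) _ rfl)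
      rwa [mul_simple_cancel_right] at h2

end HeckeBasis

/-! ### Commuting families in a group with braid relations -/

section Bernstein

variable {G : Type*} [Group G]

/-- The descending product `T_{m-1} ⋯ T_0`. -/
def descProd (T : ℕ → G) : ℕ → G
  | 0 => 1
  | m + 1 => T m * descProd T m

variable {n : ℕ} {T : ℕ → G}

theorem descProd_commute (hcomm : ∀ i j, i + 1 < j → j < n → T i * T j = T j * T i) {m j : ℕ}
    (hj : m < j) (hjn : j < n) : T j * descProd T m = descProd T m * T j := by
  induction m with
  | zero => simp [descProd]
  | succ m ih =>
    rw [descProd, ← mul_assoc, ← hcomm m j (by omega) hjn, mul_assoc, ih (by omega), mul_assoc]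

/-- `T (j+1)` passes the factors below `T j` by commutation, becomes `T j` through the braid
relation with `T (j+1) T j`, and then passes the remaining factors by commutation. -/
theorem descProd_mul (hcomm : ∀ i j, i + 1 < j → j < n → T i * T j = T j * T i)
    (hbraid : ∀ i, i + 1 < n → T i * T (i + 1) * T i = T (i + 1) * T i * T (i + 1))
    {m j : ℕ} (hm : m ≤ n) (hj : j + 1 < m) :
    descProd T m * T (j + 1) = T j * descProd T m := by
  induction m with
  | zero => omega
  | succ m ih =>
    rcases (Nat.lt_succ_iff.1 hj).lt_or_eq with h | h
    · rw [descProd, mul_assoc, ih (by omega) h, ← mul_assoc, ← mul_assoc,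
        hcomm j m h (by omega)]
    · subst h
      have h2 := descProd_commute hcomm (m := j) (j := j + 1) (by omega) (by omega)
      rw [descProd, descProd, mul_assoc, mul_assoc, ← h2]
      simp only [← mul_assoc]
      rw [hbraid j (by omega)]

/-- `Y_0 = π T_{n-1} ⋯ T_0` commutes with `T_i` for `i ≥ 1`. -/
theorem yZero_commute (hcomm : ∀ i j, i + 1 < j → j < n → T i * T j = T j * T i)
    (hbraid : ∀ i, i + 1 < n → T i * T (i + 1) * T i = T (i + 1) * T i * T (i + 1)) {p : G}
    (hp : ∀ i, i + 1 < n → p * T i = T (i + 1) * p) {i : ℕ} (hi : i + 1 < n) :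
    Commute (T (i + 1)) (p * descProd T n) := by
  rw [Commute, SemiconjBy, mul_assoc, descProd_mul hcomm hbraid le_rfl hi, ← mul_assoc,
    ← mul_assoc, hp i hi]

/-- `Y_0` commutes with `Y_1 = T_0⁻¹ Y_0 T_0⁻¹`. -/
theorem yZero_commute_yOne (hcomm : ∀ i j, i + 1 < j → j < n → T i * T j = T j * T i)
    (hbraid : ∀ i, i + 1 < n → T i * T (i + 1) * T i = T (i + 1) * T i * T (i + 1)) {p : G}
    (hp : ∀ i, i + 1 < n → p * T i = T (i + 1) * p) {m : ℕ} (hm : n = m + 1)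
    (hpp : p * p * T m = T 0 * (p * p)) :
    Commute (p * descProd T n) ((T 0)⁻¹ * (p * descProd T n) * (T 0)⁻¹) := by
  -- Here `d i = T_i ⋯ T_1`, the descending product without `T_0`. Then `Y_0 T_0⁻¹ = p d_m`, so `Y_0
  -- Y_1 = (p d_m)²`, and both orders of the product reduce to `p² (T_{m-1} ⋯ T_0) d_m`.
  obtain ⟨d, hd⟩ : ∃ d : ℕ → G, d = fun i => descProd T (i + 1) * (T 0)⁻¹ := ⟨_, rfl⟩
  have hdT : ∀ i, d i * T 0 = descProd T (i + 1) := by intro i; simp [hd]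
  have hd0 : d 0 = 1 := by simp [hd, descProd]
  have hds : ∀ i, d (i + 1) = T (i + 1) * d i := by intro i; simp [hd, descProd, mul_assoc]
  have hdp : ∀ i, i < n → d i * p = p * descProd T i := by
    intro i hi
    induction i with
    | zero => simp [hd0, descProd]
    | succ i ih => rw [hds, mul_assoc, ih (by omega), descProd, ← mul_assoc, ← hp i hi, mul_assoc]
  have hcd : ∀ i, i < n → descProd T n * d i = descProd T i * descProd T n := by
    intro i hi
    induction i with
    | zero => simp [hd0, descProd]
    | succ i ih =>
      rw [hds, ← mul_assoc, descProd_mul hcomm hbraid le_rfl hi, mul_assoc, ih (by omega), descProd,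
        mul_assoc]
  have hn : descProd T n = T m * descProd T m := by rw [hm]; rfl
  have hpp' : (T 0)⁻¹ * (p * p) = p * p * (T m)⁻¹ := by
    rw [inv_mul_eq_iff_eq_mul, ← mul_assoc, ← hpp, mul_inv_cancel_right]
  have e1 : p * descProd T n * (T 0)⁻¹ = p * d m := by
    rw [hm, ← hdT m]; group
  have e2 : p * d m * (p * d m) = p * p * (descProd T m * d m) := by
    have := hdp m (by omega)
    calc p * d m * (p * d m) = p * (d m * p) * d m := by group
      _ = _ := by rw [this]; group
  have e3 : (T 0)⁻¹ * (p * d m) * (p * descProd T n) =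
      p * p * ((T m)⁻¹ * (descProd T m * descProd T n)) := by
    have := hdp m (by omega)
    calc (T 0)⁻¹ * (p * d m) * (p * descProd T n)
        = (T 0)⁻¹ * (p * (d m * p)) * descProd T n := by group
      _ = ((T 0)⁻¹ * (p * p)) * (descProd T m * descProd T n) := by rw [this]; group
      _ = _ := by rw [hpp']; group
  have e4 : (T m)⁻¹ * (descProd T m * descProd T n) = descProd T m * d m := by
    rw [← hcd m (by omega), hn]; group
  rw [Commute, SemiconjBy]
  calc p * descProd T n * ((T 0)⁻¹ * (p * descProd T n) * (T 0)⁻¹)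
      = (p * descProd T n * (T 0)⁻¹) * (p * descProd T n * (T 0)⁻¹) := by group
    _ = (T 0)⁻¹ * (p * d m) * (p * descProd T n) := by rw [e1, e2, e3, e4]
    _ = _ := by rw [← e1]; group

variable {S : Fin n → G} {Y : Fin (n + 1) → G}

/-- Induction on `j` through `Y_{j+1} = S_j⁻¹ Y_j S_j⁻¹`. When `S_i` commutes with `S_j` the step is
immediate. When `j = i + 1` two steps are unwound: the braid relation turns `S_i` into `S_j` as it
passes `S_j⁻¹ S_i⁻¹`, and `S_j` commutes with `Y_i` by induction. -/
theorem commute_simple_y (hcomm : ∀ i j : Fin n, (i : ℕ) + 1 < j → S i * S j = S j * S i)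
    (hbraid : ∀ i j : Fin n, (i : ℕ) + 1 = j → S i * S j * S i = S j * S i * S j)
    (hY : ∀ i : Fin n, Y i.castSucc = S i * Y i.succ * S i)
    (h0 : ∀ i : Fin n, 0 < (i : ℕ) → Commute (S i) (Y 0)) (j : Fin (n + 1)) (i : Fin n)
    (h1 : j ≠ i.castSucc) (h2 : j ≠ i.succ) : Commute (S i) (Y j) := by
  have hY' : ∀ i : Fin n, Y i.succ = (S i)⁻¹ * Y i.castSucc * (S i)⁻¹ := by
    intro i; rw [hY]; group
  induction hm : (j : ℕ) using Nat.strong_induction_on generalizing i j with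
  | _ m ih =>
  rcases Fin.eq_zero_or_eq_succ j with rfl | ⟨j, rfl⟩
  · apply h0
    by_contra h
    exact h1 (by simp [Fin.ext_iff]; omega)
  · simp only [Fin.val_succ] at hm
    simp only [ne_eq, Fin.ext_iff, Fin.val_succ, Fin.val_castSucc] at h1 h2
    have hc : ∀ i : Fin n, (i : ℕ) + 1 < j ∨ (j : ℕ) + 1 < i → Commute (S i) (S j) := by
      rintro i (h | h)
      · exact hcomm i j h
      · exact (hcomm j i h).symm
    by_cases hij : (i : ℕ) + 1 = j
    · have hs : i.succ = j.castSucc := by simp [Fin.ext_iff, hij]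
      have h3 : Commute (S j) (Y i.castSucc) := by
        apply ih i (by omega) _ _ _ _ rfl <;> simp [Fin.ext_iff] <;> omega
      have hb := hbraid i j hij
      have b1 : S i * (S j)⁻¹ * (S i)⁻¹ = (S j)⁻¹ * (S i)⁻¹ * S j := by
        calc S i * (S j)⁻¹ * (S i)⁻¹ = (S j)⁻¹ * (S i)⁻¹ * (S i * S j * S i) * (S j)⁻¹ * (S i)⁻¹ := by
              group
          _ = _ := by rw [hb]; group
      have b2 : S j * (S i)⁻¹ * (S j)⁻¹ = (S i)⁻¹ * (S j)⁻¹ * S i := by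
        calc S j * (S i)⁻¹ * (S j)⁻¹ = (S i)⁻¹ * (S j)⁻¹ * (S j * S i * S j) * (S i)⁻¹ * (S j)⁻¹ := by
              group
          _ = _ := by rw [← hb]; group
      rw [hY', ← hs, hY', Commute, SemiconjBy]
      calc S i * ((S j)⁻¹ * ((S i)⁻¹ * Y i.castSucc * (S i)⁻¹) * (S j)⁻¹)
          = S i * (S j)⁻¹ * (S i)⁻¹ * Y i.castSucc * (S i)⁻¹ * (S j)⁻¹ := by group
        _ = (S j)⁻¹ * (S i)⁻¹ * (S j * Y i.castSucc) * (S i)⁻¹ * (S j)⁻¹ := by rw [b1]; group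
        _ = (S j)⁻¹ * (S i)⁻¹ * Y i.castSucc * (S j * (S i)⁻¹ * (S j)⁻¹) := by
            rw [h3.eq]; group
        _ = _ := by rw [b2]; group
    · have hc' := hc i (by omega)
      rw [hY']
      refine ((hc'.inv_right).mul_right ?_).mul_right hc'.inv_right
      apply ih j (by omega) _ _ _ _ rfl <;> simp [Fin.ext_iff] <;> omega

/-- Commutation spreads first from `Y_0, Y_1` to `Y_0, Y_j`, and then upward in the smaller index.
Each step conjugates only by an `S_i` that commutes with the other member of the pair. -/
theorem commute_y (hcomm : ∀ i j : Fin n, (i : ℕ) + 1 < j → S i * S j = S j * S i)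
    (hbraid : ∀ i j : Fin n, (i : ℕ) + 1 = j → S i * S j * S i = S j * S i * S j)
    (hY : ∀ i : Fin n, Y i.castSucc = S i * Y i.succ * S i)
    (h0 : ∀ i : Fin n, 0 < (i : ℕ) → Commute (S i) (Y 0))
    (h01 : ∀ i : Fin n, (i : ℕ) = 0 → Commute (Y 0) (Y i.succ)) (i j : Fin (n + 1)) :
    Commute (Y i) (Y j) := by
  have hY' : ∀ i : Fin n, Y i.succ = (S i)⁻¹ * Y i.castSucc * (S i)⁻¹ := by
    intro i; rw [hY]; group
  have hz : ∀ j, Commute (Y 0) (Y j) := by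
    intro j
    induction j using Fin.induction with
    | zero => exact Commute.refl _
    | succ j ih =>
      rcases Nat.eq_zero_or_pos (j : ℕ) with h | h
      · exact h01 j h
      · rw [hY']
        have h' := (h0 j h).symm.inv_right
        exact (h'.mul_right ih).mul_right h'
  have hlt : ∀ i j : Fin (n + 1), i < j → Commute (Y i) (Y j) := by
    intro i
    induction i using Fin.induction with
    | zero => intro j _; exact hz j
    | succ i ih =>
      intro j hj
      have hlt : i.castSucc < j := Fin.castSucc_lt_succ.trans hj
      have h' := (commute_simple_y hcomm hbraid hY h0 j i hlt.ne' hj.ne').inv_left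
      rw [hY']
      exact (h'.mul_left (ih j hlt)).mul_left h'
  rcases lt_trichotomy i j with h | rfl | h
  · exact hlt i j h
  · exact Commute.refl _
  · exact (hlt j i h).symm

end Bernstein

/-! ### The operators `Y_i` and the monomials `Y^ν` -/

section YOperators

variable {n : ℕ}

/-- Both lists are strictly increasing with the same entries. With `filter_castSucc_le_castSucc`,
this compares the words defining consecutive `Y_i`, as needed for `yOp_castSucc`. -/
theorem filter_castSucc_lt_succ (i : Fin n) :
    ((List.finRange n).filter fun j => j.castSucc < i.succ) =
      ((List.finRange n).filter fun j => j.castSucc < i.castSucc) ++ [i] := by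
  refine List.Perm.eq_of_pairwise (le := (· < ·)) (fun _ _ _ _ h h' => absurd h h'.asymm) ?_ ?_ ?_
  · exact (List.pairwise_lt_finRange n).filter _
  · rw [List.pairwise_append]
    exact ⟨(List.pairwise_lt_finRange n).filter _, by simp, by simp⟩
  · rw [List.perm_ext_iff_of_nodup]
    · intro a
      simp only [List.mem_filter, List.mem_finRange, true_and, decide_eq_true_eq, List.mem_append,
        List.mem_singleton, Fin.lt_def, Fin.ext_iff, Fin.val_castSucc, Fin.val_succ]
      omega
    · exact (List.nodup_finRange n).filter _
    · rw [List.nodup_append]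
      exact ⟨(List.nodup_finRange n).filter _, by simp, by simp; intros; omega⟩

theorem filter_castSucc_le_castSucc (i : Fin n) :
    ((List.finRange n).filter fun j => i.castSucc ≤ j.castSucc) =
      i :: ((List.finRange n).filter fun j => i.succ ≤ j.castSucc) := by
  refine List.Perm.eq_of_pairwise (le := (· < ·)) (fun _ _ _ _ h h' => absurd h h'.asymm) ?_ ?_ ?_
  · exact (List.pairwise_lt_finRange n).filter _
  · rw [List.pairwise_cons]
    exact ⟨fun a ha => Fin.castSucc_lt_castSucc_iff.1 (Fin.castSucc_lt_succ.trans_le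
      (of_decide_eq_true (List.mem_filter.1 ha).2)), (List.pairwise_lt_finRange n).filter _⟩
  · rw [List.perm_ext_iff_of_nodup]
    · intro a
      simp only [List.mem_filter, List.mem_finRange, true_and, decide_eq_true_eq, List.mem_cons,
        Fin.le_def, Fin.ext_iff, Fin.val_castSucc, Fin.val_succ]
      omega
    · exact (List.nodup_finRange n).filter _
    · rw [List.nodup_cons]
      exact ⟨by simp, (List.nodup_finRange n).filter _⟩

theorem yOp_castSucc (q k : ℂˣ) (i : Fin n) :
    yOp q k i.castSucc = heckeEquiv k i * yOp q k i.succ * heckeEquiv k i := by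
  unfold yOp
  rw [filter_castSucc_lt_succ, filter_castSucc_le_castSucc]
  simp only [List.map_append, List.prod_append, List.map_cons, List.map_nil, List.prod_cons,
    List.prod_nil, List.reverse_cons, mul_one, mul_inv_rev]
  group

/-- The Hecke operators indexed by natural numbers. -/
def heckeNat (n : ℕ) (k : ℂˣ) (i : ℕ) : RatFun n ≃ₗ[ℂ] RatFun n :=
  if h : i < n then heckeEquiv k ⟨i, h⟩ else 1

theorem heckeNat_val (k : ℂˣ) (i : Fin n) : heckeNat n k i = heckeEquiv k i := by simp [heckeNat]

theorem descProd_eq {G : Type*} [Group G] (T : ℕ → G) (m : ℕ) :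
    descProd T m = ((List.finRange m).reverse.map fun i : Fin m => T i).prod := by
  induction m with
  | zero => simp [descProd]
  | succ m ih =>
    rw [descProd, ih, List.finRange_succ_last]
    simp [List.map_reverse, Function.comp_def]

theorem yOp_zero (q k : ℂˣ) : yOp q k (0 : Fin (n + 1)) = piOp q * descProd (heckeNat n k) n := by
  rw [descProd_eq]
  simp only [heckeNat_val]
  simp [yOp]

theorem yOp_last (q k : ℂˣ) : yOp q k (Fin.last n) =
    (((List.finRange n).map (heckeEquiv k)).prod)⁻¹ * piOp q := by
  unfold yOp
  rw [List.filter_eq_self.2 (by simp [Fin.castSucc_lt_last]),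
    List.filter_eq_nil_iff.2 (by simp)]
  simp

theorem heckeNat_comm (k : ℂˣ) (i j : ℕ) (h : i + 1 < j) (hj : j < n) :
    heckeNat n k i * heckeNat n k j = heckeNat n k j * heckeNat n k i := by
  rw [heckeNat, heckeNat, dif_pos (by omega), dif_pos hj]
  exact heckeEquiv_comm k h

theorem heckeNat_braid (k : ℂˣ) (i : ℕ) (h : i + 1 < n) :
    heckeNat n k i * heckeNat n k (i + 1) * heckeNat n k i =
      heckeNat n k (i + 1) * heckeNat n k i * heckeNat n k (i + 1) := by
  rw [heckeNat, heckeNat, dif_pos (by omega), dif_pos h]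
  exact heckeEquiv_braid k rfl

theorem piOp_mul_heckeNat (q k : ℂˣ) (i : ℕ) (h : i + 1 < n) :
    piOp q * heckeNat n k i = heckeNat n k (i + 1) * piOp q := by
  rw [heckeNat, heckeNat, dif_pos (by omega), dif_pos h]
  exact piOp_mul_heckeEquiv q k rfl

theorem heckeEquiv_commute_yOp_zero (q k : ℂˣ) (i : Fin n) (hi : 0 < (i : ℕ)) :
    Commute (heckeEquiv k i) (yOp q k 0) := by
  obtain ⟨j, hj⟩ : ∃ j, (i : ℕ) = j + 1 := ⟨i - 1, by omega⟩
  have := i.isLt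
  rw [yOp_zero, ← heckeNat_val, hj]
  exact yZero_commute (heckeNat_comm k) (heckeNat_braid k) (piOp_mul_heckeNat q k) (by omega)

theorem heckeEquiv_commute_yOp (q k : ℂˣ) {i : Fin n} {j : Fin (n + 1)} (h1 : j ≠ i.castSucc)
    (h2 : j ≠ i.succ) : Commute (heckeEquiv k i) (yOp q k j) :=
  commute_simple_y (fun _ _ h => heckeEquiv_comm k h) (fun _ _ h => heckeEquiv_braid k h)
    (yOp_castSucc q k) (heckeEquiv_commute_yOp_zero q k) j i h1 h2

theorem yOp_commute (q k : ℂˣ) (i j : Fin (n + 1)) : Commute (yOp q k i) (yOp q k j) := by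
  refine commute_y (fun _ _ h => heckeEquiv_comm k h) (fun _ _ h => heckeEquiv_braid k h)
    (yOp_castSucc q k) (heckeEquiv_commute_yOp_zero q k) ?_ i j
  intro i hi
  obtain ⟨m, rfl⟩ : ∃ m, n = m + 1 := ⟨n - 1, by have := i.isLt; omega⟩
  have hi0 : i = 0 := Fin.ext hi
  subst hi0
  have h1 : yOp q k (0 : Fin (m + 1)).succ =
      (heckeEquiv k 0)⁻¹ * yOp q k 0 * (heckeEquiv k 0)⁻¹ := by
    have := yOp_castSucc q k (0 : Fin (m + 1))
    rw [Fin.castSucc_zero] at this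
    rw [this]; group
  have h2 : heckeEquiv k (0 : Fin (m + 1)) = heckeNat (m + 1) k 0 :=
    (heckeNat_val k (0 : Fin (m + 1))).symm
  rw [h1, yOp_zero, h2]
  refine yZero_commute_yOne (heckeNat_comm k) (heckeNat_braid k) (piOp_mul_heckeNat q k) rfl ?_
  rw [← h2, ← Fin.val_last m, heckeNat_val]
  exact piOp_sq_mul_heckeEquiv q k

theorem prod_ofFn_mul {G : Type*} [Group G] {m : ℕ} (f g : Fin m → G)
    (h : ∀ i j, Commute (f i) (g j)) :
    (List.ofFn fun i => f i * g i).prod = (List.ofFn f).prod * (List.ofFn g).prod := by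
  induction m with
  | zero => simp
  | succ m ih =>
    simp only [List.ofFn_succ, List.prod_cons]
    rw [ih (fun i => f i.succ) (fun i => g i.succ) fun i j => h _ _]
    have hc : Commute (List.ofFn fun i : Fin m => f i.succ).prod (g 0) := by
      apply Commute.list_prod_left
      intro x hx
      obtain ⟨i, rfl⟩ := List.mem_ofFn.1 hx
      exact h _ _
    rw [mul_assoc, mul_assoc, ← mul_assoc (g 0), ← hc.eq]
    simp only [mul_assoc]

theorem prod_ofFn_single {G : Type*} [Group G] {m : ℕ} (f : Fin m → G) (i : Fin m)
    (h : ∀ j, j ≠ i → f j = 1) : (List.ofFn f).prod = f i := by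
  induction m with
  | zero => exact i.elim0
  | succ m ih =>
    simp only [List.ofFn_succ, List.prod_cons]
    rcases Fin.eq_zero_or_eq_succ i with rfl | ⟨i, rfl⟩
    · have : (fun j : Fin m => f j.succ) = fun _ => 1 := by
        funext j; exact h _ (Fin.succ_ne_zero j)
      simp [this]
    · rw [h 0 (Fin.succ_ne_zero i).symm, one_mul]
      exact ih (fun j => f j.succ) i fun j hj => h _ (by simpa using hj)

theorem yPow_add (q k : ℂˣ) (ν μ : Lattice n) :
    yPow q k (ν + μ) = yPow q k ν * yPow q k μ := by
  unfold yPow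
  rw [← prod_ofFn_mul]
  · simp [zpow_add]
  · exact fun i j => (yOp_commute q k i j).zpow_zpow _ _

theorem yPow_zero (q k : ℂˣ) : yPow q k (0 : Lattice n) = 1 := by
  simp [yPow, List.prod_eq_one]

theorem yPow_single (q k : ℂˣ) (i : Fin (n + 1)) : yPow q k (Pi.single i 1) = yOp q k i := by
  unfold yPow
  rw [prod_ofFn_single _ i]
  · simp
  · intro j hj; simp [hj]

end YOperators

end
end BqKZ

namespace BqKZ
noncomputable section

/-! ### Left multiplication by `π` on the basis `T_w` -/

section Rotation

variable {n : ℕ}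

@[simp] theorem finRotate_castSucc (i : Fin n) : finRotate (n + 1) i.castSucc = i.succ := by
  rw [finRotate_apply, Fin.coeSucc_eq_succ]

@[simp] theorem finRotate_last' : finRotate (n + 1) (Fin.last n) = 0 := finRotate_last

theorem finRotate_lt {a b : Fin (n + 1)} (h : a < b) (hb : b ≠ Fin.last n) :
    finRotate (n + 1) a < finRotate (n + 1) b := by
  obtain ⟨b, rfl⟩ := Fin.exists_castSucc_eq.2 hb
  obtain ⟨a, rfl⟩ := Fin.exists_castSucc_eq.2 (h.trans_le (Fin.le_last _)).ne
  simpa using h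

/-- The rotation is increasing away from the largest value and sends that value to the bottom, so an
ascent of `w` is lost only if its upper value is the largest one. -/
theorem ascent_rotate_cases {w : Equiv.Perm (Fin (n + 1))} {i : Fin n}
    (h : w i.castSucc < w i.succ) :
    (w⁻¹ (Fin.last n) ≠ i.castSucc ∧ w⁻¹ (Fin.last n) ≠ i.succ ∧
      (finRotate (n + 1) * w) i.castSucc < (finRotate (n + 1) * w) i.succ) ∨
    (w⁻¹ (Fin.last n) = i.succ ∧
      (finRotate (n + 1) * w) i.succ < (finRotate (n + 1) * w) i.castSucc) := by
  have hne : w i.castSucc ≠ Fin.last n := (h.trans_le (Fin.le_last _)).ne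
  simp only [Equiv.Perm.mul_apply]
  by_cases h2 : w i.succ = Fin.last n
  · refine Or.inr ⟨by rw [← h2]; simp, ?_⟩
    rw [h2, finRotate_last']
    obtain ⟨a, ha⟩ := Fin.exists_castSucc_eq.2 hne
    rw [← ha, finRotate_castSucc]
    exact Fin.succ_pos a
  · refine Or.inl ⟨?_, ?_, finRotate_lt h h2⟩
    · rintro h3; apply hne; rw [← h3]; simp
    · rintro h3; apply h2; rw [← h3]; simp

/-- The five claims are carried through one induction: the values of the partial product at `i` and
`i + 1` show that appending `s_i` raises the length, and this in turn yields the product formula for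
`T` and the length. -/
theorem heckeT_rotate_prefix (k : ℂˣ) (i : Fin (n + 1)) :
    heckeT k ((((List.finRange n).filter fun j => j.castSucc < i).map simple).prod) =
      (((List.finRange n).filter fun j => j.castSucc < i).map (heckeEquiv k)).prod ∧
    (((List.finRange n).filter fun j => j.castSucc < i).map simple).prod i = 0 ∧
    (∀ a, i < a → (((List.finRange n).filter fun j => j.castSucc < i).map simple).prod a = a) ∧
    (∀ a : Fin n, a.castSucc < i →
      (((List.finRange n).filter fun j => j.castSucc < i).map simple).prod a.castSucc = a.succ) ∧
    len ((((List.finRange n).filter fun j => j.castSucc < i).map simple).prod) = i := by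
  induction i using Fin.induction with
  | zero =>
    rw [List.filter_eq_nil_iff.2 (by simp)]
    simp [heckeT_one, len_eq_invNum, invNum_one]
  | succ i ih =>
    obtain ⟨h1, h2, h3, h4, h5⟩ := ih
    rw [filter_castSucc_lt_succ]
    simp only [List.map_append, List.prod_append, List.map_cons, List.map_nil, List.prod_cons,
      List.prod_nil, mul_one]
    set w := (((List.finRange n).filter fun j => j.castSucc < i.castSucc).map simple).prod
    have hw : w i.castSucc < w i.succ := by
      rw [h2, h3 _ Fin.castSucc_lt_succ]; exact Fin.succ_pos i
    refine ⟨?_, ?_, ?_, ?_, ?_⟩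
    · rw [heckeT_mul_simple k hw, h1]
    · simp [h2]
    · intro a ha
      have ha' : i.castSucc < a := Fin.castSucc_lt_succ.trans ha
      rw [Equiv.Perm.mul_apply, simple_of_ne ha'.ne' ha.ne', h3 a ha']
    · intro a ha
      rcases (Fin.le_castSucc_iff.2 ha).lt_or_eq with h | h
      · rw [Equiv.Perm.mul_apply, simple_of_ne h.ne ha.ne, h4 a h]
      · rw [Equiv.Perm.mul_apply, h, simple_castSucc, h3 _ Fin.castSucc_lt_succ]
        simpa [Fin.ext_iff] using h.symm
    · rw [len_eq_invNum, invNum_mul_simple hw, ← len_eq_invNum, h5]; simp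

theorem rotate_prefix_last :
    (((List.finRange n).filter fun j => j.castSucc < Fin.last n).map simple).prod =
      finRotate (n + 1) := by
  obtain ⟨-, h2, -, h4, -⟩ := heckeT_rotate_prefix 1 (Fin.last n)
  ext1 a
  induction a using Fin.lastCases with
  | last => rw [h2]; simp
  | cast a => rw [h4 a (Fin.castSucc_lt_last a)]; simp

theorem heckeT_finRotate (k : ℂˣ) :
    heckeT k (finRotate (n + 1)) = ((List.finRange n).map (heckeEquiv k)).prod := by
  rw [← rotate_prefix_last, (heckeT_rotate_prefix k (Fin.last n)).1,
    List.filter_eq_self.2 (by simp [Fin.castSucc_lt_last])]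

theorem len_finRotate : len (finRotate (n + 1)) = n := by
  rw [← rotate_prefix_last, (heckeT_rotate_prefix 1 (Fin.last n)).2.2.2.2]; simp

/-- `π T_w = T_{σ w} Y_j` where `w j = N`. -/
theorem piOp_mul_heckeT (q k : ℂˣ) (w : Equiv.Perm (Fin (n + 1))) :
    piOp q * heckeT k w = heckeT k (finRotate (n + 1) * w) * yOp q k (w⁻¹ (Fin.last n)) := by
  induction w using perm_induction_right with
  | one => rw [heckeT_one, mul_one, mul_one, heckeT_finRotate, inv_one, Equiv.Perm.one_apply,
      yOp_last, mul_inv_cancel_left]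
  | step w i h ih =>
    rw [heckeT_mul_simple k h, ← mul_assoc, ih, mul_inv_rev, simple_inv, Equiv.Perm.mul_apply,
      ← mul_assoc]
    rcases ascent_rotate_cases h with ⟨h1, h2, h3⟩ | ⟨h1, h3⟩
    · rw [heckeT_mul_simple k h3, simple_of_ne h1 h2, mul_assoc, mul_assoc,
        (heckeEquiv_commute_yOp q k h1 h2).eq]
    · rw [heckeT_of_descent k h3, h1, simple_succ, yOp_castSucc]
      simp only [mul_assoc]

/-- If the largest value stands at position `j`, counted from `0`, rotation replaces its `n - j`
inversions by `j` new ones, a change of `-δ_j`. This is why `v_+` has central character `k^{-δ}`. -/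
theorem len_finRotate_mul (w : Equiv.Perm (Fin (n + 1))) :
    (len (finRotate (n + 1) * w) : ℤ) = len w - delta n (w⁻¹ (Fin.last n)) := by
  induction w using perm_induction_right with
  | one =>
    rw [mul_one, len_finRotate]
    simp [delta, len_eq_invNum, invNum_one]
    ring
  | step w i h ih =>
    rw [mul_inv_rev, simple_inv, Equiv.Perm.mul_apply, ← mul_assoc]
    rw [len_eq_invNum, len_eq_invNum] at *
    rcases ascent_rotate_cases h with ⟨h1, h2, h3⟩ | ⟨h1, h3⟩
    · rw [invNum_mul_simple h3, simple_of_ne h1 h2, invNum_mul_simple h]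
      push_cast
      linarith
    · have e := invNum_of_descent h3
      rw [h1] at ih ⊢
      rw [simple_succ, invNum_mul_simple h]
      have e2 : delta n i.castSucc = delta n i.succ + 2 := by simp [delta]; ring
      push_cast at *
      linarith

end Rotation

/-! ### `W` acting on the monomials `T_u Y^κ` -/

section Monomials

variable {n : ℕ}

/-- The group `W` of automorphisms of `ℂ(T)`. -/
def weylGroup (q : ℂˣ) : Subgroup (RatFun n ≃ₐ[ℂ] RatFun n) :=
  Subgroup.closure (Set.range (fun i : Fin n => permAlg (simple i)) ∪ {piAlg q})

theorem permAlg_mem_weylGroup (q : ℂˣ) (w : Equiv.Perm (Fin (n + 1))) :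
    permAlg w ∈ weylGroup q := by
  induction w using perm_induction_right with
  | one => rw [permAlg_one]; exact one_mem _
  | step w i _ ih =>
    rw [permAlg_mul]
    exact mul_mem ih (Subgroup.subset_closure (Or.inl ⟨i, rfl⟩))

theorem piAlg_mem_weylGroup (q : ℂˣ) : (piAlg q : RatFun n ≃ₐ[ℂ] RatFun n) ∈ weylGroup q :=
  Subgroup.subset_closure (Or.inr rfl)

/-- The permutation `(0 → j, i + 1 → (i-th index other than j))`. -/
def bringFront (j : Fin (n + 1)) : Equiv.Perm (Fin (n + 1)) := (Fin.cycleRange j)⁻¹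

@[simp] theorem bringFront_zero (j : Fin (n + 1)) : bringFront j 0 = j :=
  Fin.cycleRange_symm_zero j

@[simp] theorem bringFront_succ (j : Fin (n + 1)) (i : Fin n) :
    bringFront j i.succ = j.succAbove i := Fin.cycleRange_symm_succ j i

/-- The factorisation `ε_j = w π ρ⁻¹` with `ρ = w σ`. -/
theorem shiftAlg_single_eq (q : ℂˣ) (j : Fin (n + 1)) :
    shiftAlg q (Pi.single j 1) = permAlg (bringFront j) * piAlg q *
      (permAlg (bringFront j * finRotate (n + 1)))⁻¹ := by
  rw [eq_mul_inv_iff_mul_eq, piAlg, ← mul_assoc, ← permAlg_mul, permAlg_mul_shiftAlg]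
  congr 2
  funext i
  have : (bringFront j * finRotate (n + 1))⁻¹ i = Fin.last n ↔ i = j := by
    rw [Equiv.Perm.inv_eq_iff_eq]; simp
  simp only [Function.comp, Pi.single_apply, this]

theorem shiftAlg_mem_weylGroup (q : ℂˣ) (ν : Lattice n) : shiftAlg q ν ∈ weylGroup q := by
  let H : AddSubgroup (Lattice n) :=
    { carrier := {ν | shiftAlg q ν ∈ weylGroup q}
      zero_mem' := by simp only [Set.mem_ofPred_eq, shiftAlg_zero]; exact one_mem _
      add_mem' := fun {a b} ha hb => by
        simp only [Set.mem_ofPred_eq, shiftAlg_add]; exact mul_mem ha hb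
      neg_mem' := fun {a} ha => by
        simp only [Set.mem_ofPred_eq, shiftAlg_neg]; exact inv_mem ha }
  have h : ν ∈ H := by
    rw [← Finset.univ_sum_single ν]
    refine sum_mem fun j _ => ?_
    have h1 : (Pi.single j 1 : Lattice n) ∈ H := by
      change shiftAlg q _ ∈ weylGroup q
      rw [shiftAlg_single_eq]
      exact mul_mem (mul_mem (permAlg_mem_weylGroup q _) (piAlg_mem_weylGroup q))
        (inv_mem (permAlg_mem_weylGroup q _))
    have h2 : (Pi.single j (ν j) : Lattice n) = ν j • Pi.single j 1 := by
      rw [← Pi.single_smul]; simp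
    rw [h2]
    exact zsmul_mem h1 _
  exact h

/-- The operator `T_u Y^κ`. -/
def pbwMonomial (q k : ℂˣ) (p : Equiv.Perm (Fin (n + 1)) × Lattice n) : Module.End ℂ (RatFun n) :=
  (heckeT k p.1 * yPow q k p.2 : RatFun n ≃ₗ[ℂ] RatFun n).toLinearMap

/-- The operator underlying an automorphism. -/
def autEnd (A : RatFun n ≃ₐ[ℂ] RatFun n) : Module.End ℂ (RatFun n) := (toLin A).toLinearMap

@[simp] theorem autEnd_apply (A : RatFun n ≃ₐ[ℂ] RatFun n) (f : RatFun n) : autEnd A f = A f := rfl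

theorem autEnd_mul (A B : RatFun n ≃ₐ[ℂ] RatFun n) : autEnd (A * B) = autEnd A * autEnd B := rfl

theorem autEnd_one : autEnd (1 : RatFun n ≃ₐ[ℂ] RatFun n) = 1 := rfl

theorem autEnd_mul_smul (A : RatFun n ≃ₐ[ℂ] RatFun n) (r : RatFun n)
    (X : Module.End ℂ (RatFun n)) : autEnd A * (r • X) = A r • (autEnd A * X) := by
  ext1 f
  simp

theorem smul_mul_end (r : RatFun n) (X Z : Module.End ℂ (RatFun n)) :
    (r • X) * Z = r • (X * Z) := rfl

/-- `c_k(x_i / x_{i+1})⁻¹`. -/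
def cInv (k : ℂˣ) (i : Fin n) : RatFun n := (cfun k (xvar i.castSucc / xvar i.succ))⁻¹

theorem const_mul_xvar_sub_ne_zero (a b : ℂˣ) {i j : Fin (n + 1)} (h : i ≠ j) :
    (algebraMap ℂ (RatFun n) a * xvar i - algebraMap ℂ (RatFun n) b * xvar j) ≠ 0 := by
  have h1 : (algebraMap ℂ (RatFun n) a * xvar i - algebraMap ℂ (RatFun n) b * xvar j) =
      algebraMap (MvPolynomial (Fin (n + 1)) ℂ) (RatFun n)
        (MvPolynomial.C (a : ℂ) * MvPolynomial.X i - MvPolynomial.C (b : ℂ) * MvPolynomial.X j) := by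
    simp [xvar, IsScalarTower.algebraMap_apply ℂ (MvPolynomial (Fin (n + 1)) ℂ) (RatFun n)]
  rw [h1, Ne, FaithfulSMul.algebraMap_eq_zero_iff]
  intro h0
  have := congrArg (MvPolynomial.eval (Pi.single i 1)) h0
  simp [h.symm] at this

theorem cfun_ne_zero (k : ℂˣ) (i : Fin n) :
    (cfun k (xvar i.castSucc / xvar i.succ) : RatFun n) ≠ 0 := by
  have h : i.castSucc ≠ i.succ := Fin.castSucc_lt_succ.ne
  rw [cfun_eq k (xvar_ne_zero _)]
  exact div_ne_zero (const_mul_xvar_sub_ne_zero k⁻¹ k h.symm) (xvar_sub_ne_zero h.symm)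

/-- `s_i = 1 + c_k(x_i / x_{i+1})⁻¹ (T_i - k)`. -/
theorem autEnd_simple (k : ℂˣ) (i : Fin n) : autEnd (permAlg (simple i)) =
    (1 - cInv k i * algebraMap ℂ (RatFun n) k) • (1 : Module.End ℂ (RatFun n)) +
      cInv k i • (heckeEquiv k i).toLinearMap := by
  ext1 f
  have h := cfun_ne_zero k i
  have h2 : heckeEquiv k i f = algebraMap ℂ (RatFun n) k * f +
      cfun k (xvar i.castSucc / xvar i.succ) * (permAlg (simple i) f - f) := heckeOp_apply k i f
  simp only [autEnd_apply, LinearMap.add_apply, LinearMap.smul_apply, Module.End.one_apply,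
    LinearEquiv.coe_coe, h2, cInv, smul_eq_mul]
  field_simp
  ring

open Classical in
/-- The eigenvalue part of left multiplication by `T_i` on `T_w`. -/
def descCoeff {A : Type*} [Zero A] (c : A) (i : Fin n) (w : Equiv.Perm (Fin (n + 1))) : A :=
  if w⁻¹ i.succ < w⁻¹ i.castSucc then c else 0

theorem heckeEquiv_mul_heckeT (k : ℂˣ) (i : Fin n) (w : Equiv.Perm (Fin (n + 1))) :
    (heckeEquiv k i).toLinearMap * (heckeT k w).toLinearMap =
      (heckeT k (simple i * w)).toLinearMap +
        descCoeff (algebraMap ℂ (RatFun n) ((k : ℂ) - (k⁻¹ : ℂˣ).val)) i w •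
          (heckeT k w).toLinearMap := by
  ext1 f
  simp only [Module.End.mul_apply, LinearMap.add_apply, LinearMap.smul_apply, LinearEquiv.coe_coe,
    descCoeff, smul_eq_mul]
  rcases lt_or_gt_castSucc_succ w⁻¹ i with h | h
  · rw [if_neg h.asymm, zero_mul, add_zero, heckeT_simple_mul k h]; rfl
  · rw [if_pos h, heckeT_of_left_descent k h]
    simp only [LinearEquiv.mul_apply, heckeEquiv_quadratic]
    ring

/-- Left submodule spanned by the `T_u Y^κ` with `κ ∈ K`. -/
def pbwSpan (q k : ℂˣ) (K : Set (Lattice n)) : Submodule (RatFun n) (Module.End ℂ (RatFun n)) :=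
  Submodule.span (RatFun n) (pbwMonomial q k '' {p | p.2 ∈ K})

theorem pbwMonomial_mem (q k : ℂˣ) {K : Set (Lattice n)} (u : Equiv.Perm (Fin (n + 1)))
    {κ : Lattice n} (h : κ ∈ K) : pbwMonomial q k (u, κ) ∈ pbwSpan q k K :=
  Submodule.subset_span ⟨(u, κ), h, rfl⟩

theorem autEnd_mul_mem (q k : ℂˣ) {K K' : Set (Lattice n)} (A : RatFun n ≃ₐ[ℂ] RatFun n)
    (h : ∀ u κ, κ ∈ K → autEnd A * pbwMonomial q k (u, κ) ∈ pbwSpan q k K')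
    {X : Module.End ℂ (RatFun n)} (hX : X ∈ pbwSpan q k K) : autEnd A * X ∈ pbwSpan q k K' := by
  unfold pbwSpan at hX
  induction hX using Submodule.span_induction with
  | mem x hx => obtain ⟨p, hp, rfl⟩ := hx; exact h p.1 p.2 hp
  | zero => rw [mul_zero]; exact zero_mem _
  | add x y _ _ hx hy => rw [mul_add]; exact add_mem hx hy
  | smul r x _ hx => rw [autEnd_mul_smul]; exact Submodule.smul_mem _ _ hx

theorem pbwMonomial_eq (q k : ℂˣ) (u : Equiv.Perm (Fin (n + 1))) (κ : Lattice n) :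
    pbwMonomial q k (u, κ) = (heckeT k u).toLinearMap * (yPow q k κ).toLinearMap := rfl

theorem autEnd_simple_mul_monomial (q k : ℂˣ) (i : Fin n) (u : Equiv.Perm (Fin (n + 1)))
    (κ : Lattice n) : autEnd (permAlg (simple i)) * pbwMonomial q k (u, κ) =
      (1 - cInv k i * algebraMap ℂ (RatFun n) k +
        cInv k i * descCoeff (algebraMap ℂ (RatFun n) ((k : ℂ) - (k⁻¹ : ℂˣ).val)) i u) •
          pbwMonomial q k (u, κ) + cInv k i • pbwMonomial q k (simple i * u, κ) := by
  rw [pbwMonomial_eq, pbwMonomial_eq, autEnd_simple k i, add_mul, smul_mul_end, smul_mul_end,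
    ← mul_assoc (heckeEquiv k i).toLinearMap, heckeEquiv_mul_heckeT, one_mul, add_mul,
    smul_mul_end, smul_add, smul_smul, add_smul _ (cInv k i * _)]
  abel

/-- `π` permutes the monomials, so denominators enter the cocycle only through the simple
reflections. -/
theorem autEnd_pi_mul_monomial (q k : ℂˣ) (u : Equiv.Perm (Fin (n + 1))) (κ : Lattice n) :
    autEnd (piAlg q) * pbwMonomial q k (u, κ) =
      pbwMonomial q k (finRotate (n + 1) * u, Pi.single (u⁻¹ (Fin.last n)) 1 + κ) := by
  change (piOp q * (heckeT k u * yPow q k κ) : RatFun n ≃ₗ[ℂ] RatFun n).toLinearMap =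
    (heckeT k _ * yPow q k _ : RatFun n ≃ₗ[ℂ] RatFun n).toLinearMap
  rw [yPow_add, yPow_single, ← mul_assoc, ← mul_assoc, piOp_mul_heckeT]

theorem autEnd_pi_inv_mul_monomial (q k : ℂˣ) (u : Equiv.Perm (Fin (n + 1))) (κ : Lattice n) :
    autEnd (piAlg q)⁻¹ * pbwMonomial q k (u, κ) =
      pbwMonomial q k ((finRotate (n + 1))⁻¹ * u, -Pi.single (u⁻¹ 0) 1 + κ) := by
  have h := autEnd_pi_mul_monomial q k ((finRotate (n + 1))⁻¹ * u) (-Pi.single (u⁻¹ 0) 1 + κ)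
  have h2 : ((finRotate (n + 1))⁻¹ * u)⁻¹ (Fin.last n) = u⁻¹ 0 := by simp
  rw [h2, mul_inv_cancel_left, add_neg_cancel_left] at h
  rw [← h, ← mul_assoc, ← autEnd_mul, inv_mul_cancel, autEnd_one, one_mul]

theorem autEnd_perm_mul_mem (q k : ℂˣ) {K : Set (Lattice n)} (w : Equiv.Perm (Fin (n + 1)))
    {X : Module.End ℂ (RatFun n)} (hX : X ∈ pbwSpan q k K) :
    autEnd (permAlg w) * X ∈ pbwSpan q k K := by
  induction w using perm_induction_right generalizing X with
  | one => rwa [permAlg_one, autEnd_one, one_mul]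
  | step w i _ ih =>
    rw [permAlg_mul, autEnd_mul, mul_assoc]
    refine ih (autEnd_mul_mem q k _ (fun u κ hκ => ?_) hX)
    rw [autEnd_simple_mul_monomial]
    exact add_mem (Submodule.smul_mem _ _ (pbwMonomial_mem q k _ hκ))
      (Submodule.smul_mem _ _ (pbwMonomial_mem q k _ hκ))

/-- The nonnegative lattice vectors of degree `d`. -/
def posDeg (n d : ℕ) : Set (Lattice n) := {κ | (∀ i, 0 ≤ κ i) ∧ ∑ i, κ i = d}

/-- In the factorisation of `ε_j`, permutations leave `κ` unchanged and the single factor `π` adds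
one unit vector to it. -/
theorem autEnd_shift_single_mul_mem (q k : ℂˣ) {d : ℕ} (j : Fin (n + 1))
    {X : Module.End ℂ (RatFun n)} (hX : X ∈ pbwSpan q k (posDeg n d)) :
    autEnd (shiftAlg q (Pi.single j 1)) * X ∈ pbwSpan q k (posDeg n (d + 1)) := by
  rw [shiftAlg_single_eq, autEnd_mul, autEnd_mul, mul_assoc, mul_assoc, ← permAlg_inv]
  apply autEnd_perm_mul_mem
  refine autEnd_mul_mem q k (K := posDeg n d) _ (fun u κ hκ => ?_) (autEnd_perm_mul_mem q k _ hX)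
  rw [autEnd_pi_mul_monomial]
  apply pbwMonomial_mem
  refine ⟨fun i => add_nonneg ?_ (hκ.1 i), ?_⟩
  · rw [Pi.single_apply]; split_ifs <;> simp
  · simp only [Pi.add_apply, Finset.sum_add_distrib, hκ.2, Finset.sum_pi_single', Finset.mem_univ,
      if_true]
    push_cast; ring

/-- A nonnegative translation of degree `d` is a product of `d` unit translations. Keeping track of
the degree confines everything to finitely many monomials, which makes a dimension count possible.
-/
theorem weyl_mem_pbwSpan (q k : ℂˣ) (u : Equiv.Perm (Fin (n + 1))) {d : ℕ} {ν : Lattice n}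
    (hν : ν ∈ posDeg n d) :
    autEnd (shiftAlg q ν * permAlg u) ∈ pbwSpan q k (posDeg n d) := by
  induction d generalizing ν with
  | zero =>
    have h0 : ν = 0 := by
      funext i
      have := (Finset.sum_eq_zero_iff_of_nonneg (fun i _ => hν.1 i)).1 hν.2
      exact this i (Finset.mem_univ i)
    subst h0
    rw [shiftAlg_zero, one_mul, ← mul_one (autEnd _)]
    apply autEnd_perm_mul_mem
    have h1 : (1 : Module.End ℂ (RatFun n)) = pbwMonomial q k (1, 0) := by
      rw [pbwMonomial, heckeT_one, yPow_zero]; rfl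
    rw [h1]
    exact pbwMonomial_mem q k _ hν
  | succ d ih =>
    obtain ⟨j, hj⟩ : ∃ j, 0 < ν j := by
      by_contra! h
      have := Finset.sum_nonpos (s := Finset.univ) (f := ν) fun i _ => h i
      rw [hν.2] at this
      push_cast at this
      linarith
    have hν' : ν - Pi.single j 1 ∈ posDeg n d := by
      refine ⟨fun i => ?_, ?_⟩
      · rw [Pi.sub_apply, Pi.single_apply]
        split_ifs with h
        · subst h; linarith
        · simpa using hν.1 i
      · simp only [Pi.sub_apply, Finset.sum_sub_distrib, hν.2, Finset.sum_pi_single',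
          Finset.mem_univ, if_true]
        push_cast; ring
    have := autEnd_shift_single_mul_mem q k j (ih hν')
    rwa [← autEnd_mul, ← mul_assoc, ← shiftAlg_add, add_sub_cancel] at this

end Monomials
end
end BqKZ

namespace BqKZ
noncomputable section

/-! ### The Poincaré–Birkhoff–Witt theorem -/

section PBW

variable {n : ℕ}

theorem tpow_apply (q : ℂˣ) (ν : Lattice n) (i : Fin (n + 1)) : tpow q ν i = q ^ ν i := rfl

theorem weyl_injective {q : ℂˣ} (hq : ∀ m : ℤ, q ^ m = 1 → m = 0) :
    Function.Injective fun p : Equiv.Perm (Fin (n + 1)) × Lattice n =>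
      shiftAlg q p.2 * permAlg p.1 := by
  rintro ⟨u, ν⟩ ⟨u', ν'⟩ h
  have h1 : ∀ i, algebraMap ℂ (RatFun n) (q ^ (-ν (u i)) : ℂˣ) * xvar (u i) =
      algebraMap ℂ (RatFun n) (q ^ (-ν' (u' i)) : ℂˣ) * xvar (u' i) := by
    intro i
    have := DFunLike.congr_fun h (xvar i)
    simpa [AlgEquiv.mul_apply] using this
  have h2 : u = u' := by
    ext1 i
    by_contra hne
    exact const_mul_xvar_sub_ne_zero _ _ hne (sub_eq_zero.2 (h1 i))
  subst h2
  refine Prod.ext rfl (funext fun i => ?_)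
  have h3 := mul_right_cancel₀ (xvar_ne_zero _) (h1 (u⁻¹ i))
  have h4 := Units.ext ((algebraMap ℂ (RatFun n)).injective h3)
  have h6 : u (u⁻¹ i) = i := by simp
  rw [h6] at h4
  have h5 : q ^ (ν i - ν' i) = 1 := by
    rw [zpow_sub, ← inv_inj, mul_inv, inv_inv, ← zpow_neg, h4, zpow_neg]; simp
  exact sub_eq_zero.1 (hq _ h5)

/-- Dedekind's theorem on independence of characters, applied to pairwise distinct field
automorphisms. They are distinct because `q` is not a root of unity. -/
theorem linearIndependent_weyl {q : ℂˣ} (hq : ∀ m : ℤ, q ^ m = 1 → m = 0) :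
    LinearIndependent (RatFun n) fun p : Equiv.Perm (Fin (n + 1)) × Lattice n =>
      autEnd (shiftAlg q p.2 * permAlg p.1) := by
  let ev : Module.End ℂ (RatFun n) →ₗ[RatFun n] (RatFun n → RatFun n) :=
    { toFun := fun X f => X f
      map_add' := fun _ _ => rfl
      map_smul' := fun _ _ => rfl }
  apply LinearIndependent.of_comp ev
  have h := (linearIndependent_monoidHom (RatFun n) (RatFun n)).comp
    (fun p : Equiv.Perm (Fin (n + 1)) × Lattice n =>
      ((shiftAlg q p.2 * permAlg p.1 : RatFun n ≃ₐ[ℂ] RatFun n) : RatFun n →* RatFun n)) ?_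
  · exact h
  · intro p p' hp
    apply weyl_injective hq
    apply AlgEquiv.ext
    intro f
    exact DFunLike.congr_fun hp f

/-- Nonnegative lattice vectors of degree at most `d`. -/
def posBox (n d : ℕ) : Finset (Lattice n) :=
  (Fintype.piFinset fun _ => Finset.Icc (0 : ℤ) d).filter fun κ => ∑ i, κ i ≤ d

theorem mem_posBox {d : ℕ} {κ : Lattice n} :
    κ ∈ posBox n d ↔ (∀ i, 0 ≤ κ i) ∧ ∑ i, κ i ≤ d := by
  simp only [posBox, Finset.mem_filter, Fintype.mem_piFinset, Finset.mem_Icc]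
  constructor
  · rintro ⟨h1, h2⟩; exact ⟨fun i => (h1 i).1, h2⟩
  · rintro ⟨h1, h2⟩
    exact ⟨fun i => ⟨h1 i, (Finset.single_le_sum (fun i _ => h1 i) (Finset.mem_univ i)).trans h2⟩, h2⟩

/-- A dimension count: the span of `b` contains an independent family with the same finite index
set, so its dimension is at least the number of vectors in `b`. -/
theorem linearIndependent_of_mem_span_range {K V ι : Type*} [DivisionRing K] [AddCommGroup V]
    [Module K V] [Fintype ι] {b b' : ι → V} (hb' : LinearIndependent K b')
    (h : ∀ i, b' i ∈ Submodule.span K (Set.range b)) : LinearIndependent K b := by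
  rw [linearIndependent_iff_card_le_finrank_span]
  have h1 := linearIndependent_iff_card_eq_finrank_span.1 hb'
  rw [h1]
  have : FiniteDimensional K (Submodule.span K (Set.range b)) :=
    FiniteDimensional.span_of_finite _ (Set.finite_range _)
  apply Submodule.finrank_mono
  rw [Submodule.span_le]
  rintro _ ⟨i, rfl⟩
  exact h i

/-- In bounded nonnegative degree the monomials `T_u Y^κ` and the group elements `κ u` have the same
finite index set, and the latter are independent and lie in the span of the former. -/
theorem linearIndependent_posBox {q : ℂˣ} (hq : ∀ m : ℤ, q ^ m = 1 → m = 0) (k : ℂˣ) (d : ℕ) :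
    LinearIndependent (RatFun n) fun p : Equiv.Perm (Fin (n + 1)) × posBox n d =>
      pbwMonomial q k (p.1, p.2) := by
  have hinj : Function.Injective fun p : Equiv.Perm (Fin (n + 1)) × posBox n d =>
      (p.1, (p.2 : Lattice n)) := by
    rintro ⟨u, κ⟩ ⟨u', κ'⟩ h
    obtain ⟨h1, h2⟩ := Prod.mk.inj h
    exact Prod.ext h1 (Subtype.ext h2)
  refine linearIndependent_of_mem_span_range ((linearIndependent_weyl hq).comp _ hinj) ?_
  rintro ⟨u, κ, hκ⟩
  obtain ⟨h1, h2⟩ := mem_posBox.1 hκ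
  have hs : 0 ≤ ∑ i, κ i := Finset.sum_nonneg fun i _ => h1 i
  have hm := weyl_mem_pbwSpan q k u (d := (∑ i, κ i).toNat) (ν := κ) ⟨h1, by simp [hs]⟩
  refine Submodule.span_mono ?_ hm
  rintro _ ⟨⟨v, μ⟩, hμ, rfl⟩
  refine ⟨⟨v, μ, mem_posBox.2 ⟨hμ.1, ?_⟩⟩, rfl⟩
  rw [hμ.2]; simpa [hs] using h2

theorem pbwMonomial_mul_yPow (q k : ℂˣ) (u : Equiv.Perm (Fin (n + 1))) (κ μ : Lattice n) :
    pbwMonomial q k (u, κ) * (yPow q k μ).toLinearMap = pbwMonomial q k (u, κ + μ) := by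
  change ((heckeT k u * yPow q k κ) * yPow q k μ : RatFun n ≃ₗ[ℂ] RatFun n).toLinearMap = _
  rw [mul_assoc, ← yPow_add]
  rfl

theorem linearIndependent_pbwMonomial {q : ℂˣ} (hq : ∀ m : ℤ, q ^ m = 1 → m = 0) (k : ℂˣ) :
    LinearIndependent (RatFun n) (pbwMonomial (n := n) q k) := by
  classical
  rw [linearIndependent_iff_finset_linearIndependent]
  intro s
  obtain ⟨M, hM⟩ : ∃ M : ℕ, ∀ p ∈ s, ∀ i, -(M : ℤ) ≤ p.2 i := by
    refine ⟨s.sup fun p => Finset.univ.sup fun i => (p.2 i).natAbs, fun p hp i => ?_⟩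
    have h1 := Finset.le_sup (f := fun p : Equiv.Perm (Fin (n + 1)) × Lattice n =>
      Finset.univ.sup fun i => (p.2 i).natAbs) hp
    have h2 := Finset.le_sup (f := fun i => (p.2 i).natAbs) (Finset.mem_univ i)
    have := h2.trans h1
    omega
  obtain ⟨d, hd⟩ : ∃ d : ℕ, ∀ p ∈ s, ∑ i, (p.2 i + M) ≤ d := by
    refine ⟨s.sup fun p => (∑ i, (p.2 i + M)).natAbs, fun p hp => ?_⟩
    have h1 := Finset.le_sup (f := fun p : Equiv.Perm (Fin (n + 1)) × Lattice n =>
      (∑ i, (p.2 i + M)).natAbs) hp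
    omega
  -- Right multiplication by `Y^{(M, …, M)}` is left linear and translates the exponents of the
  -- given finite set into the nonnegative box, where independence is known.
  let ρ : Module.End ℂ (RatFun n) →ₗ[RatFun n] Module.End ℂ (RatFun n) :=
    { toFun := fun X => X * (yPow q k fun _ => (M : ℤ)).toLinearMap
      map_add' := fun X Z => add_mul _ _ _
      map_smul' := fun r X => rfl }
  apply LinearIndependent.of_comp ρ
  have h := (linearIndependent_posBox (n := n) hq k d).comp
    (fun p : s => (p.1.1, ⟨p.1.2 + fun _ => (M : ℤ), mem_posBox.2 ⟨fun i => ?_, hd p.1 p.2⟩⟩)) ?_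
  · convert h using 1
    funext p
    exact pbwMonomial_mul_yPow q k _ _ _
  · have := hM p.1 p.2 i
    simp only [Pi.add_apply]; omega
  · rintro ⟨⟨u, κ⟩, hp⟩ ⟨⟨u', κ'⟩, hp'⟩ h
    simpa using h

theorem pbw_injective {q : ℂˣ} (hq : ∀ m : ℤ, q ^ m = 1 → m = 0) (k : ℂˣ) :
    Function.Injective (pbw (n := n) q k) :=
  linearIndependent_pbwMonomial hq k

theorem pbwCoeff_pbw {q : ℂˣ} (hq : ∀ m : ℤ, q ^ m = 1 → m = 0) (k : ℂˣ)
    (c : (Equiv.Perm (Fin (n + 1)) × Lattice n) →₀ RatFun n) : pbwCoeff q k (pbw q k c) = c :=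
  Function.leftInverse_invFun (pbw_injective hq k) c

end PBW

/-! ### Matrices of automorphisms in the PBW basis -/

section Matrices

variable {n : ℕ}

/-- `F ↦ ∑ a_{u,κ} T_u Y^κ`. -/
def pbwSum (q k : ℂˣ) (F : Equiv.Perm (Fin (n + 1)) → AddMonoidAlgebra (RatFun n) (Lattice n)) :
    Module.End ℂ (RatFun n) :=
  ∑ u, (F u).coeff.sum fun κ a => a • pbwMonomial q k (u, κ)

theorem pbwSum_add (q k : ℂˣ)
    (F F' : Equiv.Perm (Fin (n + 1)) → AddMonoidAlgebra (RatFun n) (Lattice n)) :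
    pbwSum q k (F + F') = pbwSum q k F + pbwSum q k F' := by
  unfold pbwSum
  rw [← Finset.sum_add_distrib]
  refine Finset.sum_congr rfl fun u _ => ?_
  exact Finsupp.sum_add_index' (fun _ => zero_smul _ _) fun _ _ _ => add_smul _ _ _

theorem pbwSum_zero (q k : ℂˣ) :
    pbwSum q k (0 : Equiv.Perm (Fin (n + 1)) → AddMonoidAlgebra (RatFun n) (Lattice n)) = 0 := by
  simp [pbwSum]

theorem pbwSum_single (q k : ℂˣ) (u : Equiv.Perm (Fin (n + 1))) (κ : Lattice n) (a : RatFun n) :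
    pbwSum q k (Pi.single u (AddMonoidAlgebra.single κ a)) = a • pbwMonomial q k (u, κ) := by
  classical
  unfold pbwSum
  rw [Finset.sum_eq_single u]
  · rw [Pi.single_eq_same, AddMonoidAlgebra.coeff_single]
    exact Finsupp.sum_single_index (zero_smul _ _)
  · intro v _ hv
    simp [hv]
  · simp

/-- Induction principle for `H_0`-valued elements. -/
theorem vec_induction {A : Type*} [Semiring A]
    {P : (Equiv.Perm (Fin (n + 1)) → AddMonoidAlgebra A (Lattice n)) → Prop} (zero : P 0)
    (add : ∀ F F', P F → P F' → P (F + F'))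
    (single : ∀ u κ a, P (Pi.single u (AddMonoidAlgebra.single κ a)))
    (F : Equiv.Perm (Fin (n + 1)) → AddMonoidAlgebra A (Lattice n)) : P F := by
  classical
  rw [← Finset.univ_sum_single F]
  refine Finset.sum_induction _ P add zero fun u _ => ?_
  induction F u using AddMonoidAlgebra.induction_linear with
  | zero => rwa [Pi.single_zero]
  | add f g hf hg => rw [Pi.single_add]; exact add _ _ hf hg
  | single κ a => exact single u κ a

/-- Scaling a coordinate vector by `y^κ` is right multiplication by `Y^κ`. Since the `Y_i` commute,
this makes the coordinates a module over `ℂ(T)[y^{±1}]`. -/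
theorem pbwSum_smul_single (q k : ℂˣ)
    (F : Equiv.Perm (Fin (n + 1)) → AddMonoidAlgebra (RatFun n) (Lattice n)) (κ : Lattice n)
    (a : RatFun n) : pbwSum q k (AddMonoidAlgebra.single κ a • F) =
      a • (pbwSum q k F * (yPow q k κ).toLinearMap) := by
  induction F using vec_induction with
  | zero => simp [pbwSum_zero]
  | add F F' h h' => rw [smul_add, pbwSum_add, h, h', pbwSum_add, add_mul, smul_add]
  | single u μ b =>
    rw [← Pi.single_smul, smul_eq_mul, AddMonoidAlgebra.single_mul_single, pbwSum_single,
      pbwSum_single, smul_mul_end, pbwMonomial_mul_yPow, smul_smul, add_comm κ]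

theorem pbwCoeff_pbwSum {q : ℂˣ} (hq : ∀ m : ℤ, q ^ m = 1 → m = 0) (k : ℂˣ)
    (F : Equiv.Perm (Fin (n + 1)) → AddMonoidAlgebra (RatFun n) (Lattice n))
    (u : Equiv.Perm (Fin (n + 1))) :
    AddMonoidAlgebra.ofCoeff ((pbwCoeff q k (pbwSum q k F)).curry u) = F u := by
  classical
  have h : pbwSum q k F = pbw q k (Finsupp.uncurry
      (Finsupp.equivFunOnFinite.symm fun u => (F u).coeff)) := by
    change _ = Finsupp.linearCombination _ (pbwMonomial q k) _
    rw [Finsupp.linearCombination_apply,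
      Finsupp.sum_uncurry_index _ (fun p a => a • pbwMonomial q k p),
      Finsupp.sum_fintype]
    · rfl
    · intro _; exact Finsupp.sum_zero_index
  rw [h, pbwCoeff_pbw hq, Finsupp.curry_uncurry]
  rfl

end Matrices
end
end BqKZ

namespace BqKZ
noncomputable section

/-! ### The cocycle relation and the matrices of the generators -/

section Cocycle

variable {n : ℕ}

/-- Application of an automorphism to the coefficients. -/
def coefMap (A : RatFun n ≃ₐ[ℂ] RatFun n) :
    AddMonoidAlgebra (RatFun n) (Lattice n) →+* AddMonoidAlgebra (RatFun n) (Lattice n) :=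
  AddMonoidAlgebra.mapRingHom (Lattice n) (A : RatFun n →+* RatFun n)

@[simp] theorem coefMap_single (A : RatFun n ≃ₐ[ℂ] RatFun n) (κ : Lattice n) (a : RatFun n) :
    coefMap A (AddMonoidAlgebra.single κ a) = AddMonoidAlgebra.single κ (A a) :=
  AddMonoidAlgebra.mapRingHom_single _ _ _

theorem coefMap_mul (A B : RatFun n ≃ₐ[ℂ] RatFun n) :
    coefMap (A * B) = (coefMap A).comp (coefMap B) := by
  ext x <;> simp

theorem coefMap_one : coefMap (1 : RatFun n ≃ₐ[ℂ] RatFun n) = RingHom.id _ := by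
  ext x <;> simp

/-- The matrix of an automorphism: the cocycle value of an arbitrary element of `W`. -/
def cocMat (q k : ℂˣ) (A : RatFun n ≃ₐ[ℂ] RatFun n) :
    Matrix (Equiv.Perm (Fin (n + 1))) (Equiv.Perm (Fin (n + 1)))
      (AddMonoidAlgebra (RatFun n) (Lattice n)) :=
  fun u v => AddMonoidAlgebra.ofCoeff
    ((pbwCoeff q k (autEnd A * (heckeT k v).toLinearMap)).curry u)

theorem cocycle_eq (q k : ℂˣ) (ν : Lattice n) (u : Equiv.Perm (Fin (n + 1))) :
    cocycle q k ν u = cocMat q k (shiftAlg q ν * permAlg u) := rfl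

/-- `A T_v = ∑_{u,κ} M_{u,v,κ} T_u Y^κ`. -/
def HasMat (q k : ℂˣ) (A : RatFun n ≃ₐ[ℂ] RatFun n)
    (M : Matrix (Equiv.Perm (Fin (n + 1))) (Equiv.Perm (Fin (n + 1)))
      (AddMonoidAlgebra (RatFun n) (Lattice n))) : Prop :=
  ∀ v, autEnd A * (heckeT k v).toLinearMap = pbwSum q k (M.col v)

theorem HasMat.eq {q : ℂˣ} (hq : ∀ m : ℤ, q ^ m = 1 → m = 0) {k : ℂˣ}
    {A : RatFun n ≃ₐ[ℂ] RatFun n}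
    {M : Matrix (Equiv.Perm (Fin (n + 1))) (Equiv.Perm (Fin (n + 1)))
      (AddMonoidAlgebra (RatFun n) (Lattice n))} (h : HasMat q k A M) : cocMat q k A = M := by
  ext1 u v
  unfold cocMat
  rw [h v, pbwCoeff_pbwSum hq]
  rfl

/-- Passing a coefficient `a` to the left of `A` turns it into `A a`, while right multiplication by
`Y^κ` is unaffected. In coordinates `A` therefore acts by its matrix after a twist of the
coefficients, and the cocycle relation follows. -/
theorem HasMat.mul_pbwSum {q k : ℂˣ} {A : RatFun n ≃ₐ[ℂ] RatFun n}
    {M : Matrix (Equiv.Perm (Fin (n + 1))) (Equiv.Perm (Fin (n + 1)))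
      (AddMonoidAlgebra (RatFun n) (Lattice n))} (h : HasMat q k A M)
    (F : Equiv.Perm (Fin (n + 1)) → AddMonoidAlgebra (RatFun n) (Lattice n)) :
    autEnd A * pbwSum q k F = pbwSum q k (M.mulVec fun u => coefMap A (F u)) := by
  induction F using vec_induction with
  | zero => simp [pbwSum_zero, ← Pi.zero_def]
  | add F F' hF hF' =>
    rw [pbwSum_add, mul_add, hF, hF', ← pbwSum_add, ← Matrix.mulVec_add]
    congr 2
    funext u
    simp
  | single u κ a =>
    have h1 : (fun v => coefMap A ((Pi.single u (AddMonoidAlgebra.single κ a) :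
        Equiv.Perm (Fin (n + 1)) → AddMonoidAlgebra (RatFun n) (Lattice n)) v)) =
        Pi.single u (AddMonoidAlgebra.single κ (A a)) := by
      funext v
      rcases eq_or_ne v u with rfl | hv
      · simp
      · simp [hv]
    have h2 : M.mulVec (Pi.single u (AddMonoidAlgebra.single κ (A a))) =
        AddMonoidAlgebra.single κ (A a) • M.col u := by
      rw [Matrix.mulVec_single]
      funext v
      simp [mul_comm]
    rw [h1, h2, pbwSum_smul_single, ← h u, pbwSum_single, autEnd_mul_smul, pbwMonomial_eq,
      mul_assoc]

theorem HasMat.mul {q k : ℂˣ} {A B : RatFun n ≃ₐ[ℂ] RatFun n}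
    {M M' : Matrix (Equiv.Perm (Fin (n + 1))) (Equiv.Perm (Fin (n + 1)))
      (AddMonoidAlgebra (RatFun n) (Lattice n))} (h : HasMat q k A M) (h' : HasMat q k B M') :
    HasMat q k (A * B) (M * M'.map (coefMap A)) := by
  intro v
  rw [autEnd_mul, mul_assoc, h' v, h.mul_pbwSum]
  rfl

theorem pbwSum_single_zero_one (q k : ℂˣ) (v : Equiv.Perm (Fin (n + 1))) :
    pbwSum q k (Pi.single v 1) = (heckeT k v).toLinearMap := by
  rw [AddMonoidAlgebra.one_def, pbwSum_single, one_smul, pbwMonomial, yPow_zero, mul_one]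

theorem HasMat.one (q k : ℂˣ) : HasMat q k (1 : RatFun n ≃ₐ[ℂ] RatFun n) 1 := by
  intro v
  rw [autEnd_one, one_mul, ← pbwSum_single_zero_one q k v]
  congr 1
  funext u
  simp [Matrix.col_apply, Matrix.one_apply, Pi.single_apply]

/-- The matrix of left multiplication by `T_i`, where `c = k - k⁻¹`. -/
def leftMat {A : Type*} [CommRing A] (c : A) (i : Fin n) :
    Matrix (Equiv.Perm (Fin (n + 1))) (Equiv.Perm (Fin (n + 1))) A :=
  fun u v => (if u = simple i * v then 1 else 0) + if u = v then descCoeff c i v else 0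

/-- The matrix `T_w ↦ γ_{w⁻¹(N)} T_{σ w}`. -/
def rotMat {A : Type*} [CommRing A] (γ : Fin (n + 1) → A) :
    Matrix (Equiv.Perm (Fin (n + 1))) (Equiv.Perm (Fin (n + 1))) A :=
  fun u v => if u = finRotate (n + 1) * v then γ (v⁻¹ (Fin.last n)) else 0

/-- The constant `k - k⁻¹`. -/
def qdiff (k : ℂˣ) : ℂ := (k : ℂ) - (k⁻¹ : ℂˣ).val

/-- The matrix of `s_i` over `ℂ(T)`. -/
def simpleMat (k : ℂˣ) (i : Fin n) :
    Matrix (Equiv.Perm (Fin (n + 1))) (Equiv.Perm (Fin (n + 1))) (RatFun n) :=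
  (1 - cInv k i * algebraMap ℂ (RatFun n) k) • 1 +
    cInv k i • leftMat (algebraMap ℂ (RatFun n) (qdiff k)) i

theorem hasMat_simple (q k : ℂˣ) (i : Fin n) : HasMat q k (permAlg (simple i))
    ((simpleMat k i).map (algebraMap (RatFun n) (AddMonoidAlgebra (RatFun n) (Lattice n)))) := by
  intro v
  have h := autEnd_simple_mul_monomial q k i v 0
  have h1 : ∀ v : Equiv.Perm (Fin (n + 1)), pbwMonomial q k (v, 0) = (heckeT k v).toLinearMap := by
    intro v; rw [pbwMonomial, yPow_zero, mul_one]
  rw [h1] at h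
  rw [h, ← h1, ← pbwSum_single, ← pbwSum_single, ← pbwSum_add]
  congr 1
  funext u
  have hne : simple i * v ≠ v := by
    rw [Ne, mul_eq_right]
    intro h0
    have := DFunLike.congr_fun h0 i.castSucc
    rw [simple_castSucc] at this
    exact Fin.castSucc_lt_succ.ne' this
  simp only [Matrix.col_apply, Matrix.map_apply, simpleMat, Matrix.add_apply, Matrix.smul_apply,
    Matrix.one_apply, leftMat, Pi.add_apply, Pi.single_apply, AddMonoidAlgebra.coe_algebraMap,
    Function.comp, Algebra.algebraMap_self, RingHom.id_apply, smul_eq_mul, qdiff]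
  by_cases h2 : u = v
  · subst h2
    simp [hne.symm]
  · by_cases h3 : u = simple i * v
    · simp [h3, hne]
    · simp [h2, h3]

theorem hasMat_pi (q k : ℂˣ) : HasMat q k (piAlg q : RatFun n ≃ₐ[ℂ] RatFun n)
    (rotMat fun j => AddMonoidAlgebra.single (Pi.single j 1) 1) := by
  intro v
  have h := autEnd_pi_mul_monomial q k v 0
  rw [pbwMonomial, yPow_zero, mul_one, add_zero] at h
  rw [h, ← one_smul (RatFun n) (pbwMonomial q k _), ← pbwSum_single]
  congr 1
  funext u
  simp only [Matrix.col_apply, rotMat, Pi.single_apply]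

/-- The matrix `T_w ↦ y_{w⁻¹(1)}⁻¹ T_{σ⁻¹ w}`. -/
def rotInvMat (n : ℕ) : Matrix (Equiv.Perm (Fin (n + 1))) (Equiv.Perm (Fin (n + 1)))
    (AddMonoidAlgebra (RatFun n) (Lattice n)) :=
  fun u v => if u = (finRotate (n + 1))⁻¹ * v then
    AddMonoidAlgebra.single (-Pi.single (v⁻¹ 0) 1) 1 else 0

theorem hasMat_pi_inv (q k : ℂˣ) :
    HasMat q k ((piAlg q)⁻¹ : RatFun n ≃ₐ[ℂ] RatFun n) (rotInvMat n) := by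
  intro v
  have h := autEnd_pi_inv_mul_monomial q k v 0
  rw [pbwMonomial, yPow_zero, mul_one, add_zero] at h
  rw [h, ← one_smul (RatFun n) (pbwMonomial q k _), ← pbwSum_single]
  congr 1
  funext u
  simp only [Matrix.col_apply, rotInvMat, Pi.single_apply]

/-- `pbwCoeff` is a `Function.invFun`, so `cocMat` is meaningful only where an expansion exists. The
generators of `W` and their inverses have explicit expansions, and products inherit them. -/
theorem exists_hasMat (q k : ℂˣ) {A : RatFun n ≃ₐ[ℂ] RatFun n} (hA : A ∈ weylGroup q) :
    ∃ M, HasMat q k A M := by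
  unfold weylGroup at hA
  induction hA using Subgroup.closure_induction'' with
  | one => exact ⟨1, HasMat.one q k⟩
  | mem x hx =>
    rcases hx with ⟨i, rfl⟩ | rfl
    · exact ⟨_, hasMat_simple q k i⟩
    · exact ⟨_, hasMat_pi q k⟩
  | inv_mem x hx =>
    rcases hx with ⟨i, rfl⟩ | rfl
    · have h := hasMat_simple q k i
      rw [← simple_inv, permAlg_inv] at h
      exact ⟨_, h⟩
    · exact ⟨_, hasMat_pi_inv q k⟩
  | mul x y _ _ hx hy =>
    obtain ⟨M, hM⟩ := hx
    obtain ⟨M', hM'⟩ := hy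
    exact ⟨_, hM.mul hM'⟩

theorem hasMat_cocMat {q : ℂˣ} (hq : ∀ m : ℤ, q ^ m = 1 → m = 0) (k : ℂˣ)
    {A : RatFun n ≃ₐ[ℂ] RatFun n} (hA : A ∈ weylGroup q) : HasMat q k A (cocMat q k A) := by
  obtain ⟨M, hM⟩ := exists_hasMat q k hA
  rwa [hM.eq hq]

theorem cocMat_mul {q : ℂˣ} (hq : ∀ m : ℤ, q ^ m = 1 → m = 0) (k : ℂˣ)
    {A B : RatFun n ≃ₐ[ℂ] RatFun n} (hA : A ∈ weylGroup q) (hB : B ∈ weylGroup q) :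
    cocMat q k (A * B) = cocMat q k A * (cocMat q k B).map (coefMap A) :=
  ((hasMat_cocMat hq k hA).mul (hasMat_cocMat hq k hB)).eq hq

theorem cocMat_one {q : ℂˣ} (hq : ∀ m : ℤ, q ^ m = 1 → m = 0) (k : ℂˣ) :
    cocMat q k (1 : RatFun n ≃ₐ[ℂ] RatFun n) = 1 := (HasMat.one q k).eq hq

theorem cocMat_simple {q : ℂˣ} (hq : ∀ m : ℤ, q ^ m = 1 → m = 0) (k : ℂˣ) (i : Fin n) :
    cocMat q k (permAlg (simple i)) = (simpleMat k i).map
      (algebraMap (RatFun n) (AddMonoidAlgebra (RatFun n) (Lattice n))) :=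
  (hasMat_simple q k i).eq hq

theorem cocMat_pi_inv {q : ℂˣ} (hq : ∀ m : ℤ, q ^ m = 1 → m = 0) (k : ℂˣ) :
    cocMat q k ((piAlg q)⁻¹ : RatFun n ≃ₐ[ℂ] RatFun n) = rotInvMat n :=
  (hasMat_pi_inv q k).eq hq

theorem cocMat_pi {q : ℂˣ} (hq : ∀ m : ℤ, q ^ m = 1 → m = 0) (k : ℂˣ) :
    cocMat q k (piAlg q : RatFun n ≃ₐ[ℂ] RatFun n) =
      rotMat fun j => AddMonoidAlgebra.single (Pi.single j 1) 1 :=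
  (hasMat_pi q k).eq hq

end Cocycle
end
end BqKZ

namespace BqKZ
noncomputable section

/-! ### Compatibility of the cocycle with the dual intertwiners -/

section Coordinates

variable {n : ℕ} {A : Type*} [CommRing A]

/-- The matrix `M_{u⁻¹,v⁻¹}`, that is `C_ι M C_ι`. -/
def iotaMat (M : Matrix (Equiv.Perm (Fin (n + 1))) (Equiv.Perm (Fin (n + 1))) A) :
    Matrix (Equiv.Perm (Fin (n + 1))) (Equiv.Perm (Fin (n + 1))) A :=
  M.submatrix (Equiv.inv _) (Equiv.inv _)

theorem iotaMat_apply (M : Matrix (Equiv.Perm (Fin (n + 1))) (Equiv.Perm (Fin (n + 1))) A)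
    (u v : Equiv.Perm (Fin (n + 1))) : iotaMat M u v = M u⁻¹ v⁻¹ := rfl

theorem iotaMat_mul (M M' : Matrix (Equiv.Perm (Fin (n + 1))) (Equiv.Perm (Fin (n + 1))) A) :
    iotaMat (M * M') = iotaMat M * iotaMat M' :=
  (Matrix.submatrix_mul_equiv M M' _ (Equiv.inv _) _).symm

theorem iotaMat_one :
    iotaMat (1 : Matrix (Equiv.Perm (Fin (n + 1))) (Equiv.Perm (Fin (n + 1))) A) = 1 :=
  Matrix.submatrix_one_equiv _

theorem iotaMat_map {B : Type*} [CommRing B] (f : A → B)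
    (M : Matrix (Equiv.Perm (Fin (n + 1))) (Equiv.Perm (Fin (n + 1))) A) :
    iotaMat (M.map f) = (iotaMat M).map f := rfl

theorem iotaMat_mulVec (M : Matrix (Equiv.Perm (Fin (n + 1))) (Equiv.Perm (Fin (n + 1))) A)
    (f : Equiv.Perm (Fin (n + 1)) → A) : (iotaMat M).mulVec f = cIota (M.mulVec (cIota f)) := by
  funext u
  simp only [Matrix.mulVec, dotProduct, iotaMat_apply, cIota]
  exact Fintype.sum_equiv (Equiv.inv _) _ _ fun v => by simp

/-- The matrix `T_w ↦ g_{w(N)} T_{w σ⁻¹}`. -/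
def dualRotMat (g : Fin (n + 1) → A) :
    Matrix (Equiv.Perm (Fin (n + 1))) (Equiv.Perm (Fin (n + 1))) A :=
  fun u v => if u = v * (finRotate (n + 1))⁻¹ then g (v (Fin.last n)) else 0

theorem iotaMat_rotMat (g : Fin (n + 1) → A) : iotaMat (rotMat g) = dualRotMat g := by
  ext1 u v
  simp only [iotaMat_apply, rotMat, dualRotMat, inv_inv]
  congr 1
  rw [eq_iff_iff, inv_eq_iff_eq_inv, mul_inv_rev, inv_inv]

theorem iotaMat_dualRotMat (g : Fin (n + 1) → A) : iotaMat (dualRotMat g) = rotMat g := by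
  rw [← iotaMat_rotMat]
  ext1 u v
  simp [iotaMat_apply]

/-- The matrix of left multiplication by `(1 - z) T_i - c`. -/
def interMat (c z : A) (i : Fin n) :
    Matrix (Equiv.Perm (Fin (n + 1))) (Equiv.Perm (Fin (n + 1))) A :=
  (-c) • 1 + (1 - z) • leftMat c i

theorem simple_mul_ne (i : Fin n) (v : Equiv.Perm (Fin (n + 1))) : simple i * v ≠ v := by
  rw [Ne, mul_eq_right]
  intro h0
  have := DFunLike.congr_fun h0 i.castSucc
  rw [simple_castSucc] at this
  exact Fin.castSucc_lt_succ.ne' this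

theorem interMat_self (c z : A) (i : Fin n) (v : Equiv.Perm (Fin (n + 1))) :
    interMat c z i v v = -c + (1 - z) * descCoeff c i v := by
  simp [interMat, leftMat, (simple_mul_ne i v).symm]

theorem interMat_simple_mul (c z : A) (i : Fin n) (v : Equiv.Perm (Fin (n + 1))) :
    interMat c z i (simple i * v) v = 1 - z := by
  simp [interMat, leftMat, simple_mul_ne i v]

theorem interMat_of_ne (c z : A) (i : Fin n) {u v : Equiv.Perm (Fin (n + 1))} (h : u ≠ v)
    (h' : u ≠ simple i * v) : interMat c z i u v = 0 := by
  simp [interMat, leftMat, h, h']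

theorem mul_dualRotMat (M : Matrix (Equiv.Perm (Fin (n + 1))) (Equiv.Perm (Fin (n + 1))) A)
    (g : Fin (n + 1) → A) (u v : Equiv.Perm (Fin (n + 1))) :
    (M * dualRotMat g) u v = M u (v * (finRotate (n + 1))⁻¹) * g (v (Fin.last n)) := by
  simp [Matrix.mul_apply, dualRotMat]

theorem dualRotMat_mul (M : Matrix (Equiv.Perm (Fin (n + 1))) (Equiv.Perm (Fin (n + 1))) A)
    (g : Fin (n + 1) → A) (u v : Equiv.Perm (Fin (n + 1))) :
    (dualRotMat g * M) (u * (finRotate (n + 1))⁻¹) v = g (u (Fin.last n)) * M u v := by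
  simp [Matrix.mul_apply, dualRotMat]

theorem descCoeff_of_lt (c : A) {i : Fin n} {w : Equiv.Perm (Fin (n + 1))}
    (h : w⁻¹ i.castSucc < w⁻¹ i.succ) : descCoeff c i w = 0 := if_neg h.asymm

theorem descCoeff_of_gt (c : A) {i : Fin n} {w : Equiv.Perm (Fin (n + 1))}
    (h : w⁻¹ i.succ < w⁻¹ i.castSucc) : descCoeff c i w = c := if_pos h

theorem finRotate_pos {a : Fin (n + 1)} (ha : a ≠ Fin.last n) : 0 < finRotate (n + 1) a := by
  obtain ⟨b, rfl⟩ := Fin.exists_castSucc_eq.2 ha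
  rw [finRotate_castSucc]; exact Fin.succ_pos b

/-- The off-diagonal entries agree at once. On the diagonal, rotation changes whether `i` is a
descent of `u` only when `u` sends the last index to `i` or `i + 1`, and there `z g_i = g_{i+1}`
accounts for the difference. -/
theorem interMat_mul_dualRotMat (c z : A) (i : Fin n) (g : Fin (n + 1) → A)
    (hg : z * g i.castSucc = g i.succ) :
    interMat c z i * dualRotMat (g ∘ simple i) = dualRotMat g * interMat c z i := by
  ext1 u v
  obtain ⟨u, rfl⟩ : ∃ u', u = u' * (finRotate (n + 1))⁻¹ := ⟨u * finRotate (n + 1), by simp⟩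
  rw [mul_dualRotMat, dualRotMat_mul]
  by_cases h1 : u = v
  · subst h1
    rw [interMat_self, interMat_self, Function.comp_apply]
    have e : (u * (finRotate (n + 1))⁻¹)⁻¹ = finRotate (n + 1) * u⁻¹ := by simp
    have hd : ∀ {a b : Fin (n + 1)}, b ≠ u (Fin.last n) → u⁻¹ b ≠ Fin.last n := by
      intro _ b hb h; apply hb; rw [← h]; simp
    by_cases ha : u (Fin.last n) = i.castSucc
    · have h2 : u⁻¹ i.castSucc = Fin.last n := by rw [← ha]; simp
      have h3 : u⁻¹ i.succ ≠ Fin.last n :=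
        hd (a := 0) (by rw [ha]; exact Fin.castSucc_lt_succ.ne')
      rw [descCoeff_of_gt c (w := u) (by rw [h2]; exact lt_of_le_of_ne (Fin.le_last _) h3),
        descCoeff_of_lt c (by
          rw [e, Equiv.Perm.mul_apply, Equiv.Perm.mul_apply, h2, finRotate_last']
          exact finRotate_pos h3), ha, simple_castSucc]
      linear_combination c * hg
    by_cases hb : u (Fin.last n) = i.succ
    · have h2 : u⁻¹ i.succ = Fin.last n := by rw [← hb]; simp
      have h3 : u⁻¹ i.castSucc ≠ Fin.last n :=
        hd (a := 0) (by rw [hb]; exact Fin.castSucc_lt_succ.ne)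
      rw [descCoeff_of_lt c (w := u) (by rw [h2]; exact lt_of_le_of_ne (Fin.le_last _) h3),
        descCoeff_of_gt c (by
          rw [e, Equiv.Perm.mul_apply, Equiv.Perm.mul_apply, h2, finRotate_last']
          exact finRotate_pos h3), hb, simple_succ]
      linear_combination -c * hg
    · have h2 := hd (a := 0) (Ne.symm ha)
      have h3 := hd (a := 0) (Ne.symm hb)
      rw [simple_of_ne ha hb, mul_comm]
      congr 3
      rcases lt_or_gt_castSucc_succ u⁻¹ i with h | h
      · rw [descCoeff_of_lt c h, descCoeff_of_lt c (by rw [e]; exact finRotate_lt h h3)]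
      · rw [descCoeff_of_gt c h, descCoeff_of_gt c (by rw [e]; exact finRotate_lt h h2)]
  by_cases h2 : u = simple i * v
  · subst h2
    rw [mul_assoc, interMat_simple_mul, interMat_simple_mul, mul_comm]
    rfl
  · rw [interMat_of_ne, interMat_of_ne _ _ _ h1 h2, mul_zero, zero_mul]
    · simpa using h1
    · rw [← mul_assoc]; simpa using h2

/-- Both composites send `T_v` to a multiple of `T_{σ v σ⁻¹}`, so only the scalars need comparison.
-/
theorem rotMat_mul_dualRotMat (a a' b b' : Fin (n + 1) → A)
    (h : ∀ v : Equiv.Perm (Fin (n + 1)),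
      b (v (Fin.last n)) * a (finRotate (n + 1) (v⁻¹ (Fin.last n))) =
      a' (v⁻¹ (Fin.last n)) * b' (finRotate (n + 1) (v (Fin.last n)))) :
    rotMat a * dualRotMat b = dualRotMat b' * rotMat a' := by
  ext1 u v
  obtain ⟨u, rfl⟩ : ∃ u', u = u' * (finRotate (n + 1))⁻¹ := ⟨u * finRotate (n + 1), by simp⟩
  rw [mul_dualRotMat, dualRotMat_mul]
  simp only [rotMat]
  by_cases h1 : u = finRotate (n + 1) * v
  · subst h1
    rw [if_pos (mul_assoc _ _ _), if_pos rfl, mul_comm, mul_inv_rev, inv_inv]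
    simp only [Equiv.Perm.mul_apply]
    rw [h, mul_comm]
  · rw [if_neg h1, if_neg, mul_zero, zero_mul]
    rw [← mul_assoc]
    simpa using h1

theorem simple_mul_eq_of_swap {i j : Fin n} {v : Equiv.Perm (Fin (n + 1))}
    (h : v⁻¹ i.castSucc = j.castSucc ∧ v⁻¹ i.succ = j.succ ∨
      v⁻¹ i.succ = j.castSucc ∧ v⁻¹ i.castSucc = j.succ) : simple i * v = v * simple j := by
  suffices h1 : v * simple j * v⁻¹ = simple i by rw [← h1]; group
  rw [simple, ← Equiv.swap_apply_apply]
  rcases h with ⟨h2, h3⟩ | ⟨h2, h3⟩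
  · rw [← h2, ← h3]; simp [simple]
  · rw [← h2, ← h3]; simp [simple, Equiv.swap_comm]

/-- `s_j` reverses the order of `v⁻¹ i` and `v⁻¹ (i+1)` only if these are `j` and `j + 1` in some
order, and in that case `s_i v = v s_j`. -/
theorem descCoeff_mul_simple (c : A) {i j : Fin n} {v : Equiv.Perm (Fin (n + 1))}
    (h : simple i * v ≠ v * simple j) : descCoeff c i (v * simple j) = descCoeff c i v := by
  have h1 := mt (simple_mul_eq_of_swap (i := i) (j := j) (v := v)) h
  rw [not_or] at h1
  have e : (v * simple j)⁻¹ = simple j * v⁻¹ := by simp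
  rcases lt_or_gt_castSucc_succ v⁻¹ i with h2 | h2
  · rw [descCoeff_of_lt c h2, descCoeff_of_lt c (by rw [e]; exact simple_lt_simple h2 h1.1)]
  · rw [descCoeff_of_gt c h2, descCoeff_of_gt c (by rw [e]; exact simple_lt_simple h2 h1.2)]

theorem descCoeff_inv_of_eq (c : A) {i j : Fin n} {v : Equiv.Perm (Fin (n + 1))}
    (h : simple i * v = v * simple j) : descCoeff c j v⁻¹ = descCoeff c i v := by
  have h1 : Equiv.swap (v j.castSucc) (v j.succ) = simple i := by
    rw [Equiv.swap_apply_apply]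
    exact (mul_inv_eq_iff_eq_mul.2 h.symm)
  have h2 : v j.castSucc = i.castSucc ∧ v j.succ = i.succ ∨
      v j.castSucc = i.succ ∧ v j.succ = i.castSucc := by
    have h3 : v j.succ = simple i (v j.castSucc) := by rw [← h1]; simp
    have hne : v j.castSucc ≠ v j.succ := by simp [Fin.castSucc_lt_succ.ne]
    rcases eq_or_ne (v j.castSucc) i.castSucc with h4 | h4
    · left; rw [h3, h4]; simp
    rcases eq_or_ne (v j.castSucc) i.succ with h5 | h5
    · right; rw [h3, h5]; simp
    · rw [simple_of_ne h4 h5] at h3; exact absurd h3.symm hne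
  have hj : j.castSucc < j.succ := Fin.castSucc_lt_succ
  have hi : i.castSucc < i.succ := Fin.castSucc_lt_succ
  rcases h2 with ⟨h2, h3⟩ | ⟨h2, h3⟩
  · have h4 : v⁻¹ i.castSucc = j.castSucc := by rw [← h2]; simp
    have h5 : v⁻¹ i.succ = j.succ := by rw [← h3]; simp
    rw [descCoeff_of_lt c (by rw [inv_inv, h2, h3]; exact hi),
      descCoeff_of_lt c (by rw [h4, h5]; exact hj)]
  · have h4 : v⁻¹ i.castSucc = j.succ := by rw [← h3]; simp
    have h5 : v⁻¹ i.succ = j.castSucc := by rw [← h2]; simp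
    rw [descCoeff_of_gt c (by rw [inv_inv, h2, h3]; exact hi),
      descCoeff_of_gt c (by rw [h4, h5]; exact hj)]

theorem descCoeff_simple_mul_self (c : A) (i : Fin n) (v : Equiv.Perm (Fin (n + 1))) :
    descCoeff c i (simple i * v) = c - descCoeff c i v := by
  have e : (simple i * v)⁻¹ = v⁻¹ * simple i := by simp
  rcases lt_or_gt_castSucc_succ v⁻¹ i with h2 | h2
  · rw [descCoeff_of_lt c h2, descCoeff_of_gt c (by rw [e]; simpa using h2), sub_zero]
  · rw [descCoeff_of_gt c h2, descCoeff_of_lt c (by rw [e]; simpa using h2), sub_self]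

theorem leftMat_mulVec_single (c : A) (i : Fin n) (v : Equiv.Perm (Fin (n + 1))) :
    (leftMat c i).mulVec (Pi.single v 1) =
      Pi.single (simple i * v) 1 + descCoeff c i v • Pi.single v 1 := by
  rw [Matrix.mulVec_single_one]
  funext u
  simp [leftMat, Matrix.col_apply, Pi.single_apply]

theorem iotaMat_leftMat_mulVec_single (c : A) (i : Fin n) (v : Equiv.Perm (Fin (n + 1))) :
    (iotaMat (leftMat c i)).mulVec (Pi.single v 1) =
      Pi.single (v * simple i) 1 + descCoeff c i v⁻¹ • Pi.single v 1 := by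
  rw [Matrix.mulVec_single_one]
  funext u
  have : u⁻¹ = simple i * v⁻¹ ↔ u = v * simple i := by
    rw [inv_eq_iff_eq_inv, mul_inv_rev, inv_inv, simple_inv]
  simp [leftMat, Matrix.col_apply, Pi.single_apply, iotaMat_apply, this]

/-- Left and right multiplication commute. -/
theorem leftMat_commute_iotaMat (c : A) (i j : Fin n) :
    leftMat c i * iotaMat (leftMat c j) = iotaMat (leftMat c j) * leftMat c i := by
  apply Matrix.ext_of_mulVec_single
  intro v
  rw [← Matrix.mulVec_mulVec, ← Matrix.mulVec_mulVec, leftMat_mulVec_single,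
    iotaMat_leftMat_mulVec_single, Matrix.mulVec_add, Matrix.mulVec_add, Matrix.mulVec_smul,
    Matrix.mulVec_smul, leftMat_mulVec_single, leftMat_mulVec_single,
    iotaMat_leftMat_mulVec_single, iotaMat_leftMat_mulVec_single, ← mul_assoc]
  -- Left and right multiplication interact only when `s_i v = v s_j`. Otherwise neither factor
  -- changes the descent seen by the other.
  by_cases h : simple i * v = v * simple j
  · have h1 : descCoeff c j v⁻¹ = descCoeff c i v := descCoeff_inv_of_eq c h
    have h2 : descCoeff c j (simple i * v)⁻¹ = c - descCoeff c i v := by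
      rw [h, mul_inv_rev, simple_inv, descCoeff_simple_mul_self, h1]
    have h3 : descCoeff c i (v * simple j) = c - descCoeff c i v := by
      rw [← h, descCoeff_simple_mul_self]
    rw [h1, h2, h3, h]
  · have h' : simple j * v⁻¹ ≠ v⁻¹ * simple i := by
      intro h0
      apply h
      rw [← inv_inj, mul_inv_rev, mul_inv_rev, simple_inv, simple_inv, h0]
    have h2 : descCoeff c j (simple i * v)⁻¹ = descCoeff c j v⁻¹ := by
      rw [mul_inv_rev, simple_inv, descCoeff_mul_simple c h']
    rw [descCoeff_mul_simple c h, h2, smul_add, smul_add, smul_comm]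
    abel

theorem leftMat_map {B : Type*} [CommRing B] (f : A →+* B) (c : A) (i : Fin n) :
    (leftMat c i).map f = leftMat (f c) i := by
  ext1 u v
  simp only [leftMat, Matrix.map_apply, map_add, apply_ite f, map_one, map_zero, descCoeff]

theorem interMat_map {B : Type*} [CommRing B] (f : A →+* B) (c z : A) (i : Fin n) :
    (interMat c z i).map f = interMat (f c) (f z) i := by
  rw [interMat, interMat, ← leftMat_map]
  ext1 u v
  simp [Matrix.one_apply, apply_ite f]

theorem rotMat_map {B : Type*} [CommRing B] (f : A →+* B) (g : Fin (n + 1) → A) :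
    (rotMat g).map f = rotMat (f ∘ g) := by
  ext1 u v
  simp only [rotMat, Matrix.map_apply, apply_ite f, map_zero, Function.comp]

theorem dualRotMat_map {B : Type*} [CommRing B] (f : A →+* B) (g : Fin (n + 1) → A) :
    (dualRotMat g).map f = dualRotMat (f ∘ g) := by
  ext1 u v
  simp only [dualRotMat, Matrix.map_apply, apply_ite f, map_zero, Function.comp]

end Coordinates

end
end BqKZ

namespace BqKZ
noncomputable section

/-! ### The intertwining relation, reduced to generators of `W` -/

section DualRelations

variable {n : ℕ}

/-- The substitution `y ↦ y⁻¹`. -/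
def negHom (A : Type*) [CommRing A] (n : ℕ) :
    AddMonoidAlgebra A (Lattice n) →+* AddMonoidAlgebra A (Lattice n) :=
  AddMonoidAlgebra.mapDomainRingHom A (-AddMonoidHom.id (Lattice n))

@[simp] theorem negHom_single {A : Type*} [CommRing A] (κ : Lattice n) (a : A) :
    negHom A n (AddMonoidAlgebra.single κ a) = AddMonoidAlgebra.single (-κ) a := by
  simp [negHom]

/-- `C_ι C_A(x, t⁻¹) C_ι`. -/
def dualMat (q k : ℂˣ) (A : RatFun n ≃ₐ[ℂ] RatFun n) :
    Matrix (Equiv.Perm (Fin (n + 1))) (Equiv.Perm (Fin (n + 1)))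
      (AddMonoidAlgebra (RatFun n) (Lattice n)) :=
  iotaMat ((cocMat q k A).map (negHom (RatFun n) n))

theorem coefMap_negHom (A : RatFun n ≃ₐ[ℂ] RatFun n)
    (x : AddMonoidAlgebra (RatFun n) (Lattice n)) :
    coefMap A (negHom _ n x) = negHom _ n (coefMap A x) := by
  induction x using AddMonoidAlgebra.induction_linear with
  | zero => simp
  | add f g hf hg => simp [hf, hg]
  | single κ a => simp

theorem dualMat_mul {q : ℂˣ} (hq : ∀ m : ℤ, q ^ m = 1 → m = 0) (k : ℂˣ)
    {A B : RatFun n ≃ₐ[ℂ] RatFun n} (hA : A ∈ weylGroup q) (hB : B ∈ weylGroup q) :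
    dualMat q k (A * B) = dualMat q k A * (dualMat q k B).map (coefMap A) := by
  unfold dualMat
  rw [cocMat_mul hq k hA hB, Matrix.map_mul, iotaMat_mul, ← iotaMat_map, Matrix.map_map,
    Matrix.map_map]
  congr 3
  funext x
  exact (coefMap_negHom A x).symm

theorem dualMat_one {q : ℂˣ} (hq : ∀ m : ℤ, q ^ m = 1 → m = 0) (k : ℂˣ) :
    dualMat q k (1 : RatFun n ≃ₐ[ℂ] RatFun n) = 1 := by
  rw [dualMat, cocMat_one hq, Matrix.map_one _ (map_zero _) (map_one _), iotaMat_one]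

theorem dualMat_simple {q : ℂˣ} (hq : ∀ m : ℤ, q ^ m = 1 → m = 0) (k : ℂˣ) (i : Fin n) :
    dualMat q k (permAlg (simple i)) = (iotaMat (simpleMat k i)).map
      (algebraMap (RatFun n) (AddMonoidAlgebra (RatFun n) (Lattice n))) := by
  rw [dualMat, cocMat_simple hq, Matrix.map_map, iotaMat_map]
  congr 1
  funext a
  simp [AddMonoidAlgebra.coe_algebraMap]

theorem dualMat_pi {q : ℂˣ} (hq : ∀ m : ℤ, q ^ m = 1 → m = 0) (k : ℂˣ) :
    dualMat q k (piAlg q : RatFun n ≃ₐ[ℂ] RatFun n) =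
      dualRotMat fun j => AddMonoidAlgebra.single (-Pi.single j 1) 1 := by
  rw [dualMat, cocMat_pi hq, rotMat_map, iotaMat_rotMat]
  congr 1
  funext j
  simp

/-- Compatibility of `C_A` with a dual intertwiner `M` that acts on `t` through `τ`. -/
def Intertwines (q k : ℂˣ)
    (M : Matrix (Equiv.Perm (Fin (n + 1))) (Equiv.Perm (Fin (n + 1)))
      (AddMonoidAlgebra (RatFun n) (Lattice n)))
    (τ : AddMonoidAlgebra (RatFun n) (Lattice n) →+* AddMonoidAlgebra (RatFun n) (Lattice n))
    (A : RatFun n ≃ₐ[ℂ] RatFun n) : Prop :=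
  M * (dualMat q k A).map τ = dualMat q k A * M.map (coefMap A)

theorem map_coefMap_comm {τ : AddMonoidAlgebra (RatFun n) (Lattice n) →+*
      AddMonoidAlgebra (RatFun n) (Lattice n)} {A : RatFun n ≃ₐ[ℂ] RatFun n}
    (hτ : ∀ x, τ (coefMap A x) = coefMap A (τ x))
    (M : Matrix (Equiv.Perm (Fin (n + 1))) (Equiv.Perm (Fin (n + 1)))
      (AddMonoidAlgebra (RatFun n) (Lattice n))) :
    (M.map (coefMap A)).map τ = (M.map τ).map (coefMap A) := by
  ext1 u v; exact hτ _

/-- The relation says that `M`, composed with `τ`, commutes with the twisted action of `A`. As `τ`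
commutes with the coefficient action, the cocycle relation makes the set of such `A` a subgroup. -/
theorem intertwines_of_generators {q : ℂˣ} (hq : ∀ m : ℤ, q ^ m = 1 → m = 0) (k : ℂˣ)
    {M : Matrix (Equiv.Perm (Fin (n + 1))) (Equiv.Perm (Fin (n + 1)))
      (AddMonoidAlgebra (RatFun n) (Lattice n))}
    {τ : AddMonoidAlgebra (RatFun n) (Lattice n) →+* AddMonoidAlgebra (RatFun n) (Lattice n)}
    (hτ : ∀ (A : RatFun n ≃ₐ[ℂ] RatFun n) x, τ (coefMap A x) = coefMap A (τ x))
    (hs : ∀ i, Intertwines q k M τ (permAlg (simple i))) (hp : Intertwines q k M τ (piAlg q))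
    {A : RatFun n ≃ₐ[ℂ] RatFun n} (hA : A ∈ weylGroup q) : Intertwines q k M τ A := by
  have hcm : ∀ A B : RatFun n ≃ₐ[ℂ] RatFun n, ∀ N : Matrix (Equiv.Perm (Fin (n + 1)))
      (Equiv.Perm (Fin (n + 1))) (AddMonoidAlgebra (RatFun n) (Lattice n)),
      N.map (coefMap (A * B)) = (N.map (coefMap B)).map (coefMap A) := by
    intro A B N; rw [coefMap_mul]; rfl
  have hone : ∀ N : Matrix (Equiv.Perm (Fin (n + 1)))
      (Equiv.Perm (Fin (n + 1))) (AddMonoidAlgebra (RatFun n) (Lattice n)),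
      N.map (coefMap (1 : RatFun n ≃ₐ[ℂ] RatFun n)) = N := by
    intro N; rw [coefMap_one]; rfl
  have hA' := hA
  unfold weylGroup at hA
  induction hA using Subgroup.closure_induction with
  | mem x hx =>
    rcases hx with ⟨i, rfl⟩ | rfl
    · exact hs i
    · exact hp
  | one =>
    unfold Intertwines
    rw [dualMat_one hq, Matrix.map_one _ (map_zero _) (map_one _), mul_one, one_mul, hone]
  | mul A B hA hB ihA ihB =>
    have ihA := ihA hA
    have ihB := ihB hB
    unfold Intertwines at *
    rw [dualMat_mul hq k hA hB, Matrix.map_mul, map_coefMap_comm (hτ A), ← mul_assoc, ihA, mul_assoc,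
      ← Matrix.map_mul, ihB, Matrix.map_mul, ← mul_assoc, hcm]
  | inv A hA ihA =>
    have ihA := ihA hA
    unfold Intertwines at *
    have hAi : A⁻¹ ∈ weylGroup q := inv_mem hA
    -- The matrices of `A` and `A⁻¹` are mutually inverse up to the twist. Applying `A⁻¹` to the
    -- relation for `A` and cancelling gives the relation for `A⁻¹`.
    have h1 : dualMat q k A⁻¹ * (dualMat q k A).map (coefMap A⁻¹) = 1 := by
      rw [← dualMat_mul hq k hAi hA, inv_mul_cancel, dualMat_one hq]
    have h2 := mul_eq_one_comm.1 h1
    have h3 := congrArg (fun N => N.map τ) h2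
    simp only [Matrix.map_mul, Matrix.map_one _ (map_zero _) (map_one _)] at h3
    have h4 := congrArg (fun N => N.map (coefMap A⁻¹)) ihA
    simp only [Matrix.map_mul, ← hcm, inv_mul_cancel, hone] at h4
    rw [← map_coefMap_comm (hτ A⁻¹)] at h4
    calc M * (dualMat q k A⁻¹).map τ
        = dualMat q k A⁻¹ * ((dualMat q k A).map (coefMap A⁻¹) * M) * (dualMat q k A⁻¹).map τ := by
          rw [← mul_assoc (dualMat q k A⁻¹), h1, one_mul]
      _ = dualMat q k A⁻¹ * M.map (coefMap A⁻¹) *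
          (((dualMat q k A).map (coefMap A⁻¹)).map τ * (dualMat q k A⁻¹).map τ) := by
          rw [← h4]; simp only [mul_assoc]
      _ = _ := by rw [h3, mul_one]

/-- `k⁻¹ - k x_i / x_{i+1}`. -/
def interDenom (k : ℂˣ) (i : Fin n) : RatFun n :=
  algebraMap ℂ (RatFun n) (k⁻¹ : ℂˣ).val -
    algebraMap ℂ (RatFun n) k * (xvar i.castSucc / xvar i.succ)

theorem interDenom_ne_zero (k : ℂˣ) (i : Fin n) : interDenom k i ≠ 0 := by
  intro h
  apply cfun_ne_zero k i
  rw [cfun]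
  unfold interDenom at h
  rw [h, zero_div]

/-- Clearing the denominator of the normalised intertwiner leaves a matrix that is linear in the
ratio of coordinates, so the same matrix also makes sense in the variable `t`. -/
theorem interDenom_smul_simpleMat (k : ℂˣ) (i : Fin n) :
    interDenom k i • simpleMat k i =
      interMat (algebraMap ℂ (RatFun n) (qdiff k)) (xvar i.castSucc / xvar i.succ) i := by
  have h := interDenom_ne_zero k i
  have h1 : cInv k i = (1 - xvar i.castSucc / xvar i.succ) / interDenom k i := by
    rw [cInv, cfun, inv_div]; rfl
  rw [simpleMat, interMat, smul_add, smul_smul, smul_smul, h1, mul_div_cancel₀ _ h]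
  congr 2
  rw [mul_sub, ← mul_assoc, mul_div_cancel₀ _ h, qdiff, map_sub]
  unfold interDenom
  ring

/-- The permutation action on exponents. -/
def permHom (A : Type*) [CommRing A] (w : Equiv.Perm (Fin (n + 1))) :
    AddMonoidAlgebra A (Lattice n) →+* AddMonoidAlgebra A (Lattice n) :=
  AddMonoidAlgebra.mapDomainRingHom A
    ({ toFun := fun κ => κ ∘ ⇑w⁻¹, map_zero' := rfl, map_add' := fun _ _ => rfl } :
      Lattice n →+ Lattice n)

@[simp] theorem permHom_single {A : Type*} [CommRing A] (w : Equiv.Perm (Fin (n + 1)))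
    (κ : Lattice n) (a : A) :
    permHom A w (AddMonoidAlgebra.single κ a) = AddMonoidAlgebra.single (κ ∘ ⇑w⁻¹) a := by
  simp [permHom]

theorem single_comp_inv (w : Equiv.Perm (Fin (n + 1))) (j : Fin (n + 1)) (c : ℤ) :
    (Pi.single j c : Lattice n) ∘ ⇑w⁻¹ = Pi.single (w j) c := by
  funext i
  simp only [Function.comp, Pi.single_apply, Equiv.Perm.inv_eq_iff_eq]

/-- `t_i / t_{i+1}`. -/
def ratioMon (A : Type*) [CommRing A] (i : Fin n) : AddMonoidAlgebra A (Lattice n) :=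
  AddMonoidAlgebra.single (Pi.single i.castSucc 1 - Pi.single i.succ 1) 1

/-- Against `s_j` this is the commutation of left and right multiplication in `H_0`, because `C_ι`
turns the left action of `T_j` into a right one. Against `π` it is `interMat_mul_dualRotMat` with
`g_j = t_j⁻¹`. -/
theorem intertwines_interMat {q : ℂˣ} (hq : ∀ m : ℤ, q ^ m = 1 → m = 0) (k : ℂˣ) (i : Fin n)
    {A : RatFun n ≃ₐ[ℂ] RatFun n} (hA : A ∈ weylGroup q) :
    Intertwines q k (interMat (algebraMap (RatFun n) _ (algebraMap ℂ (RatFun n) (qdiff k)))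
      (ratioMon (RatFun n) i) i) (permHom (RatFun n) (simple i)) A := by
  have hM : ∀ A : RatFun n ≃ₐ[ℂ] RatFun n,
      (interMat (algebraMap (RatFun n) _ (algebraMap ℂ (RatFun n) (qdiff k)))
        (ratioMon (RatFun n) i) i).map (coefMap A) =
      interMat (algebraMap (RatFun n) _ (algebraMap ℂ (RatFun n) (qdiff k)))
        (ratioMon (RatFun n) i) i := by
    intro A
    rw [interMat_map]
    congr 1
    · simp [AddMonoidAlgebra.coe_algebraMap]
    · simp [ratioMon]
  refine intertwines_of_generators hq k ?_ ?_ ?_ hA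
  · intro A x
    induction x using AddMonoidAlgebra.induction_linear with
    | zero => simp
    | add f g hf hg => simp [hf, hg]
    | single κ a => simp
  · intro j
    unfold Intertwines
    rw [hM, dualMat_simple hq, Matrix.map_map]
    have e : (permHom (RatFun n) (simple i) : _ → _) ∘
        (algebraMap (RatFun n) (AddMonoidAlgebra (RatFun n) (Lattice n))) =
        algebraMap (RatFun n) (AddMonoidAlgebra (RatFun n) (Lattice n)) := by
      funext a
      simp [AddMonoidAlgebra.coe_algebraMap]
    rw [e]
    have h1 : (iotaMat (simpleMat k j)).map
        (algebraMap (RatFun n) (AddMonoidAlgebra (RatFun n) (Lattice n))) =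
        (algebraMap _ _ (1 - cInv k j * algebraMap ℂ (RatFun n) k) :
          AddMonoidAlgebra (RatFun n) (Lattice n)) • 1 +
        (algebraMap _ _ (cInv k j) : AddMonoidAlgebra (RatFun n) (Lattice n)) •
          iotaMat (leftMat (algebraMap (RatFun n) _ (algebraMap ℂ (RatFun n) (qdiff k))) j) := by
      rw [← leftMat_map]
      ext1 u v
      simp only [iotaMat_apply, Matrix.map_apply, simpleMat, Matrix.add_apply, Matrix.smul_apply,
        Matrix.one_apply, inv_inj, smul_eq_mul, map_add, map_mul, apply_ite (algebraMap (RatFun n)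
          (AddMonoidAlgebra (RatFun n) (Lattice n))), map_one, map_zero]
    rw [h1, interMat]
    simp only [mul_add, add_mul, smul_mul_assoc, mul_smul_comm, one_mul, mul_one,
      leftMat_commute_iotaMat]
    simp only [smul_comm (1 - ratioMon (RatFun n) i), smul_comm (-algebraMap (RatFun n)
      (AddMonoidAlgebra (RatFun n) (Lattice n)) _), smul_add]
    abel
  · unfold Intertwines
    rw [hM, dualMat_pi hq, dualRotMat_map]
    rw [← interMat_mul_dualRotMat]
    · congr 2
      funext j
      simp only [Function.comp, permHom_single]
      rw [Pi.neg_comp, single_comp_inv]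
    · simp only [ratioMon, AddMonoidAlgebra.single_mul_single, mul_one]
      congr 1
      abel

/-- The action `t_i ↦ q^{-[i = N]} t_{σ i}`. -/
def rotHom {A : Type*} [CommRing A] [Algebra ℂ A] (q : ℂˣ) :
    AddMonoidAlgebra A (Lattice n) →+* AddMonoidAlgebra A (Lattice n) :=
  (AddMonoidAlgebra.lift A (AddMonoidAlgebra A (Lattice n)) (Lattice n)
    { toFun := fun κ => AddMonoidAlgebra.single (κ.toAdd ∘ ⇑(finRotate (n + 1))⁻¹)
        (algebraMap ℂ A (q ^ (-κ.toAdd (Fin.last n)) : ℂˣ))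
      map_one' := by simp [AddMonoidAlgebra.one_def, ← Pi.zero_def, Function.comp_def]
      map_mul' := fun κ μ => by
        rw [AddMonoidAlgebra.single_mul_single, ← map_mul, ← Units.val_mul, ← zpow_add, toAdd_mul,
          Pi.add_apply, neg_add]
        rfl } : _ →ₐ[A] _).toRingHom

@[simp] theorem rotHom_single {A : Type*} [CommRing A] [Algebra ℂ A] (q : ℂˣ) (κ : Lattice n)
    (a : A) :
    rotHom q (AddMonoidAlgebra.single κ a) = AddMonoidAlgebra.single (κ ∘ ⇑(finRotate (n + 1))⁻¹)
      (a * algebraMap ℂ A (q ^ (-κ (Fin.last n)) : ℂˣ)) := by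
  simp [rotHom, AddMonoidAlgebra.lift_single]

theorem piAlg_xvar (q : ℂˣ) (j : Fin (n + 1)) : piAlg q (xvar j) =
    (algebraMap ℂ (RatFun n) (q ^ (-(Pi.single (Fin.last n) 1 : Lattice n) j) : ℂˣ) *
      xvar (finRotate (n + 1) j) : RatFun n) := by
  rw [piAlg, AlgEquiv.mul_apply, shiftAlg_xvar, map_mul, AlgEquiv.commutes, permAlg_xvar]

/-- The previous result with the two variables exchanged. Against `s_i` it is the `C_ι`-conjugate of
`interMat_mul_dualRotMat` with `g_j = x_j⁻¹`. Against `π` it reduces to a comparison of monomials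
and powers of `q`. -/
theorem intertwines_rotMat {q : ℂˣ} (hq : ∀ m : ℤ, q ^ m = 1 → m = 0) (k : ℂˣ)
    {A : RatFun n ≃ₐ[ℂ] RatFun n} (hA : A ∈ weylGroup q) :
    Intertwines q k (rotMat fun j => algebraMap (RatFun n) _ (xvar j)⁻¹) (rotHom q) A := by
  refine intertwines_of_generators hq k ?_ ?_ ?_ hA
  · intro A x
    induction x using AddMonoidAlgebra.induction_linear with
    | zero => simp
    | add f g hf hg => simp [hf, hg]
    | single κ a => simp
  · intro i
    unfold Intertwines
    have e : (rotHom q : _ → _) ∘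
        (algebraMap (RatFun n) (AddMonoidAlgebra (RatFun n) (Lattice n))) =
        algebraMap (RatFun n) (AddMonoidAlgebra (RatFun n) (Lattice n)) := by
      funext a
      simp [AddMonoidAlgebra.coe_algebraMap]
    have h1 : simpleMat k i * dualRotMat ((fun j => (xvar j)⁻¹) ∘ simple i) =
        dualRotMat (fun j => (xvar j)⁻¹) * simpleMat k i := by
      have h := interMat_mul_dualRotMat (algebraMap ℂ (RatFun n) (qdiff k))
        (xvar i.castSucc / xvar i.succ) i (fun j => (xvar j)⁻¹) (by
          have := xvar_ne_zero (n := n) i.castSucc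
          field_simp)
      rw [← interDenom_smul_simpleMat, smul_mul_assoc, mul_smul_comm] at h
      exact smul_right_injective _ (interDenom_ne_zero k i) h
    have h2 := congrArg iotaMat h1
    rw [iotaMat_mul, iotaMat_mul, iotaMat_dualRotMat, iotaMat_dualRotMat] at h2
    rw [dualMat_simple hq, Matrix.map_map, e, rotMat_map]
    have h3 := congrArg (fun N => N.map
      (algebraMap (RatFun n) (AddMonoidAlgebra (RatFun n) (Lattice n)))) h2
    simp only [Matrix.map_mul, rotMat_map] at h3
    refine h3.symm.trans ?_
    congr 2
    funext j
    simp [AddMonoidAlgebra.coe_algebraMap]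
  · unfold Intertwines
    rw [dualMat_pi hq, dualRotMat_map, rotMat_map]
    apply rotMat_mul_dualRotMat
    intro v
    simp only [Function.comp, rotHom_single, AddMonoidAlgebra.coe_algebraMap, coefMap_single,
      Algebra.algebraMap_self, RingHom.id_apply, AddMonoidAlgebra.single_mul_single, map_inv₀,
      piAlg_xvar, Pi.neg_comp, single_comp_inv, add_zero, zero_add, one_mul, mul_one, Pi.neg_apply,
      neg_neg, mul_inv]
    -- On either side a factor `q` appears exactly when `v` fixes the last index.
    have hv : (Pi.single (v (Fin.last n)) 1 : Lattice n) (Fin.last n) =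
        (Pi.single (Fin.last n) 1 : Lattice n) (v⁻¹ (Fin.last n)) := by
      simp only [Pi.single_apply, Equiv.Perm.inv_eq_iff_eq]
    rw [hv, zpow_neg, ← map_inv₀, ← Units.val_inv_eq_inv_val, inv_inv]

end DualRelations
end
end BqKZ

namespace BqKZ
noncomputable section

/-! ### Regularity and evaluation -/

section Regularity

variable {n : ℕ} {t t' t'' : Torus n}

theorem hasValueAt_algebraMap (t : Torus n) (p : MvPolynomial (Fin (n + 1)) ℂ) :
    HasValueAt t (algebraMap _ (RatFun n) p) (MvPolynomial.eval (fun i => (t i : ℂ)) p) :=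
  ⟨p, 1, by simp, by simp, by simp⟩

theorem HasValueAt.add {f g : RatFun n} {y z : ℂ} (hf : HasValueAt t f y)
    (hg : HasValueAt t g z) : HasValueAt t (f + g) (y + z) := by
  obtain ⟨p, r, hr, h, rfl⟩ := hf
  obtain ⟨p', r', hr', h', rfl⟩ := hg
  refine ⟨p * r' + p' * r, r * r', by simp [hr, hr'], ?_, ?_⟩
  · simp only [map_mul, map_add, ← h, ← h']; ring
  · simp only [map_mul, map_add]; field_simp

theorem HasValueAt.mul {f g : RatFun n} {y z : ℂ} (hf : HasValueAt t f y)
    (hg : HasValueAt t g z) : HasValueAt t (f * g) (y * z) := by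
  obtain ⟨p, r, hr, h, rfl⟩ := hf
  obtain ⟨p', r', hr', h', rfl⟩ := hg
  refine ⟨p * p', r * r', by simp [hr, hr'], ?_, ?_⟩
  · simp only [map_mul, ← h, ← h']; ring
  · simp only [map_mul]; field_simp

theorem HasValueAt.inv {f : RatFun n} {z : ℂ} (hf : HasValueAt t f z) (hz : z ≠ 0) :
    HasValueAt t f⁻¹ z⁻¹ := by
  obtain ⟨p, r, hr, h, rfl⟩ := hf
  have hp : MvPolynomial.eval (fun i => (t i : ℂ)) p ≠ 0 := fun h0 => hz (by simp [h0])
  have hf0 : f ≠ 0 := by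
    rintro rfl
    rw [zero_mul, eq_comm, FaithfulSMul.algebraMap_eq_zero_iff] at h
    exact hp (by simp [h])
  refine ⟨r, p, hp, ?_, by rw [inv_div]⟩
  rw [← h, inv_mul_cancel_left₀ hf0]

theorem hasValueAt_const (t : Torus n) (a : ℂ) : HasValueAt t (algebraMap ℂ (RatFun n) a) a := by
  simpa [IsScalarTower.algebraMap_apply ℂ (MvPolynomial (Fin (n + 1)) ℂ) (RatFun n)]
    using hasValueAt_algebraMap t (MvPolynomial.C a)

theorem hasValueAt_xvar (t : Torus n) (i : Fin (n + 1)) : HasValueAt t (xvar i) (t i) := by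
  have h := hasValueAt_algebraMap t (MvPolynomial.X i)
  rw [MvPolynomial.eval_X] at h
  exact h

theorem HasValueAt.neg {f : RatFun n} {z : ℂ} (hf : HasValueAt t f z) : HasValueAt t (-f) (-z) := by
  simpa using (hasValueAt_const t (-1)).mul hf

theorem HasValueAt.sub {f g : RatFun n} {y z : ℂ} (hf : HasValueAt t f y)
    (hg : HasValueAt t g z) : HasValueAt t (f - g) (y - z) := by
  rw [sub_eq_add_neg, sub_eq_add_neg]; exact hf.add hg.neg

theorem HasValueAt.ratEval_eq {f : RatFun n} {z : ℂ} (h : HasValueAt t f z) : ratEval t f = z :=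
  (Classical.epsilon_spec (p := HasValueAt t f) ⟨z, h⟩).unique h

/-- The ring of rational functions that are regular at `t`. -/
def regRing (t : Torus n) : Subring (RatFun n) where
  carrier := {f | RegularAt t f}
  mul_mem' := fun ⟨_, h⟩ ⟨_, h'⟩ => ⟨_, h.mul h'⟩
  one_mem' := ⟨1, by simpa using hasValueAt_const t 1⟩
  add_mem' := fun ⟨_, h⟩ ⟨_, h'⟩ => ⟨_, h.add h'⟩
  zero_mem' := ⟨0, by simpa using hasValueAt_const t 0⟩
  neg_mem' := fun ⟨_, h⟩ => ⟨_, h.neg⟩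

theorem HasValueAt.mem_regRing {f : RatFun n} {z : ℂ} (h : HasValueAt t f z) : f ∈ regRing t :=
  ⟨z, h⟩

theorem hasValueAt_ratEval {f : RatFun n} (h : f ∈ regRing t) : HasValueAt t f (ratEval t f) := by
  obtain ⟨z, hz⟩ := h
  rwa [hz.ratEval_eq]

/-- Evaluation of regular functions. -/
def evalReg (t : Torus n) : regRing t →+* ℂ where
  toFun f := ratEval t f
  map_one' := HasValueAt.ratEval_eq (by simpa using hasValueAt_const t 1)
  map_mul' f g := ((hasValueAt_ratEval f.2).mul (hasValueAt_ratEval g.2)).ratEval_eq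
  map_zero' := HasValueAt.ratEval_eq (by simpa using hasValueAt_const t 0)
  map_add' f g := ((hasValueAt_ratEval f.2).add (hasValueAt_ratEval g.2)).ratEval_eq

/-- The elements of `ℂ(T)[y^{±1}]` with coefficients regular at `t`. -/
def regPoly (t : Torus n) : Subring (AddMonoidAlgebra (RatFun n) (Lattice n)) :=
  (AddMonoidAlgebra.mapRingHom (Lattice n) (regRing t).subtype).range

theorem mem_regPoly {x : AddMonoidAlgebra (RatFun n) (Lattice n)} :
    x ∈ regPoly t ↔ ∀ κ, x.coeff κ ∈ regRing t := by
  constructor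
  · rintro ⟨F, rfl⟩ κ
    simp
  · intro h
    rw [← AddMonoidAlgebra.sum_coeff_single x]
    refine sum_mem fun κ _ => ⟨AddMonoidAlgebra.single κ ⟨_, h κ⟩, ?_⟩
    simp

theorem single_mem_regPoly {κ : Lattice n} {a : RatFun n} (h : a ∈ regRing t) :
    AddMonoidAlgebra.single κ a ∈ regPoly t :=
  ⟨AddMonoidAlgebra.single κ ⟨a, h⟩, by simp⟩

/-- `(A f)(t) = f(t')`. -/
def Moves (A : RatFun n ≃ₐ[ℂ] RatFun n) (t t' : Torus n) : Prop :=
  ∀ f z, HasValueAt t' f z → HasValueAt t (A f) z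

theorem Moves.mul {A B : RatFun n ≃ₐ[ℂ] RatFun n} (h : Moves A t t') (h' : Moves B t' t'') :
    Moves (A * B) t t'' := fun f z hf => h _ z (h' f z hf)

theorem moves_permAlg (w : Equiv.Perm (Fin (n + 1))) (t : Torus n) :
    Moves (permAlg w) t (t ∘ w) := by
  rintro f z ⟨p, r, hr, h, rfl⟩
  have e : ∀ p, permAlg w (algebraMap (MvPolynomial (Fin (n + 1)) ℂ) (RatFun n) p) =
      algebraMap _ _ (MvPolynomial.rename w p) := by
    intro p; simp [permAlg]
  refine ⟨MvPolynomial.rename w p, MvPolynomial.rename w r, ?_, ?_, ?_⟩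
  · rw [MvPolynomial.eval_rename]; exact hr
  · rw [← e, ← e, ← map_mul, h]
  · rw [MvPolynomial.eval_rename, MvPolynomial.eval_rename]; rfl

theorem eval_scaleEquiv (a t : Torus n) (p : MvPolynomial (Fin (n + 1)) ℂ) :
    MvPolynomial.eval (fun i => (t i : ℂ)) (scaleEquiv a p) =
      MvPolynomial.eval (fun i => ((a * t) i : ℂˣ).val) p := by
  induction p using MvPolynomial.induction_on with
  | C c =>
    have : scaleEquiv a (MvPolynomial.C c) = MvPolynomial.C c := (scaleEquiv a).commutes c
    rw [this]; simp
  | add p p' h h' => simp [h, h']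
  | mul_X p i h =>
    have : scaleEquiv a (MvPolynomial.X i) = MvPolynomial.C (a i : ℂ) * MvPolynomial.X i :=
      MvPolynomial.aeval_X _ _
    rw [map_mul, map_mul, h, this]; simp

theorem moves_shiftAlg (q : ℂˣ) (ν : Lattice n) (t : Torus n) :
    Moves (shiftAlg q ν) t (tpow q (-ν) * t) := by
  rintro f z ⟨p, r, hr, h, rfl⟩
  have e : ∀ p, shiftAlg q ν (algebraMap (MvPolynomial (Fin (n + 1)) ℂ) (RatFun n) p) =
      algebraMap _ _ (scaleEquiv (tpow q (-ν)) p) := by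
    intro p; simp [shiftAlg]
  refine ⟨scaleEquiv (tpow q (-ν)) p, scaleEquiv (tpow q (-ν)) r, ?_, ?_, ?_⟩
  · rw [eval_scaleEquiv]; exact hr
  · rw [← e, ← e, ← map_mul, h]
  · rw [eval_scaleEquiv, eval_scaleEquiv]

theorem Moves.coefMap_mem {A : RatFun n ≃ₐ[ℂ] RatFun n} (h : Moves A t t')
    {x : AddMonoidAlgebra (RatFun n) (Lattice n)} (hx : x ∈ regPoly t') :
    coefMap A x ∈ regPoly t := by
  rw [mem_regPoly] at *
  intro κ
  obtain ⟨z, hz⟩ := hx κ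
  exact ⟨z, h _ _ hz⟩

/-- `A` moves `t` to `t'`, and its matrix is regular and invertible there. -/
structure GoodAt (q k : ℂˣ) (A : RatFun n ≃ₐ[ℂ] RatFun n) (t t' : Torus n) : Prop where
  mem : A ∈ weylGroup q
  moves : Moves A t t'
  moves_inv : Moves A⁻¹ t' t
  regular : ∀ u v, cocMat q k A u v ∈ regPoly t
  regular_inv : ∀ u v, cocMat q k A⁻¹ u v ∈ regPoly t'

variable {q k : ℂˣ}

theorem GoodAt.symm {A : RatFun n ≃ₐ[ℂ] RatFun n} (h : GoodAt q k A t t') :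
    GoodAt q k A⁻¹ t' t :=
  ⟨inv_mem h.mem, h.moves_inv, by rw [inv_inv]; exact h.moves, h.regular_inv,
    by rw [inv_inv]; exact h.regular⟩

theorem cocMat_mul_mem (hq : ∀ m : ℤ, q ^ m = 1 → m = 0) {A B : RatFun n ≃ₐ[ℂ] RatFun n}
    (hA : A ∈ weylGroup q) (hB : B ∈ weylGroup q) (hm : Moves A t t')
    (h : ∀ u v, cocMat q k A u v ∈ regPoly t) (h' : ∀ u v, cocMat q k B u v ∈ regPoly t')
    (u v : Equiv.Perm (Fin (n + 1))) : cocMat q k (A * B) u v ∈ regPoly t := by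
  rw [cocMat_mul hq k hA hB, Matrix.mul_apply]
  exact sum_mem fun w _ => mul_mem (h _ _) (hm.coefMap_mem (h' _ _))

theorem GoodAt.mul (hq : ∀ m : ℤ, q ^ m = 1 → m = 0) {A B : RatFun n ≃ₐ[ℂ] RatFun n}
    (h : GoodAt q k A t t') (h' : GoodAt q k B t' t'') : GoodAt q k (A * B) t t'' where
  mem := mul_mem h.mem h'.mem
  moves := h.moves.mul h'.moves
  moves_inv := by rw [mul_inv_rev]; exact h'.moves_inv.mul h.moves_inv
  regular := cocMat_mul_mem hq h.mem h'.mem h.moves h.regular h'.regular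
  regular_inv := by
    rw [mul_inv_rev]
    exact cocMat_mul_mem hq (inv_mem h'.mem) (inv_mem h.mem) h'.moves_inv h'.regular_inv
      h.regular_inv

theorem GoodAt.one (hq : ∀ m : ℤ, q ^ m = 1 → m = 0) (t : Torus n) : GoodAt q k 1 t t := by
  have h : ∀ u v, cocMat q k (1 : RatFun n ≃ₐ[ℂ] RatFun n) u v ∈ regPoly t := by
    intro u v
    rw [cocMat_one hq, Matrix.one_apply]
    split_ifs
    · exact one_mem _
    · exact zero_mem _
  exact ⟨one_mem _, fun _ _ h => h, by rw [inv_one]; exact fun _ _ h => h, h,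
    by rw [inv_one]; exact h⟩

/-- After clearing `x_{i+1}` the function is `(x_{i+1} - x_i) / (k⁻¹ x_{i+1} - k x_i)`. This
hyperplane is the only source of poles in the cocycle. -/
theorem hasValueAt_cInv {i : Fin n} (h : t i.succ ≠ k ^ 2 * t i.castSucc) :
    HasValueAt t (cInv k i) (((t i.succ : ℂ) - t i.castSucc) *
      ((k⁻¹ : ℂˣ) * t i.succ - (k : ℂ) * t i.castSucc)⁻¹) := by
  rw [cInv, cfun_eq k (xvar_ne_zero _), inv_div, div_eq_mul_inv]
  refine ((hasValueAt_xvar t _).sub (hasValueAt_xvar t _)).mul (HasValueAt.inv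
    (((hasValueAt_const t _).mul (hasValueAt_xvar t _)).sub
      ((hasValueAt_const t _).mul (hasValueAt_xvar t _))) ?_)
  intro h0
  apply h
  have h1 : k⁻¹ * t i.succ = k * t i.castSucc := Units.ext (by simpa using sub_eq_zero.1 h0)
  rw [inv_mul_eq_iff_eq_mul] at h1
  rw [h1, sq, mul_assoc]

theorem simpleMat_mem {i : Fin n} (h : t i.succ ≠ k ^ 2 * t i.castSucc)
    (u v : Equiv.Perm (Fin (n + 1))) : simpleMat k i u v ∈ regRing t := by
  have h1 := (hasValueAt_cInv h).mem_regRing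
  have hc : ∀ a : ℂ, algebraMap ℂ (RatFun n) a ∈ regRing t :=
    fun a => (hasValueAt_const t a).mem_regRing
  have hi : ∀ {p : Prop} [Decidable p] {a b : RatFun n}, a ∈ regRing t → b ∈ regRing t →
      (if p then a else b) ∈ regRing t := by
    intro p _ a b ha hb; split_ifs <;> assumption
  simp only [simpleMat, Matrix.add_apply, Matrix.smul_apply, Matrix.one_apply, leftMat, descCoeff,
    smul_eq_mul]
  exact add_mem (mul_mem (sub_mem (one_mem _) (mul_mem h1 (hc _))) (hi (one_mem _) (zero_mem _)))
    (mul_mem h1 (add_mem (hi (one_mem _) (zero_mem _))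
      (hi (hi (hc _) (zero_mem _)) (zero_mem _))))

theorem goodAt_simple (hq : ∀ m : ℤ, q ^ m = 1 → m = 0) {i : Fin n}
    (h : t i.succ ≠ k ^ 2 * t i.castSucc) (h' : t i.castSucc ≠ k ^ 2 * t i.succ) :
    GoodAt q k (permAlg (simple i)) t (t ∘ simple i) := by
  have e : (permAlg (simple i) : RatFun n ≃ₐ[ℂ] RatFun n)⁻¹ = permAlg (simple i) := by
    rw [← permAlg_inv, simple_inv]
  have hm := moves_permAlg (simple i) (t ∘ simple i)
  have ht : (t ∘ simple i) ∘ simple i = t := by funext j; simp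
  rw [ht] at hm
  have hr : ∀ t : Torus n, t i.succ ≠ k ^ 2 * t i.castSucc → ∀ u v,
      cocMat q k (permAlg (simple i)) u v ∈ regPoly t := by
    intro t ht u v
    rw [cocMat_simple hq]
    exact single_mem_regPoly (simpleMat_mem ht u v)
  exact ⟨permAlg_mem_weylGroup q _, moves_permAlg _ t, by rwa [e], hr t h,
    by rw [e]; exact hr _ (by simpa using h')⟩

theorem goodAt_pi (hq : ∀ m : ℤ, q ^ m = 1 → m = 0) (t : Torus n) :
    GoodAt q k (piAlg q) t
      (tpow q (-Pi.single (Fin.last n) 1) * (t ∘ finRotate (n + 1))) where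
  mem := piAlg_mem_weylGroup q
  moves := (moves_permAlg _ t).mul (moves_shiftAlg q _ _)
  moves_inv := by
    rw [piAlg, mul_inv_rev, ← shiftAlg_neg, ← permAlg_inv]
    refine Moves.mul (t' := t ∘ finRotate (n + 1)) ?_ ?_
    · convert moves_shiftAlg q _ _ using 1
      funext i
      simp [tpow_apply, ← mul_assoc]
    · convert moves_permAlg _ _ using 1
      funext i
      simp
  regular u v := by
    rw [cocMat_pi hq, rotMat]
    split_ifs
    · exact single_mem_regPoly (one_mem _)
    · exact zero_mem _
  regular_inv u v := by
    rw [cocMat_pi_inv hq, rotInvMat]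
    split_ifs
    · exact single_mem_regPoly (one_mem _)
    · exact zero_mem _

/-- Each letter of a reduced word exchanges one pair of coordinates of `t`. The pairs that occur are
the inversions of `w⁻¹`, so conditions are needed for these alone. -/
theorem goodAt_perm (hq : ∀ m : ℤ, q ^ m = 1 → m = 0) (w : Equiv.Perm (Fin (n + 1)))
    (h : ∀ a b, a < b → w⁻¹ b < w⁻¹ a → t b ≠ k ^ 2 * t a ∧ t a ≠ k ^ 2 * t b) :
    GoodAt q k (permAlg w) t (t ∘ w) := by
  induction w using perm_induction_right with
  | one => rw [permAlg_one]; exact GoodAt.one hq t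
  | step w i hw ih =>
    have e : (w * simple i)⁻¹ = simple i * w⁻¹ := by simp
    rw [permAlg_mul]
    refine (ih fun a b hab hba => h a b hab ?_).mul hq (goodAt_simple hq ?_ ?_)
    · rw [e]
      refine simple_lt_simple hba ?_
      rintro ⟨h1, h2⟩
      rw [Equiv.Perm.inv_eq_iff_eq] at h1 h2
      rw [h1, h2] at hab
      exact hab.asymm hw
    · exact (h _ _ hw (by rw [e]; simp)).1
    · exact (h _ _ hw (by rw [e]; simp)).2

/-- In the factorisation `shiftAlg_single_eq`, the first permutation moves `j` to the front and
exchanges it with each `a < j` while the point is still `t`. The last one returns it past each `b >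
j` after the shift, when the point is `t'`. The factor `π` has no poles. -/
theorem goodAt_shift_single (hq : ∀ m : ℤ, q ^ m = 1 → m = 0) (j : Fin (n + 1))
    (h1 : ∀ a, a < j → t j ≠ k ^ 2 * t a ∧ t a ≠ k ^ 2 * t j)
    (ht' : t' = tpow q (-Pi.single j 1) * t)
    (h2 : ∀ b, j < b → t' b ≠ k ^ 2 * t' j ∧ t' j ≠ k ^ 2 * t' b) :
    GoodAt q k (shiftAlg q (Pi.single j 1)) t t' := by
  rw [shiftAlg_single_eq]
  refine ((goodAt_perm hq (bringFront j) ?_).mul hq (goodAt_pi hq _)).mul hq (t' := _) ?_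
  · intro a b hab hba
    obtain ⟨a, rfl⟩ := (bringFront j).surjective a
    obtain ⟨b, rfl⟩ := (bringFront j).surjective b
    have e : ∀ x, (bringFront j)⁻¹ (bringFront j x) = x := fun x => by simp
    rw [e, e] at hba
    rcases Fin.eq_zero_or_eq_succ b with rfl | ⟨b, rfl⟩
    · rw [bringFront_zero] at *
      exact h1 _ hab
    · obtain ⟨a, rfl⟩ := Fin.exists_succ_eq.2 ((Fin.zero_le _).trans_lt hba).ne'
      rw [bringFront_succ, bringFront_succ] at hab
      exact absurd (Fin.succAbove_lt_succAbove_iff.1 hab) (Fin.succ_lt_succ_iff.1 hba).asymm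
  · have h3 : GoodAt q k (permAlg (bringFront j * finRotate (n + 1))) t'
        (t' ∘ ⇑(bringFront j * finRotate (n + 1))) := by
      apply goodAt_perm hq
      intro a b hab hba
      obtain ⟨a, rfl⟩ := (bringFront j * finRotate (n + 1)).surjective a
      obtain ⟨b, rfl⟩ := (bringFront j * finRotate (n + 1)).surjective b
      have e : ∀ x, (bringFront j * finRotate (n + 1))⁻¹ ((bringFront j * finRotate (n + 1)) x) =
          x := Equiv.symm_apply_apply _
      rw [e, e] at hba
      have hl : (bringFront j * finRotate (n + 1)) (Fin.last n) = j := by simp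
      have hc : ∀ i : Fin n, (bringFront j * finRotate (n + 1)) i.castSucc = j.succAbove i := by
        intro i; simp
      rcases eq_or_ne a (Fin.last n) with rfl | ha
      · rw [hl] at *
        exact h2 _ hab
      · obtain ⟨a, rfl⟩ := Fin.exists_castSucc_eq.2 ha
        obtain ⟨b, rfl⟩ := Fin.exists_castSucc_eq.2 (hba.trans (Fin.castSucc_lt_last a)).ne
        rw [hc, hc] at hab
        exact absurd (Fin.succAbove_lt_succAbove_iff.1 hab)
          (Fin.castSucc_lt_castSucc_iff.1 hba).asymm
    convert h3.symm using 1
    rw [ht']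
    funext i
    have : (bringFront j * finRotate (n + 1)) i = j ↔ i = Fin.last n := by
      rw [← Equiv.Perm.eq_inv_iff_eq]
      have : (bringFront j * finRotate (n + 1))⁻¹ j = Fin.last n := by
        rw [Equiv.Perm.inv_eq_iff_eq]; simp
      rw [this]
    simp only [Pi.mul_apply, Function.comp_apply, tpow_apply, Pi.neg_apply, Pi.single_apply, this]
    rfl

end Regularity

/-! ### Dominant weights and the genericity of `k` -/

section Dominant

variable {n : ℕ} {q k : ℂˣ}

theorem dominant_iff {ν : Lattice n} : Dominant ν ↔ ∀ i : Fin n, ν i.succ ≤ ν i.castSucc :=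
  Fin.antitone_iff_succ_le

/-- Every dominant weight is joined to `0` by a path of dominant weights that adds or removes one
unit vector at a time. The step is an equivalence because negative entries require walking it
backwards. -/
theorem dominant_induction {P : Lattice n → Prop} (zero : P 0)
    (step : ∀ ν j, Dominant ν → Dominant (ν + Pi.single j 1) → (P ν ↔ P (ν + Pi.single j 1)))
    (ν : Lattice n) (hν : Dominant ν) : P ν := by
  -- Raising the entries of a constant vector from the left, one at a time, keeps it dominant and
  -- ends at the next constant vector.
  have hpart : ∀ (c : ℤ) (m : ℕ), m ≤ n + 1 →
      (P (fun _ => c) ↔ P fun i => c + if (i : ℕ) < m then 1 else 0) := by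
    intro c m
    induction m with
    | zero => simp
    | succ m ih =>
      intro hm
      rw [ih (by omega)]
      have hd : ∀ m, Dominant (n := n) fun i => c + if (i : ℕ) < m then 1 else 0 := by
        intro m
        rw [dominant_iff]
        intro i
        simp only [Fin.val_succ, Fin.val_castSucc]
        split_ifs <;> omega
      have e : (fun i : Fin (n + 1) => c + if (i : ℕ) < m + 1 then (1 : ℤ) else 0) =
          (fun i : Fin (n + 1) => c + if (i : ℕ) < m then (1 : ℤ) else 0) +
            Pi.single (⟨m, by omega⟩ : Fin (n + 1)) 1 := by
        funext i
        simp only [Pi.add_apply, Pi.single_apply, Fin.ext_iff]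
        split_ifs <;> omega
      rw [e]
      exact step _ _ (hd m) (e ▸ hd (m + 1))
  have hsucc : ∀ c : ℤ, P (fun _ => c) ↔ P fun _ => c + 1 := by
    intro c
    rw [hpart c (n + 1) le_rfl]
    simp only [Fin.is_lt, if_true]
  have hconst : ∀ c : ℤ, P fun _ => c := by
    intro c
    induction c using Int.induction_on with
    | zero => exact zero
    | succ c ih => exact (hsucc _).1 ih
    | pred c ih => exact (hsucc _).2 (by simpa using ih)
  -- Removing a unit at a strict descent preserves dominance and the last entry, so the excess over
  -- the last entry decreases until the weight is constant.
  induction hm : (∑ i, (ν i - ν (Fin.last n))).toNat using Nat.strong_induction_on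
    generalizing ν with
  | _ m ih =>
  by_cases hdesc : ∃ i : Fin n, ν i.succ < ν i.castSucc
  · obtain ⟨i, hi⟩ := hdesc
    have hν' : Dominant (ν - Pi.single i.castSucc 1) := by
      rw [dominant_iff] at *
      intro j
      have h1 := hν j
      simp only [Pi.sub_apply, Pi.single_apply]
      have : j.succ = i.castSucc → j ≠ i := by rintro h rfl; simp [Fin.ext_iff] at h
      by_cases hj : j = i
      · subst hj
        have : j.succ ≠ j.castSucc := Fin.castSucc_lt_succ.ne'
        simp [this]; omega
      · have : j.castSucc ≠ i.castSucc := by simpa using hj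
        simp only [this, if_false]
        split_ifs <;> omega
    have e : ν - Pi.single i.castSucc 1 + Pi.single i.castSucc 1 = ν := sub_add_cancel _ _
    have hs := step (ν - Pi.single i.castSucc 1) i.castSucc hν' (by rwa [e])
    rw [e] at hs
    rw [← hs]
    refine ih _ ?_ _ hν' rfl
    have h1 : ∑ j, ((ν - Pi.single i.castSucc 1 : Lattice n) j -
        (ν - Pi.single i.castSucc 1 : Lattice n) (Fin.last n)) =
        ∑ j, (ν j - ν (Fin.last n)) - 1 := by
      have h2 : (ν - Pi.single i.castSucc 1 : Lattice n) (Fin.last n) = ν (Fin.last n) := by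
        simp [(Fin.castSucc_ne_last i).symm]
      rw [h2]
      simp only [Pi.sub_apply, sub_right_comm, Finset.sum_sub_distrib, Finset.sum_pi_single',
        Finset.mem_univ, if_true]
    have h2 : 0 < ∑ j, (ν j - ν (Fin.last n)) := by
      apply Finset.sum_pos'
      · intro j _
        exact sub_nonneg.2 (hν (Fin.le_last j))
      · refine ⟨i.castSucc, Finset.mem_univ _, ?_⟩
        have := hν (Fin.le_last i.succ)
        omega
    omega
  · push Not at hdesc
    have hmono : Monotone ν := Fin.monotone_iff_le_succ.2 hdesc
    have : ν = fun _ => ν 0 := by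
      funext i
      exact le_antisymm (hν (Fin.zero_le i)) (hmono (Fin.zero_le i))
    rw [this]
    exact hconst _

/-- An equality would force `k^{2(b-a+1)}` or `k^{2(b-a-1)}` to equal `q^{κ_a - κ_b}`. Both
exponents are in the range excluded by genericity, except the second when `b = a + 1`; then `q^{κ_a
- κ_b} = 1` contradicts `κ_b < κ_a`. -/
theorem torus_separated (hq : ∀ m : ℤ, q ^ m = 1 → m = 0)
    (hk : ∀ j : ℕ, 1 ≤ j → j ≤ n + 1 → ∀ m : ℤ, k ^ (2 * j) ≠ q ^ m) {κ : Lattice n}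
    {a b : Fin (n + 1)} (hab : a < b) (hκ : κ b < κ a) :
    (tpow q (-κ) * tpow k (delta n)) b ≠ k ^ 2 * (tpow q (-κ) * tpow k (delta n)) a ∧
    (tpow q (-κ) * tpow k (delta n)) a ≠ k ^ 2 * (tpow q (-κ) * tpow k (delta n)) b := by
  have hab' := Fin.lt_def.1 hab
  have hb := b.isLt
  simp only [Pi.mul_apply, tpow_apply, Pi.neg_apply, delta]
  constructor
  · intro h
    apply hk (b - a + 1) (by omega) (by omega) (κ a - κ b)
    have e : (k : ℂˣ) ^ (2 * ((b : ℕ) - a + 1)) =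
        k ^ 2 * k ^ ((n : ℤ) - 2 * (a : ℕ)) * (k ^ ((n : ℤ) - 2 * (b : ℕ)))⁻¹ := by
      rw [← zpow_natCast, ← zpow_natCast, ← zpow_neg, ← zpow_add, ← zpow_add]
      congr 1
      push_cast [hab'.le]
      ring
    rw [e, sub_eq_add_neg (κ a), zpow_add q, mul_inv_eq_iff_eq_mul, mul_assoc (q ^ κ a), h,
      mul_left_comm (k ^ 2) (q ^ (-κ a)), zpow_neg q, mul_inv_cancel_left]
  · intro h
    have e : (k : ℂˣ) ^ (2 * ((b : ℕ) - a - 1)) = q ^ (κ a - κ b) := by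
      have e2 : (k : ℂˣ) ^ (2 * ((b : ℕ) - a - 1)) =
          k ^ ((n : ℤ) - 2 * (a : ℕ)) * (k ^ 2 * k ^ ((n : ℤ) - 2 * (b : ℕ)))⁻¹ := by
        rw [← zpow_natCast, ← zpow_natCast, ← zpow_add, ← zpow_neg, ← zpow_add]
        congr 1
        rw [Nat.sub_sub]
        push_cast [Nat.succ_le_of_lt hab']
        ring
      rw [e2, mul_inv_eq_iff_eq_mul, sub_eq_add_neg (κ a), zpow_add q, mul_assoc (q ^ κ a),
        mul_left_comm (q ^ (-κ b)) (k ^ 2), ← h, zpow_neg q, mul_inv_cancel_left]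
    rcases Nat.eq_zero_or_pos ((b : ℕ) - a - 1) with h0 | h0
    · rw [h0, mul_zero, pow_zero] at e
      have := hq _ e.symm
      omega
    · exact hk _ h0 (by omega) _ e

/-- If `ν` and `ν + ε_j` are both dominant, then `ν_a > ν_j` for `a < j`, and `(ν + ε_j)_b < (ν +
ε_j)_j` for `b > j`. These are the strict inequalities that `torus_separated` needs for the two
halves of `goodAt_shift_single`. Backward steps use `GoodAt.symm`. -/
theorem goodAt_dominant (hq : ∀ m : ℤ, q ^ m = 1 → m = 0)
    (hk : ∀ j : ℕ, 1 ≤ j → j ≤ n + 1 → ∀ m : ℤ, k ^ (2 * j) ≠ q ^ m) (ν : Lattice n)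
    (hν : Dominant ν) :
    GoodAt q k (shiftAlg q ν) (tpow k (delta n)) (tpow q (-ν) * tpow k (delta n)) := by
  have h0 : tpow q (0 : Lattice n) * tpow k (delta n) = tpow k (delta n) := by
    funext i; simp [tpow_apply]
  have hstep : ∀ (ν : Lattice n) (j : Fin (n + 1)), Dominant ν → Dominant (ν + Pi.single j 1) →
      GoodAt q k (shiftAlg q (Pi.single j 1)) (tpow q (-ν) * tpow k (delta n))
        (tpow q (-(ν + Pi.single j 1)) * tpow k (delta n)) := by
    intro ν j hν hν'
    apply goodAt_shift_single hq
    · intro a ha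
      apply torus_separated hq hk ha
      have := hν' ha.le
      simp [ha.ne] at this
      omega
    · funext i
      simp only [Pi.mul_apply, tpow_apply, Pi.neg_apply, Pi.add_apply, neg_add, zpow_add]
      rw [mul_comm (q ^ (-ν i)), mul_assoc]
    · intro b hb
      apply torus_separated hq hk hb
      have := hν hb.le
      simp [hb.ne']
      omega
  refine dominant_induction (P := fun ν => GoodAt q k (shiftAlg q ν) (tpow k (delta n))
    (tpow q (-ν) * tpow k (delta n))) ?_ ?_ ν hν
  · rw [shiftAlg_zero, neg_zero, h0]
    exact GoodAt.one hq _
  · intro ν j hν hν'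
    have hs := hstep ν j hν hν'
    rw [shiftAlg_add]
    constructor
    · intro h
      exact h.mul hq hs
    · intro h
      have := h.mul hq hs.symm
      rwa [mul_inv_cancel_right] at this

end Dominant
end
end BqKZ

namespace BqKZ
noncomputable section

/-! ### Specialisation of the coefficients -/

section Specialisation

variable {n : ℕ} {t t' : Torus n}

/-- The coefficients of `x` are regular at `t`, and their values there are the coefficients
of `p`. -/
def Specialises (t : Torus n) (x : AddMonoidAlgebra (RatFun n) (Lattice n)) (p : Laurent n) :
    Prop :=
  ∃ F : AddMonoidAlgebra (regRing t) (Lattice n),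
    AddMonoidAlgebra.mapRingHom (Lattice n) (regRing t).subtype F = x ∧
    AddMonoidAlgebra.mapRingHom (Lattice n) (evalReg t) F = p

theorem Specialises.add {x y : AddMonoidAlgebra (RatFun n) (Lattice n)} {p r : Laurent n}
    (h : Specialises t x p) (h' : Specialises t y r) : Specialises t (x + y) (p + r) := by
  obtain ⟨F, rfl, rfl⟩ := h
  obtain ⟨G, rfl, rfl⟩ := h'
  exact ⟨F + G, map_add _ _ _, map_add _ _ _⟩

theorem Specialises.mul {x y : AddMonoidAlgebra (RatFun n) (Lattice n)} {p r : Laurent n}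
    (h : Specialises t x p) (h' : Specialises t y r) : Specialises t (x * y) (p * r) := by
  obtain ⟨F, rfl, rfl⟩ := h
  obtain ⟨G, rfl, rfl⟩ := h'
  exact ⟨F * G, map_mul _ _ _, map_mul _ _ _⟩

theorem specialises_zero (t : Torus n) : Specialises t 0 0 := ⟨0, map_zero _, map_zero _⟩

theorem specialises_one (t : Torus n) : Specialises t 1 1 := ⟨1, map_one _, map_one _⟩

theorem Specialises.sum {ι : Type*} {s : Finset ι}
    {x : ι → AddMonoidAlgebra (RatFun n) (Lattice n)} {p : ι → Laurent n}
    (h : ∀ i ∈ s, Specialises t (x i) (p i)) :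
    Specialises t (∑ i ∈ s, x i) (∑ i ∈ s, p i) := by
  classical
  induction s using Finset.induction_on with
  | empty => exact specialises_zero t
  | insert a s ha ih =>
    rw [Finset.sum_insert ha, Finset.sum_insert ha]
    exact (h a (Finset.mem_insert_self a s)).add
      (ih fun i hi => h i (Finset.mem_insert_of_mem hi))

theorem specialises_single (κ : Lattice n) {a : RatFun n} {z : ℂ} (h : HasValueAt t a z) :
    Specialises t (AddMonoidAlgebra.single κ a) (AddMonoidAlgebra.single κ z) := by
  refine ⟨AddMonoidAlgebra.single κ ⟨a, h.mem_regRing⟩, by simp, ?_⟩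
  rw [AddMonoidAlgebra.mapRingHom_single]
  congr 1
  exact h.ratEval_eq

theorem Specialises.unique {x : AddMonoidAlgebra (RatFun n) (Lattice n)} {p r : Laurent n}
    (h : Specialises t x p) (h' : Specialises t x r) : p = r := by
  obtain ⟨F, rfl, rfl⟩ := h
  obtain ⟨G, hG, rfl⟩ := h'
  congr 1
  refine AddMonoidAlgebra.coeff_injective (Finsupp.ext fun κ => ?_)
  have h := congrArg (fun x => x.coeff κ) hG
  simp only [AddMonoidAlgebra.coeff_mapRingHom, Subring.subtype_apply, SetLike.coe_eq_coe] at h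
  exact h.symm

/-- A map that is compatible with specialisation on monomials is so everywhere. -/
theorem Specialises.map {x : AddMonoidAlgebra (RatFun n) (Lattice n)} {p : Laurent n}
    (f : AddMonoidAlgebra (RatFun n) (Lattice n) →+* AddMonoidAlgebra (RatFun n) (Lattice n))
    (g : Laurent n →+* Laurent n)
    (hfg : ∀ κ a z, HasValueAt t a z → Specialises t' (f (AddMonoidAlgebra.single κ a))
      (g (AddMonoidAlgebra.single κ z)))
    (h : Specialises t x p) : Specialises t' (f x) (g p) := by
  obtain ⟨F, rfl, rfl⟩ := h
  induction F using AddMonoidAlgebra.induction_linear with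
  | zero => simpa using specialises_zero t'
  | add F G hF hG => simp only [map_add]; exact hF.add hG
  | single κ a =>
    simp only [AddMonoidAlgebra.mapRingHom_single]
    exact hfg _ _ _ (hasValueAt_ratEval a.2)

theorem Specialises.coefMap {x : AddMonoidAlgebra (RatFun n) (Lattice n)} {p : Laurent n}
    {A : RatFun n ≃ₐ[ℂ] RatFun n} (hA : Moves A t t') (h : Specialises t' x p) :
    Specialises t (coefMap A x) p :=
  h.map (BqKZ.coefMap A) (RingHom.id _) fun κ a z hz => by
    rw [coefMap_single]; exact specialises_single κ (hA a z hz)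

theorem Specialises.negHom {x : AddMonoidAlgebra (RatFun n) (Lattice n)} {p : Laurent n}
    (h : Specialises t x p) : Specialises t (negHom _ n x) (negHom _ n p) :=
  h.map (BqKZ.negHom _ n) (BqKZ.negHom _ n) fun κ a z hz => by
    rw [negHom_single, negHom_single]; exact specialises_single _ hz

theorem Specialises.permHom (w : Equiv.Perm (Fin (n + 1)))
    {x : AddMonoidAlgebra (RatFun n) (Lattice n)} {p : Laurent n}
    (h : Specialises t x p) : Specialises t (permHom _ w x) (permHom _ w p) :=
  h.map (BqKZ.permHom _ w) (BqKZ.permHom _ w) fun κ a z hz => by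
    rw [permHom_single, permHom_single]; exact specialises_single _ hz

theorem Specialises.rotHom (q : ℂˣ)
    {x : AddMonoidAlgebra (RatFun n) (Lattice n)} {p : Laurent n}
    (h : Specialises t x p) : Specialises t (rotHom q x) (rotHom q p) :=
  h.map (BqKZ.rotHom q) (BqKZ.rotHom q) fun κ a z hz => by
    rw [rotHom_single, rotHom_single]
    exact specialises_single _ (hz.mul (hasValueAt_const t _))

theorem specialises_sum_single {x : AddMonoidAlgebra (RatFun n) (Lattice n)}
    (h : x ∈ regPoly t) :
    Specialises t x (x.coeff.sum fun κ a => AddMonoidAlgebra.single κ (ratEval t a)) := by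
  have h' := mem_regPoly.1 h
  conv => enter [2]; rw [← AddMonoidAlgebra.sum_coeff_single x]
  exact Specialises.sum fun κ _ => specialises_single κ (hasValueAt_ratEval (h' κ))

/-- Entrywise specialisation. -/
def SpecialisesMat (t : Torus n)
    (M : Matrix (Equiv.Perm (Fin (n + 1))) (Equiv.Perm (Fin (n + 1)))
      (AddMonoidAlgebra (RatFun n) (Lattice n)))
    (P : Matrix (Equiv.Perm (Fin (n + 1))) (Equiv.Perm (Fin (n + 1))) (Laurent n)) : Prop :=
  ∀ u v, Specialises t (M u v) (P u v)

variable {M M' : Matrix (Equiv.Perm (Fin (n + 1))) (Equiv.Perm (Fin (n + 1)))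
      (AddMonoidAlgebra (RatFun n) (Lattice n))}
    {P P' : Matrix (Equiv.Perm (Fin (n + 1))) (Equiv.Perm (Fin (n + 1))) (Laurent n)}

theorem SpecialisesMat.mul (h : SpecialisesMat t M P) (h' : SpecialisesMat t M' P') :
    SpecialisesMat t (M * M') (P * P') := fun u v => by
  rw [Matrix.mul_apply, Matrix.mul_apply]
  exact Specialises.sum fun w _ => (h u w).mul (h' w v)

theorem SpecialisesMat.unique (h : SpecialisesMat t M P) (h' : SpecialisesMat t M P') : P = P' := by
  ext1 u v
  exact (h u v).unique (h' u v)

theorem specialisesMat_one (t : Torus n) : SpecialisesMat t 1 1 := fun u v => by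
  rw [Matrix.one_apply, Matrix.one_apply]
  split_ifs
  exacts [specialises_one t, specialises_zero t]

theorem specialisesMat_rotMat {a : Fin (n + 1) → AddMonoidAlgebra (RatFun n) (Lattice n)}
    {b : Fin (n + 1) → Laurent n} (h : ∀ j, Specialises t (a j) (b j)) :
    SpecialisesMat t (rotMat a) (rotMat b) := fun u v => by
  rw [rotMat, rotMat]
  split_ifs
  exacts [h _, specialises_zero t]

theorem specialisesMat_interMat {c z : AddMonoidAlgebra (RatFun n) (Lattice n)}
    {c' z' : Laurent n} (hc : Specialises t c c') (hz : Specialises t z z') (i : Fin n) :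
    SpecialisesMat t (interMat c z i) (interMat c' z' i) := by
  obtain ⟨F, rfl, rfl⟩ := hc
  obtain ⟨G, rfl, rfl⟩ := hz
  rw [← interMat_map, ← interMat_map]
  exact fun u v => ⟨_, rfl, rfl⟩

theorem SpecialisesMat.iotaMat_negHom (h : SpecialisesMat t M P) :
    SpecialisesMat t (iotaMat (M.map (negHom _ n))) (iotaMat (P.map (negHom _ n))) :=
  fun u v => (h u⁻¹ v⁻¹).negHom

end Specialisation

end
end BqKZ

namespace BqKZ
noncomputable section

/-! ### Laurent polynomials as rational functions, and their values -/

section Values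

variable {n : ℕ} {t t' : Torus n}

theorem toRat_single (κ : Lattice n) (a : ℂ) :
    toRat (AddMonoidAlgebra.single κ a) =
      algebraMap ℂ (RatFun n) a * ∏ i, xvar i ^ κ i := by
  simp [toRat, AddMonoidAlgebra.lift_single, monom, Algebra.smul_def]

theorem evalL_single (t : Torus n) (κ : Lattice n) (a : ℂ) :
    evalL t (AddMonoidAlgebra.single κ a) = a * ∏ i, (t i : ℂ) ^ κ i := by
  simp [evalL, AddMonoidAlgebra.lift_single, monom]

theorem HasValueAt.zpow {f : RatFun n} {z : ℂ} (hf : HasValueAt t f z) (hz : z ≠ 0) (m : ℤ) :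
    HasValueAt t (f ^ m) (z ^ m) := by
  induction m with
  | zero => simpa using hasValueAt_const t 1
  | succ m ih =>
    have hf0 : f ≠ 0 := by
      rintro rfl
      exact hz (hf.unique (by simpa using hasValueAt_const t 0))
    rw [zpow_add_one₀ hz, zpow_add_one₀ hf0]
    exact ih.mul hf
  | pred m ih =>
    have hf0 : f ≠ 0 := by
      rintro rfl
      exact hz (hf.unique (by simpa using hasValueAt_const t 0))
    rw [zpow_sub_one₀ hz, zpow_sub_one₀ hf0]
    exact ih.mul (hf.inv hz)

theorem HasValueAt.sum {ι : Type*} {s : Finset ι} {f : ι → RatFun n} {z : ι → ℂ}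
    (h : ∀ i ∈ s, HasValueAt t (f i) (z i)) : HasValueAt t (∑ i ∈ s, f i) (∑ i ∈ s, z i) := by
  classical
  induction s using Finset.induction_on with
  | empty => simpa using hasValueAt_const t 0
  | insert a s ha ih =>
    rw [Finset.sum_insert ha, Finset.sum_insert ha]
    exact (h a (Finset.mem_insert_self a s)).add
      (ih fun i hi => h i (Finset.mem_insert_of_mem hi))

theorem HasValueAt.prod {ι : Type*} {s : Finset ι} {f : ι → RatFun n} {z : ι → ℂ}
    (h : ∀ i ∈ s, HasValueAt t (f i) (z i)) : HasValueAt t (∏ i ∈ s, f i) (∏ i ∈ s, z i) := by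
  classical
  induction s using Finset.induction_on with
  | empty => simpa using hasValueAt_const t 1
  | insert a s ha ih =>
    rw [Finset.prod_insert ha, Finset.prod_insert ha]
    exact (h a (Finset.mem_insert_self a s)).mul
      (ih fun i hi => h i (Finset.mem_insert_of_mem hi))

theorem hasValueAt_toRat (t : Torus n) (p : Laurent n) : HasValueAt t (toRat p) (evalL t p) := by
  induction p using AddMonoidAlgebra.induction_linear with
  | zero => simpa using hasValueAt_const t 0
  | add f g hf hg => simp only [map_add]; exact hf.add hg
  | single κ a =>
    rw [toRat_single, evalL_single]
    exact (hasValueAt_const t a).mul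
      (HasValueAt.prod fun i _ => (hasValueAt_xvar t i).zpow (t i).ne_zero _)

theorem evalL_negHom (t : Torus n) (p : Laurent n) : evalL t (negHom ℂ n p) = evalL t⁻¹ p := by
  induction p using AddMonoidAlgebra.induction_linear with
  | zero => simp
  | add f g hf hg => simp [hf, hg]
  | single κ a => simp [evalL_single]

/-- With `toRat_rotHom`, this identifies the substitutions on the second variable with the action of
the generators of `W` on `ℂ(T)`, so that dual relations become statements about the quantum KZ
equations. -/
theorem toRat_permHom (w : Equiv.Perm (Fin (n + 1))) (p : Laurent n) :
    toRat (permHom ℂ w p) = permAlg w (toRat p) := by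
  induction p using AddMonoidAlgebra.induction_linear with
  | zero => simp
  | add f g hf hg => simp [hf, hg]
  | single κ a =>
    rw [permHom_single, toRat_single, toRat_single, map_mul, AlgEquiv.commutes, map_prod]
    congr 1
    refine (Fintype.prod_equiv w _ _ fun i => ?_).symm
    simp

theorem toRat_rotHom (q : ℂˣ) (p : Laurent n) :
    toRat (rotHom q p) = piAlg q (toRat p) := by
  induction p using AddMonoidAlgebra.induction_linear with
  | zero => simp
  | add f g hf hg => simp [hf, hg]
  | single κ a =>
    rw [rotHom_single, toRat_single, toRat_single, map_mul (algebraMap ℂ (RatFun n)),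
      map_mul (piAlg q), AlgEquiv.commutes (piAlg q), map_prod, Algebra.algebraMap_self,
      RingHom.id_apply, mul_assoc]
    congr 1
    simp only [map_zpow₀, piAlg_xvar, mul_zpow, Finset.prod_mul_distrib]
    congr 1
    · rw [Finset.prod_eq_single (Fin.last n)]
      · rw [Pi.single_eq_same, ← map_zpow₀, ← Units.val_zpow_eq_zpow_val, ← zpow_mul, neg_one_mul]
      · intro j _ hj
        simp [hj]
      · simp
    · refine (Fintype.prod_equiv (finRotate (n + 1)) _ _ fun i => ?_).symm
      simp

theorem toRat_algebraMap (a : ℂ) :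
    toRat (algebraMap ℂ (Laurent n) a) = algebraMap ℂ (RatFun n) a := toRat.commutes a

theorem toRat_ratioMon (i : Fin n) :
    toRat (ratioMon ℂ i) = (xvar i.castSucc / xvar i.succ : RatFun n) := by
  have hne : i.castSucc ≠ i.succ := Fin.castSucc_lt_succ.ne
  rw [ratioMon, toRat_single, map_one, one_mul]
  have h : ∀ j, (xvar j : RatFun n) ^ (Pi.single i.castSucc 1 - Pi.single i.succ 1 : Lattice n) j =
      (if j = i.castSucc then xvar i.castSucc else 1) *
      (if j = i.succ then (xvar i.succ)⁻¹ else 1) := by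
    intro j
    rw [Pi.sub_apply, zpow_sub₀ (xvar_ne_zero j), Pi.single_apply, Pi.single_apply, div_eq_mul_inv]
    split_ifs with h1 h2 h2
    · exact absurd (h1.symm.trans h2) hne
    all_goals simp [*]
  rw [Finset.prod_congr rfl fun j _ => h j, Finset.prod_mul_distrib, Finset.prod_ite_eq',
    Finset.prod_ite_eq', if_pos (Finset.mem_univ _), if_pos (Finset.mem_univ _), div_eq_mul_inv]

end Values

/-! ### Solutions with central character `ζ` as vectors fixed by `W` -/

section CentralCharacter

variable {n : ℕ}

/-- Evaluation of the second variable at `ζ`. -/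
def evalSnd (ζ : Torus n) : AddMonoidAlgebra (RatFun n) (Lattice n) →ₐ[RatFun n] RatFun n :=
  AddMonoidAlgebra.lift (RatFun n) (RatFun n) (Lattice n)
    (monom fun i => Units.map (algebraMap ℂ (RatFun n)).toMonoidHom (ζ i))

theorem evalSnd_single (ζ : Torus n) (κ : Lattice n) (a : RatFun n) :
    evalSnd ζ (AddMonoidAlgebra.single κ a) =
      a * algebraMap ℂ (RatFun n) (∏ i, (ζ i : ℂ) ^ κ i) := by
  simp [evalSnd, AddMonoidAlgebra.lift_single, monom]

theorem evalSnd_coefMap (ζ : Torus n) (A : RatFun n ≃ₐ[ℂ] RatFun n)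
    (x : AddMonoidAlgebra (RatFun n) (Lattice n)) :
    evalSnd ζ (coefMap A x) = A (evalSnd ζ x) := by
  induction x using AddMonoidAlgebra.induction_linear with
  | zero => simp
  | add f g hf hg => simp [hf, hg]
  | single κ a => rw [coefMap_single, evalSnd_single, evalSnd_single, map_mul, AlgEquiv.commutes]

theorem Specialises.hasValueAt_evalSnd {t : Torus n} (ζ : Torus n)
    {x : AddMonoidAlgebra (RatFun n) (Lattice n)} {p : Laurent n} (h : Specialises t x p) :
    HasValueAt t (evalSnd ζ x) (evalL ζ p) := by
  obtain ⟨F, rfl, rfl⟩ := h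
  induction F using AddMonoidAlgebra.induction_linear with
  | zero => simpa using hasValueAt_const t 0
  | add F G hF hG => simp only [map_add]; exact hF.add hG
  | single κ a =>
    simp only [AddMonoidAlgebra.mapRingHom_single, evalSnd_single, evalL_single]
    exact (hasValueAt_ratEval a.2).mul (hasValueAt_const t _)

/-- The matrix of an automorphism with the second variable evaluated at `ζ`. -/
def cocAt (q k : ℂˣ) (ζ : Torus n) (A : RatFun n ≃ₐ[ℂ] RatFun n) :
    Matrix (Equiv.Perm (Fin (n + 1))) (Equiv.Perm (Fin (n + 1))) (RatFun n) :=
  (cocMat q k A).map (evalSnd ζ)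

theorem cocycleAt_eq (q k : ℂˣ) (ζ : Torus n) (ν : Lattice n) (u : Equiv.Perm (Fin (n + 1))) :
    cocycleAt q k ζ ν u = cocAt q k ζ (shiftAlg q ν * permAlg u) := rfl

theorem cocAt_mul {q : ℂˣ} (hq : ∀ m : ℤ, q ^ m = 1 → m = 0) (k : ℂˣ) (ζ : Torus n)
    {A B : RatFun n ≃ₐ[ℂ] RatFun n} (hA : A ∈ weylGroup q) (hB : B ∈ weylGroup q) :
    cocAt q k ζ (A * B) = cocAt q k ζ A * (cocAt q k ζ B).map A := by
  rw [cocAt, cocMat_mul hq k hA hB, Matrix.map_mul]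
  congr 1
  ext1 u v
  exact evalSnd_coefMap ζ A _

theorem cocAt_one {q : ℂˣ} (hq : ∀ m : ℤ, q ^ m = 1 → m = 0) (k : ℂˣ) (ζ : Torus n) :
    cocAt q k ζ (1 : RatFun n ≃ₐ[ℂ] RatFun n) = 1 := by
  rw [cocAt, cocMat_one hq, Matrix.map_one _ (map_zero _) (map_one _)]

theorem cocAt_simple {q : ℂˣ} (hq : ∀ m : ℤ, q ^ m = 1 → m = 0) (k : ℂˣ) (ζ : Torus n)
    (i : Fin n) : cocAt q k ζ (permAlg (simple i)) = simpleMat k i := by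
  rw [cocAt, cocMat_simple hq]
  ext1 u v
  exact (evalSnd ζ).commutes _

theorem cocAt_pi {q : ℂˣ} (hq : ∀ m : ℤ, q ^ m = 1 → m = 0) (k : ℂˣ) (ζ : Torus n) :
    cocAt q k ζ (piAlg q) = rotMat fun j => algebraMap ℂ (RatFun n) (ζ j) := by
  rw [cocAt, cocMat_pi hq]
  have h := rotMat_map (evalSnd ζ : AddMonoidAlgebra (RatFun n) (Lattice n) →+* RatFun n)
    (n := n) fun j => AddMonoidAlgebra.single (Pi.single j 1) 1
  refine h.trans ?_
  congr 1
  funext j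
  simp only [Function.comp_apply, RingHom.coe_coe, evalSnd_single, one_mul]
  congr 1
  rw [Finset.prod_eq_single j]
  · simp
  · intro i _ hi; simp [hi]
  · simp

/-- `F` is invariant under the action of `A` that is twisted by the cocycle. -/
def Fixes (q k : ℂˣ) (ζ : Torus n) (F : Equiv.Perm (Fin (n + 1)) → RatFun n)
    (A : RatFun n ≃ₐ[ℂ] RatFun n) : Prop :=
  (cocAt q k ζ A).mulVec (fun v => A (F v)) = F

theorem map_mulVec_algEquiv (A : RatFun n ≃ₐ[ℂ] RatFun n)
    (M : Matrix (Equiv.Perm (Fin (n + 1))) (Equiv.Perm (Fin (n + 1))) (RatFun n))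
    (F : Equiv.Perm (Fin (n + 1)) → RatFun n) :
    (fun v => A (M.mulVec F v)) = (M.map A).mulVec fun v => A (F v) := by
  funext v
  simp [Matrix.mulVec, dotProduct]

/-- By the cocycle relation `F ↦ C_A^ζ · A(F)` is an action of `W`, so the elements fixing `F` form
a subgroup. -/
theorem fixes_of_generators {q : ℂˣ} (hq : ∀ m : ℤ, q ^ m = 1 → m = 0) {k : ℂˣ} {ζ : Torus n}
    {F : Equiv.Perm (Fin (n + 1)) → RatFun n}
    (hs : ∀ i, Fixes q k ζ F (permAlg (simple i))) (hp : Fixes q k ζ F (piAlg q))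
    {A : RatFun n ≃ₐ[ℂ] RatFun n} (hA : A ∈ weylGroup q) : Fixes q k ζ F A := by
  have hmul : ∀ {A B : RatFun n ≃ₐ[ℂ] RatFun n}, A ∈ weylGroup q → B ∈ weylGroup q →
      (cocAt q k ζ (A * B)).mulVec (fun v => (A * B) (F v)) =
        (cocAt q k ζ A).mulVec fun v => A ((cocAt q k ζ B).mulVec (fun v => B (F v)) v) := by
    intro A B hA hB
    rw [cocAt_mul hq k ζ hA hB, map_mulVec_algEquiv, Matrix.mulVec_mulVec]
    rfl
  have hone : (cocAt q k ζ 1).mulVec (fun v => (1 : RatFun n ≃ₐ[ℂ] RatFun n) (F v)) = F := by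
    rw [cocAt_one hq, Matrix.one_mulVec]; rfl
  have hA' := hA
  unfold weylGroup at hA
  induction hA using Subgroup.closure_induction with
  | mem x hx =>
    rcases hx with ⟨i, rfl⟩ | rfl
    · exact hs i
    · exact hp
  | one => exact hone
  | mul A B hA hB ihA ihB =>
    have ihA := ihA hA
    have ihB := ihB hB
    unfold Fixes at *
    rw [hmul hA hB, ihB, ihA]
  | inv A hA ihA =>
    have ihA := ihA hA
    have h := hmul (inv_mem hA) hA
    rw [inv_mul_cancel, hone] at h
    unfold Fixes at *
    rw [ihA] at h
    exact h.symm

end CentralCharacter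

end
end BqKZ

namespace BqKZ
noncomputable section

/-! ### The constant solution `v_+` with central character `k^{-δ}` -/

section TrivialVector

variable {n : ℕ}

theorem cIota_cIota {A : Type*} (f : Equiv.Perm (Fin (n + 1)) → A) : cIota (cIota f) = f := by
  funext w
  simp [cIota]

/-- This compares the coefficients of `T_w` in `T_i v_+ = k v_+`. At a descent with `ℓ = len w` it
is `k^{ℓ-1} + (k - k⁻¹) k^ℓ = k^{ℓ+1}`. -/
theorem pow_len_simple_mul (k : ℂˣ) (i : Fin n) (w : Equiv.Perm (Fin (n + 1))) :
    (k : ℂ) ^ len (simple i * w) + descCoeff (qdiff k) i w * (k : ℂ) ^ len w =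
      k * (k : ℂ) ^ len w := by
  rcases lt_or_gt_castSucc_succ w⁻¹ i with h | h
  · have h1 := invNum_simple_mul h
    rw [descCoeff_of_lt _ h, len_eq_invNum, len_eq_invNum, h1, pow_succ, zero_mul, add_zero,
      mul_comm]
  · have h1 := invNum_simple_mul (w := simple i * w) (i := i) (by simpa using h)
    rw [← mul_assoc, simple_mul_self, one_mul] at h1
    rw [descCoeff_of_gt _ h, len_eq_invNum, len_eq_invNum, h1, pow_succ, qdiff,
      Units.val_inv_eq_inv_val]
    have := k.ne_zero
    field_simp
    ring

theorem leftMat_mulVec_pow_len (k : ℂˣ) (i : Fin n) :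
    (leftMat (qdiff k) i).mulVec (fun w => (k : ℂ) ^ len w) = fun w => (k : ℂ) * (k : ℂ) ^ len w := by
  funext u
  have h : ∀ v, leftMat (qdiff k) i u v * (k : ℂ) ^ len v =
      (if v = simple i * u then (k : ℂ) ^ len v else 0) +
        if v = u then descCoeff (qdiff k) i v * (k : ℂ) ^ len v else 0 := by
    intro v
    have h1 : u = simple i * v ↔ v = simple i * u := by
      rw [← simple_inv, ← inv_mul_eq_iff_eq_mul, inv_inv, eq_comm, simple_inv]
    simp only [leftMat, add_mul, ite_mul, one_mul, zero_mul, h1, eq_comm (a := u)]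
  simp only [Matrix.mulVec, dotProduct, h, Finset.sum_add_distrib, Finset.sum_ite_eq',
    Finset.mem_univ, if_true]
  exact pow_len_simple_mul k i u

/-- Since `s_i = 1 + c_k⁻¹ (T_i - k)`, every `k`-eigenvector of `T_i` is fixed. -/
theorem simpleMat_mulVec_pow_len (k : ℂˣ) (i : Fin n) :
    (simpleMat k i).mulVec (fun w => algebraMap ℂ (RatFun n) ((k : ℂ) ^ len w)) =
      fun w => algebraMap ℂ (RatFun n) ((k : ℂ) ^ len w) := by
  have h := leftMat_mulVec_pow_len k i
  have h1 : (leftMat (algebraMap ℂ (RatFun n) (qdiff k)) i).mulVec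
      (fun w => algebraMap ℂ (RatFun n) ((k : ℂ) ^ len w)) =
      fun w => algebraMap ℂ (RatFun n) k * algebraMap ℂ (RatFun n) ((k : ℂ) ^ len w) := by
    rw [← leftMat_map]
    funext u
    rw [← map_mul, ← congrFun h u]
    exact (RingHom.map_mulVec (algebraMap ℂ (RatFun n)) _ _ _).symm
  rw [simpleMat, Matrix.add_mulVec, Matrix.smul_mulVec, Matrix.smul_mulVec, Matrix.one_mulVec, h1]
  funext u
  simp only [Pi.add_apply, Pi.smul_apply, smul_eq_mul]
  ring

/-- The weights `k^{-δ_j}` compensate the change of `k^{len w}` under rotation computed in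
`len_finRotate_mul`. -/
theorem rotMat_mulVec_pow_len (k : ℂˣ) :
    (rotMat fun j => algebraMap ℂ (RatFun n) (tpow k (-delta n) j : ℂˣ)).mulVec
      (fun w => algebraMap ℂ (RatFun n) ((k : ℂ) ^ len w)) =
      fun w => algebraMap ℂ (RatFun n) ((k : ℂ) ^ len w) := by
  funext u
  obtain ⟨u, rfl⟩ : ∃ u', u = finRotate (n + 1) * u' := ⟨(finRotate (n + 1))⁻¹ * u, by simp⟩
  have h : ∀ v, rotMat (fun j => algebraMap ℂ (RatFun n) (tpow k (-delta n) j : ℂˣ))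
      (finRotate (n + 1) * u) v * algebraMap ℂ (RatFun n) ((k : ℂ) ^ len v) =
      if v = u then algebraMap ℂ (RatFun n) (tpow k (-delta n) (v⁻¹ (Fin.last n)) : ℂˣ) *
        algebraMap ℂ (RatFun n) ((k : ℂ) ^ len v) else 0 := by
    intro v
    simp only [rotMat, ite_mul, zero_mul, mul_right_inj, eq_comm (a := u)]
  simp only [Matrix.mulVec, dotProduct, h, Finset.sum_ite_eq', Finset.mem_univ, if_true]
  rw [← map_mul]
  congr 1
  rw [tpow, Pi.neg_apply, ← zpow_natCast, ← zpow_natCast, ← Units.val_zpow_eq_zpow_val,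
    ← Units.val_zpow_eq_zpow_val, ← Units.val_mul, ← zpow_add, len_finRotate_mul]
  congr 2
  ring

theorem fixes_vPlus {q : ℂˣ} (hq : ∀ m : ℤ, q ^ m = 1 → m = 0) (k : ℂˣ)
    {A : RatFun n ≃ₐ[ℂ] RatFun n} (hA : A ∈ weylGroup q) :
    Fixes q k (tpow k (-delta n)) (fun v => toRat (vPlus n k v)) A := by
  have hv : (fun v => toRat (vPlus n k v)) =
      fun w => algebraMap ℂ (RatFun n) ((k : ℂ) ^ len w) := by
    funext w
    rw [vPlus, toRat_algebraMap]
  rw [hv]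
  refine fixes_of_generators hq (fun i => ?_) ?_ hA
  · unfold Fixes
    simp only [AlgEquiv.commutes]
    rw [cocAt_simple hq, simpleMat_mulVec_pow_len]
  · unfold Fixes
    simp only [AlgEquiv.commutes]
    rw [cocAt_pi hq, rotMat_mulVec_pow_len]

end TrivialVector

/-! ### The dual cocycle at a fixed `γ`: invertibility and change of central character -/

section DualCocycle

variable {n : ℕ} {q k : ℂˣ}

theorem dualRegularAt_of_goodAt {ζ t' : Torus n} {ν : Lattice n}
    (h : GoodAt q k (shiftAlg q ν) ζ⁻¹ t') : DualRegularAt q k ζ ν := by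
  intro u v κ
  have := mem_regPoly.1 (h.regular u v) κ
  rwa [cocycle_eq, permAlg_one, mul_one]

/-- The specialisation of the cocycle in the first variable. -/
def cocSpec (q k : ℂˣ) (t : Torus n) (ν : Lattice n) :
    Matrix (Equiv.Perm (Fin (n + 1))) (Equiv.Perm (Fin (n + 1))) (Laurent n) :=
  fun u v => (cocMat q k (shiftAlg q ν) u v).coeff.sum fun κ a =>
    AddMonoidAlgebra.single κ (ratEval t a)

theorem specialisesMat_cocSpec {t t' : Torus n} {ν : Lattice n}
    (h : GoodAt q k (shiftAlg q ν) t t') :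
    SpecialisesMat t (cocMat q k (shiftAlg q ν)) (cocSpec q k t ν) :=
  fun u v => specialises_sum_single (h.regular u v)

theorem dualCocycleAt_eq (q k : ℂˣ) (ζ : Torus n) (ν : Lattice n) :
    dualCocycleAt q k ζ ν = iotaMat ((cocSpec q k ζ⁻¹ ν).map (negHom ℂ n)) := by
  ext1 u v
  rw [iotaMat_apply, Matrix.map_apply, dualCocycleAt, cocSpec, cocycle_eq, permAlg_one, mul_one,
    Finsupp.sum, Finsupp.sum, map_sum]
  simp only [negHom_single]

theorem specialisesMat_dualCocycleAt {ζ t' : Torus n} {ν : Lattice n}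
    (h : GoodAt q k (shiftAlg q ν) ζ⁻¹ t') :
    SpecialisesMat ζ⁻¹ (dualMat q k (shiftAlg q ν)) (dualCocycleAt q k ζ ν) := by
  rw [dualCocycleAt_eq]
  exact (specialisesMat_cocSpec h).iotaMat_negHom

/-- The identity `D_ν · ν(D_{-ν}) = 1` is specialised at `ζ⁻¹`. The second factor is then evaluated
at the translated point `t'`, where `GoodAt` guarantees its regularity. -/
theorem isUnit_dualCocycleAt (hq : ∀ m : ℤ, q ^ m = 1 → m = 0) {ζ t' : Torus n} {ν : Lattice n}
    (h : GoodAt q k (shiftAlg q ν) ζ⁻¹ t') : IsUnit (dualCocycleAt q k ζ ν) := by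
  have h' : GoodAt q k (shiftAlg q (-ν)) t' ζ⁻¹ := by
    rw [shiftAlg_neg]; exact h.symm
  have h1 := specialisesMat_dualCocycleAt h
  have h2 := (specialisesMat_cocSpec h').iotaMat_negHom
  have h3 := h1.mul fun u v => (h2 u v).coefMap h.moves
  have h4 : dualMat q k (shiftAlg q ν) *
      (dualMat q k (shiftAlg q (-ν))).map (coefMap (shiftAlg q ν)) = 1 := by
    rw [← dualMat_mul hq k h.mem h'.mem, shiftAlg_neg, mul_inv_cancel, dualMat_one hq]
  exact IsUnit.of_mul_eq_one _ (h3.unique (h4 ▸ specialisesMat_one _))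

/-- The image in `Mat(ℂ(T))` of the dual cocycle value. -/
def dualRat (q k : ℂˣ) (ζ : Torus n) (ν : Lattice n) :
    Matrix (Equiv.Perm (Fin (n + 1))) (Equiv.Perm (Fin (n + 1))) (RatFun n) :=
  (dualCocycleAt q k ζ ν).map toRat

theorem map_toRat_mul (M N : Matrix (Equiv.Perm (Fin (n + 1))) (Equiv.Perm (Fin (n + 1)))
    (Laurent n)) : (M * N).map toRat = M.map toRat * N.map toRat :=
  Matrix.map_mul (f := (toRat : Laurent n →ₐ[ℂ] RatFun n))

/-- The first variable is specialised at `t` and the second becomes the coordinate of `ℂ(T)`. Under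
this exchange of roles the substitution `τ` turns into an automorphism `B` of `ℂ(T)`. -/
theorem Intertwines.map_toRat {M : Matrix (Equiv.Perm (Fin (n + 1))) (Equiv.Perm (Fin (n + 1)))
      (AddMonoidAlgebra (RatFun n) (Lattice n))}
    {τ : AddMonoidAlgebra (RatFun n) (Lattice n) →+* AddMonoidAlgebra (RatFun n) (Lattice n)}
    {A B : RatFun n ≃ₐ[ℂ] RatFun n} (h : Intertwines q k M τ A) {t : Torus n}
    {D M₁ M₂ : Matrix (Equiv.Perm (Fin (n + 1))) (Equiv.Perm (Fin (n + 1))) (Laurent n)}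
    (hD : SpecialisesMat t (dualMat q k A) D) (hM₁ : SpecialisesMat t M M₁)
    (hM₂ : SpecialisesMat t (M.map (coefMap A)) M₂) {σ : Laurent n →+* Laurent n}
    (hτ : ∀ x p, Specialises t x p → Specialises t (τ x) (σ p))
    (hσ : ∀ p, toRat (σ p) = B (toRat p)) :
    M₁.map toRat * (D.map toRat).map B = D.map toRat * M₂.map toRat := by
  have h1 : SpecialisesMat t (M * (dualMat q k A).map τ) (M₁ * D.map σ) :=
    hM₁.mul fun u v => hτ _ _ (hD u v)
  have h2 := hD.mul hM₂
  unfold Intertwines at h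
  rw [h] at h1
  have h3 := h1.unique h2
  have e : (D.map σ).map toRat = (D.map toRat).map B := by
    ext1 u v
    exact hσ _
  rw [← e, ← map_toRat_mul, h3, map_toRat_mul]

/-- The specialised relation holds for the intertwiner with denominators cleared. As the cleared
factor is the same nonzero scalar on both sides, it cancels. -/
theorem simpleMat_mul_dualRat (hq : ∀ m : ℤ, q ^ m = 1 → m = 0) {ζ t' : Torus n} {ν : Lattice n}
    (h : GoodAt q k (shiftAlg q ν) ζ⁻¹ t') (i : Fin n) :
    simpleMat k i * (dualRat q k ζ ν).map (permAlg (simple i)) =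
      dualRat q k ζ ν * simpleMat k i := by
  have hM : SpecialisesMat ζ⁻¹
      (interMat (algebraMap (RatFun n) _ (algebraMap ℂ (RatFun n) (qdiff k)))
        (ratioMon (RatFun n) i) i)
      (interMat (algebraMap ℂ _ (qdiff k)) (ratioMon ℂ i) i) := by
    apply specialisesMat_interMat
    · rw [AddMonoidAlgebra.coe_algebraMap, AddMonoidAlgebra.coe_algebraMap]
      exact specialises_single _ (hasValueAt_const _ _)
    · exact specialises_single _ (by simpa using hasValueAt_const ζ⁻¹ 1)
  have hfix : (interMat (algebraMap (RatFun n) _ (algebraMap ℂ (RatFun n) (qdiff k)))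
        (ratioMon (RatFun n) i) i).map (coefMap (shiftAlg q ν)) =
      interMat (algebraMap (RatFun n) _ (algebraMap ℂ (RatFun n) (qdiff k)))
        (ratioMon (RatFun n) i) i := by
    rw [interMat_map]
    congr 1
    · simp [AddMonoidAlgebra.coe_algebraMap]
    · simp [ratioMon]
  have h1 := (intertwines_interMat hq k i h.mem).map_toRat (specialisesMat_dualCocycleAt h) hM
    (by rw [hfix]; exact hM) (fun _ _ hx => hx.permHom (simple i)) (toRat_permHom (simple i))
  have e : (interMat (algebraMap ℂ (Laurent n) (qdiff k)) (ratioMon ℂ i) i).map toRat =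
      interDenom k i • simpleMat k i := by
    rw [interDenom_smul_simpleMat, ← toRat_algebraMap, ← toRat_ratioMon]
    exact interMat_map (toRat : Laurent n →ₐ[ℂ] RatFun n).toRingHom _ _ i
  rw [e, smul_mul_assoc, mul_smul_comm] at h1
  exact smul_right_injective _ (interDenom_ne_zero k i) h1

theorem rotMat_map_toRat (a : Fin (n + 1) → ℂ) :
    (rotMat fun j => algebraMap ℂ (Laurent n) (a j)).map toRat =
      rotMat fun j => algebraMap ℂ (RatFun n) (a j) := by
  refine (rotMat_map (toRat : Laurent n →ₐ[ℂ] RatFun n).toRingHom _).trans ?_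
  congr 1
  funext j
  exact toRat_algebraMap _

/-- The entries `x_j⁻¹` take the value `ζ_j` at `ζ⁻¹`, but `q^{ν_j} ζ_j` after translation by `ν`.
This is the source of the change of central character. -/
theorem rotMat_mul_dualRat (hq : ∀ m : ℤ, q ^ m = 1 → m = 0) {ζ t' : Torus n} {ν : Lattice n}
    (h : GoodAt q k (shiftAlg q ν) ζ⁻¹ t') :
    (rotMat fun j => algebraMap ℂ (RatFun n) (ζ j)) * (dualRat q k ζ ν).map (piAlg q) =
      dualRat q k ζ ν * rotMat fun j => algebraMap ℂ (RatFun n) ((tpow q ν * ζ) j : ℂˣ) := by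
  have hx : ∀ j, HasValueAt ζ⁻¹ (xvar j)⁻¹ (ζ j : ℂ) := by
    intro j
    have h := (hasValueAt_xvar ζ⁻¹ j).inv (ζ⁻¹ j).ne_zero
    simpa using h
  have hM : SpecialisesMat ζ⁻¹ (rotMat fun j => algebraMap (RatFun n) _ (xvar j)⁻¹)
      (rotMat fun j => algebraMap ℂ (Laurent n) (ζ j)) := by
    refine specialisesMat_rotMat fun j => ?_
    rw [AddMonoidAlgebra.coe_algebraMap, AddMonoidAlgebra.coe_algebraMap]
    exact specialises_single _ (hx j)
  have hM' : SpecialisesMat ζ⁻¹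
      ((rotMat fun j => algebraMap (RatFun n) _ (xvar j)⁻¹).map (coefMap (shiftAlg q ν)))
      (rotMat fun j => algebraMap ℂ (Laurent n) ((tpow q ν * ζ) j : ℂˣ)) := by
    rw [rotMat_map]
    refine specialisesMat_rotMat fun j => ?_
    rw [Function.comp_apply, AddMonoidAlgebra.coe_algebraMap, AddMonoidAlgebra.coe_algebraMap]
    simp only [Function.comp_apply, coefMap_single, Algebra.algebraMap_self, RingHom.id_apply]
    apply specialises_single
    rw [map_inv₀, shiftAlg_xvar, mul_inv, ← map_inv₀, ← Units.val_inv_eq_inv_val, zpow_neg, inv_inv,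
      Pi.mul_apply, Units.val_mul]
    exact (hasValueAt_const _ _).mul (hx j)
  have h1 := (intertwines_rotMat hq k h.mem).map_toRat (specialisesMat_dualCocycleAt h) hM hM'
    (fun _ _ hx => hx.rotHom q) (toRat_rotHom q)
  rwa [rotMat_map_toRat, rotMat_map_toRat] at h1

/-- The matrix `dualRat` carries the twisted action with character `q^ν ζ` to the one with character
`ζ`. It is injective, so the preimage of a fixed vector is fixed; the two preceding relations check
this on generators. -/
theorem fixes_of_dualRat_mulVec (hq : ∀ m : ℤ, q ^ m = 1 → m = 0) {ζ t' : Torus n} {ν : Lattice n}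
    (h : GoodAt q k (shiftAlg q ν) ζ⁻¹ t') {F : Equiv.Perm (Fin (n + 1)) → RatFun n}
    {G : Equiv.Perm (Fin (n + 1)) → RatFun n} (hFG : (dualRat q k ζ ν).mulVec F = G)
    (hG : ∀ A ∈ weylGroup q, Fixes q k ζ G A) {A : RatFun n ≃ₐ[ℂ] RatFun n}
    (hA : A ∈ weylGroup q) : Fixes q k (tpow q ν * ζ) F A := by
  have hD : IsUnit (dualRat q k ζ ν) :=
    (isUnit_dualCocycleAt hq h).map (toRat : Laurent n →ₐ[ℂ] RatFun n).toRingHom.mapMatrix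
  have key : ∀ B ∈ weylGroup q, cocAt q k ζ B * (dualRat q k ζ ν).map B =
      dualRat q k ζ ν * cocAt q k (tpow q ν * ζ) B → Fixes q k (tpow q ν * ζ) F B := by
    intro B hB hrel
    apply Matrix.mulVec_injective_of_isUnit hD
    rw [hFG, Matrix.mulVec_mulVec, ← hrel, ← Matrix.mulVec_mulVec, ← map_mulVec_algEquiv, hFG]
    exact hG B hB
  refine fixes_of_generators hq (fun i => ?_) ?_ hA
  · apply key _ (permAlg_mem_weylGroup q _)
    rw [cocAt_simple hq, cocAt_simple hq]
    exact simpleMat_mul_dualRat hq h i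
  · apply key _ (piAlg_mem_weylGroup q)
    rw [cocAt_pi hq, cocAt_pi hq]
    exact rotMat_mul_dualRat hq h

end DualCocycle

end
end BqKZ

namespace BqKZ
noncomputable section

/-! ### Evaluation at `k^δ` and self-duality -/

section SelfDuality

variable {n : ℕ} {q k : ℂˣ}

theorem tpow_neg_inv (q : ℂˣ) (ν : Lattice n) : (tpow q (-ν))⁻¹ = tpow q ν := by
  funext i
  simp [tpow]

theorem tpow_mul_tpow_inv (q k : ℂˣ) (ν κ : Lattice n) :
    (tpow q (-ν) * tpow k κ)⁻¹ = tpow q ν * tpow k (-κ) := by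
  rw [mul_inv, tpow_neg_inv, ← tpow_neg_inv k (-κ), neg_neg]

theorem goodAt_dominant_inv (hq : ∀ m : ℤ, q ^ m = 1 → m = 0)
    (hk : ∀ j : ℕ, 1 ≤ j → j ≤ n + 1 → ∀ m : ℤ, k ^ (2 * j) ≠ q ^ m) (ν : Lattice n)
    (hν : Dominant ν) :
    GoodAt q k (shiftAlg q ν) (tpow k (-delta n))⁻¹ (tpow q (-ν) * tpow k (delta n)) := by
  rw [tpow_neg_inv]
  exact goodAt_dominant hq hk ν hν

theorem dualCocycleAt_mulVec_Q
    (h : IsUnit (dualCocycleAt q k (tpow k (-delta n)) ν)) :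
    (dualCocycleAt q k (tpow k (-delta n)) ν).mulVec (Q q k ν) = vPlus n k := by
  rw [Q, Matrix.mulVec_mulVec, Matrix.mul_nonsing_inv _ ((Matrix.isUnit_iff_isUnit_det _).1 h),
    Matrix.one_mulVec]

theorem fixes_Q (hq : ∀ m : ℤ, q ^ m = 1 → m = 0)
    (hk : ∀ j : ℕ, 1 ≤ j → j ≤ n + 1 → ∀ m : ℤ, k ^ (2 * j) ≠ q ^ m) {ν : Lattice n}
    (hν : Dominant ν) {A : RatFun n ≃ₐ[ℂ] RatFun n} (hA : A ∈ weylGroup q) :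
    Fixes q k (tpow q ν * tpow k (-delta n)) (fun v => toRat (Q q k ν v)) A := by
  have h := goodAt_dominant_inv hq hk ν hν
  refine fixes_of_dualRat_mulVec hq h (G := fun v => toRat (vPlus n k v)) ?_
    (fun A hA => fixes_vPlus hq k hA) hA
  funext u
  rw [← dualCocycleAt_mulVec_Q (isUnit_dualCocycleAt hq h)]
  exact (RingHom.map_mulVec (toRat : Laurent n →ₐ[ℂ] RatFun n).toRingHom _ _ _).symm

/-- The value of the cocycle at `(k^δ, y)`. -/
def cocValue (q k : ℂˣ) (ν : Lattice n) (y : Torus n) :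
    Matrix (Equiv.Perm (Fin (n + 1))) (Equiv.Perm (Fin (n + 1))) ℂ :=
  (cocSpec q k (tpow k (-delta n))⁻¹ ν).map (evalL y)

theorem map_evalL_dualCocycleAt (ν : Lattice n) (t : Torus n) :
    (dualCocycleAt q k (tpow k (-delta n)) ν).map (evalL t) = iotaMat (cocValue q k ν t⁻¹) := by
  rw [dualCocycleAt_eq, ← iotaMat_map, Matrix.map_map, cocValue]
  congr 2
  funext p
  exact evalL_negHom t p

theorem isUnit_cocValue (hq : ∀ m : ℤ, q ^ m = 1 → m = 0)
    (hk : ∀ j : ℕ, 1 ≤ j → j ≤ n + 1 → ∀ m : ℤ, k ^ (2 * j) ≠ q ^ m) {ν : Lattice n}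
    (hν : Dominant ν) (y : Torus n) : IsUnit (cocValue q k ν y) := by
  have h := (isUnit_dualCocycleAt hq (goodAt_dominant_inv hq hk ν hν)).map
    (evalL y⁻¹ : Laurent n →ₐ[ℂ] ℂ).toRingHom.mapMatrix
  have e : (evalL y⁻¹ : Laurent n →ₐ[ℂ] ℂ).toRingHom.mapMatrix
      (dualCocycleAt q k (tpow k (-delta n)) ν) = iotaMat (cocValue q k ν y) := by
    rw [← inv_inv y, ← map_evalL_dualCocycleAt, inv_inv]
    rfl
  rw [e] at h
  obtain ⟨N, hN⟩ := h.exists_right_inv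
  refine IsUnit.of_mul_eq_one (iotaMat N) ?_
  have h1 := congrArg iotaMat hN
  rw [iotaMat_mul, iotaMat_one] at h1
  rw [← h1]
  congr 1

theorem evalH_vPlus (t : Torus n) : evalH t (vPlus n k) = fun w => (k : ℂ) ^ len w := by
  funext w
  exact (evalL t).commutes _

theorem cIota_pow_len (k : ℂˣ) : (cIota fun w : Equiv.Perm (Fin (n + 1)) => (k : ℂ) ^ len w) =
    fun w => (k : ℂ) ^ len w := by
  funext w
  rw [cIota, len_inv]

/-- This is the equation defining `Q_ν`, evaluated at `t` and conjugated by `C_ι`. The right side is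
unchanged because `w` and `w⁻¹` have the same length. -/
theorem cocValue_mulVec_cIota (hq : ∀ m : ℤ, q ^ m = 1 → m = 0)
    (hk : ∀ j : ℕ, 1 ≤ j → j ≤ n + 1 → ∀ m : ℤ, k ^ (2 * j) ≠ q ^ m) {ν : Lattice n}
    (hν : Dominant ν) (t : Torus n) :
    (cocValue q k ν t⁻¹).mulVec (cIota (evalH t (Q q k ν))) = fun w => (k : ℂ) ^ len w := by
  have h := dualCocycleAt_mulVec_Q (isUnit_dualCocycleAt hq (goodAt_dominant_inv hq hk ν hν))
  have h1 : ((dualCocycleAt q k (tpow k (-delta n)) ν).map (evalL t)).mulVec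
      (evalH t (Q q k ν)) = fun w => (k : ℂ) ^ len w := by
    rw [← evalH_vPlus t, ← h]
    funext u
    exact (RingHom.map_mulVec (evalL t : Laurent n →ₐ[ℂ] ℂ).toRingHom _ _ _).symm
  rw [map_evalL_dualCocycleAt, iotaMat_mulVec] at h1
  rw [← cIota_cIota (Matrix.mulVec _ _), h1, cIota_pow_len]

/-- The quantum KZ equation may be evaluated at `t = k^δ` because its coefficient matrix is regular
there; translation by `ν` moves the argument of `f` to `q^{-ν} k^δ`. -/
theorem cocValue_mulVec_evalH (hq : ∀ m : ℤ, q ^ m = 1 → m = 0)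
    (hk : ∀ j : ℕ, 1 ≤ j → j ≤ n + 1 → ∀ m : ℤ, k ^ (2 * j) ≠ q ^ m) {ν : Lattice n}
    (hν : Dominant ν) {ζ : Torus n} {f : Equiv.Perm (Fin (n + 1)) → Laurent n}
    (hf : Fixes q k ζ (fun v => toRat (f v)) (shiftAlg q ν)) :
    (cocValue q k ν ζ).mulVec (evalH (tpow q (-ν) * tpow k (delta n)) f) =
      evalH (tpow k (delta n)) f := by
  funext u
  have h := specialisesMat_cocSpec (goodAt_dominant_inv hq hk ν hν)
  rw [tpow_neg_inv] at h
  have h1 : HasValueAt (tpow k (delta n))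
      ((cocAt q k ζ (shiftAlg q ν)).mulVec (fun v => shiftAlg q ν (toRat (f v))) u)
      ((cocValue q k ν ζ).mulVec (evalH (tpow q (-ν) * tpow k (delta n)) f) u) := by
    rw [cocValue, tpow_neg_inv]
    exact HasValueAt.sum fun v _ => ((h u v).hasValueAt_evalSnd ζ).mul
      (moves_shiftAlg q ν _ _ _ (hasValueAt_toRat _ (f v)))
  unfold Fixes at hf
  rw [hf] at h1
  exact h1.unique (hasValueAt_toRat _ _)

/-- Because `(k^δ)⁻¹ = k^{-δ}` is the central character of `v_+`, both `C_ι Q_ν(k^δ)` and `v_+`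
solve the same invertible linear system. -/
theorem evalH_Q_delta (hq : ∀ m : ℤ, q ^ m = 1 → m = 0)
    (hk : ∀ j : ℕ, 1 ≤ j → j ≤ n + 1 → ∀ m : ℤ, k ^ (2 * j) ≠ q ^ m) {ν : Lattice n}
    (hν : Dominant ν) : evalH (tpow k (delta n)) (Q q k ν) = fun w => (k : ℂ) ^ len w := by
  have h1 := cocValue_mulVec_cIota hq hk hν (tpow k (delta n))
  have h2 := cocValue_mulVec_evalH hq hk hν (fixes_vPlus hq k (shiftAlg_mem_weylGroup q ν))
  rw [evalH_vPlus, evalH_vPlus] at h2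
  have e : (tpow k (delta n))⁻¹ = tpow k (-delta n) := by
    rw [← tpow_neg_inv k (-delta n), neg_neg]
  rw [e] at h1
  have h3 := Matrix.mulVec_injective_of_isUnit (isUnit_cocValue hq hk hν _) (h1.trans h2.symm)
  rw [← cIota_cIota (evalH _ _), h3, cIota_pow_len]

/-- The point `q^{-μ} k^δ` is the inverse of the central character of `Q_μ`. Thus the definition of
`Q_ν` and the quantum KZ equation for `Q_μ` involve the same invertible matrix, and both right sides
are `v_+` by `evalH_Q_delta`. -/
theorem evalH_Q_symm (hq : ∀ m : ℤ, q ^ m = 1 → m = 0)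
    (hk : ∀ j : ℕ, 1 ≤ j → j ≤ n + 1 → ∀ m : ℤ, k ^ (2 * j) ≠ q ^ m) {ν μ : Lattice n}
    (hν : Dominant ν) (hμ : Dominant μ) :
    evalH (tpow q (-μ) * tpow k (delta n)) (Q q k ν) =
      cIota (evalH (tpow q (-ν) * tpow k (delta n)) (Q q k μ)) := by
  have h1 := cocValue_mulVec_cIota hq hk hν (tpow q (-μ) * tpow k (delta n))
  have h2 := cocValue_mulVec_evalH hq hk hν (fixes_Q hq hk hμ (shiftAlg_mem_weylGroup q ν))
  rw [evalH_Q_delta hq hk hμ] at h2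
  rw [tpow_mul_tpow_inv] at h1
  have h3 := Matrix.mulVec_injective_of_isUnit (isUnit_cocValue hq hk hν _) (h1.trans h2.symm)
  rw [← h3, cIota_cIota]

theorem eq_zero_of_zpow_eq_one {r : ℝ} (hr0 : 0 < r) (hr1 : r < 1) (hqr : (q : ℂ) = (r : ℂ))
    (m : ℤ) (h : q ^ m = 1) : m = 0 := by
  have h1 : (q : ℂ) ^ m = 1 := by rw [← Units.val_zpow_eq_zpow_val, h, Units.val_one]
  rw [hqr] at h1
  have h2 : r ^ m = 1 := by exact_mod_cast h1
  exact (zpow_eq_one_iff_right₀ hr0.le hr1.ne).1 h2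

end SelfDuality

end
end BqKZ

theorem mainTheorem8 (n : ℕ) (hn : 1 ≤ n) (q k : ℂˣ)
    (r : ℝ) (hr0 : 0 < r) (hr1 : r < 1) (hqr : (q : ℂ) = (r : ℂ))
    (hk : ∀ j : ℕ, 1 ≤ j → j ≤ n + 1 → ∀ m : ℤ, k ^ (2 * j) ≠ q ^ m) :
    (∀ ν : BqKZ.Lattice n, BqKZ.Dominant ν →
      BqKZ.DualRegularAt q k (BqKZ.tpow k (-BqKZ.delta n)) ν ∧
      IsUnit (BqKZ.dualCocycleAt q k (BqKZ.tpow k (-BqKZ.delta n)) ν) ∧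
      BqKZ.SolvesQKZ q k (BqKZ.tpow q ν * BqKZ.tpow k (-BqKZ.delta n)) (BqKZ.Q q k ν) ∧
      BqKZ.IsSymmInvariant q k (BqKZ.tpow q ν * BqKZ.tpow k (-BqKZ.delta n)) (BqKZ.Q q k ν)) ∧
    (∀ ν μ : BqKZ.Lattice n, BqKZ.Dominant ν → BqKZ.Dominant μ →
      BqKZ.evalH (BqKZ.tpow q (-μ) * BqKZ.tpow k (BqKZ.delta n)) (BqKZ.Q q k ν) =
        BqKZ.cIota
          (BqKZ.evalH (BqKZ.tpow q (-ν) * BqKZ.tpow k (BqKZ.delta n)) (BqKZ.Q q k μ))) := by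
  have hq : ∀ m : ℤ, q ^ m = 1 → m = 0 := BqKZ.eq_zero_of_zpow_eq_one hr0 hr1 hqr
  refine ⟨fun ν hν => ?_, fun ν μ hν hμ => BqKZ.evalH_Q_symm hq hk hν hμ⟩
  have h := BqKZ.goodAt_dominant_inv hq hk ν hν
  refine ⟨BqKZ.dualRegularAt_of_goodAt h, BqKZ.isUnit_dualCocycleAt hq h, fun κ => ?_, fun u => ?_⟩
  · rw [BqKZ.cocycleAt_eq, BqKZ.permAlg_one, mul_one]
    exact BqKZ.fixes_Q hq hk hν (BqKZ.shiftAlg_mem_weylGroup q κ)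
  · rw [BqKZ.cocycleAt_eq, BqKZ.shiftAlg_zero, one_mul]
    exact BqKZ.fixes_Q hq hk hν (BqKZ.permAlg_mem_weylGroup q u)
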